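/- Let $d\ge 1$ and let $(X_i,Y_i)_{i\ge1}$ be i.i.d. with values in $\mathbb{R}^d\times\mathbb{R}$, where $Y_i=\mu(X_i)+\epsilon_i$ with $\mu:\mathbb{R}^d\to\mathbb{R}$ measurable, $\epsilon_i$ independent of $X_i$, $\mathbb{E}\,\epsilon_i=0$, $0<\operatorname{Var}(\epsilon_i)<\infty$ and $\mathbb{E}\,Y_i^2<\infty$. Let $X_i$ have a density $f$ with respect to Lebesgue measure for which there are constants $0<c\le C<\infty$ with $c\le f\le C$ almost everywhere with respect to the law of $X_i$. Let $x\in\operatorname{supp}(X_1)$ be such that $f$ and $\mu$ are twice continuously differentiable with bounded second derivatives in a neighborhood of $x$. For a finite non-empty set $S$ of indices let $\Phi_S(x)$ be the response $Y_i$ of the index $i\in S$ that minimizes the Euclidean distance $\|X_i-x\|$ over $S$ (ties are broken in favor of the smallest index), and for $1\le s\le n$ let $$D_n(s)(x)=\binom{n}{s}^{-1}\sum_{S\subseteq\{1,\dots,n\},\ |S|=s}\Phi_S(x).$$ Let $s_1=s_1(n)$ and $s_2=s_2(n)$ be positive integers with $s_1\ne s_2$ for all large $n$, $s_1,s_2\to\infty$,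 $s_1/n\to0$ and $s_2/n\to0$ as $n\to\infty$. Let $(w_1^*,w_2^*)$ be the solution of $$w_1+w_2=1,\qquad w_1s_1^{-2/d}+w_2s_2^{-2/d}=0,$$ and let $D_n(s_1,s_2)(x)=w_1^*D_n(s_1)(x)+w_2^*D_n(s_2)(x)$. Then $D_n(s_1,s_2)(x)$ is integrable, its bias $\Lambda=\Lambda_n=\mathbb{E}\,D_n(s_1,s_2)(x)-\mu(x)$ satisfies $$\Lambda=o\big(s_1^{-2/d}+s_2^{-2/d}\big)\qquad(n\to\infty),$$ and there are $\sigma_n>0$ with $\sigma_n^2=O\big(\tfrac{s_1}{n}+\tfrac{s_2}{n}\big)$ such that $$\frac{D_n(s_1,s_2)(x)-\mu(x)-\Lambda}{\sigma_n}\ \overset{\mathscr{D}}{\longrightarrow}\ N(0,1).$$ -/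

import Mathlib

open MeasureTheory ProbabilityTheory Filter Topology Asymptotics

noncomputable section

/-- Labels in `S` of the sample points closest to `x`; several labels in case of a tie. -/
def closestLabels {d : ℕ} (x : EuclideanSpace ℝ (Fin d)) (S : Finset ℕ)
    (z : ℕ → EuclideanSpace ℝ (Fin d) × ℝ) : Finset ℕ :=
  {i ∈ S | ∀ j ∈ S, ‖(z i).1 - x‖ ≤ ‖(z j).1 - x‖}

/-- The kernel `Φ(x; z_i, i ∈ S)`: the response of the 1-nearest neighbour of `x` in the subsample
with labels in `S`, ties being broken in favour of the smallest label
(value `0` on the empty subsample). -/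
def nearestResponse {d : ℕ} (x : EuclideanSpace ℝ (Fin d)) (S : Finset ℕ)
    (z : ℕ → EuclideanSpace ℝ (Fin d) × ℝ) : ℝ :=
  if h : (closestLabels x S z).Nonempty then (z ((closestLabels x S z).min' h)).2 else 0

/-- The distributional nearest neighbours estimator `D_n(s)(x)` on the sample `z 0, …, z (n - 1)`:
the average of the kernel over all subsamples of size `s`. -/
def dnn {d : ℕ} (n s : ℕ) (x : EuclideanSpace ℝ (Fin d))
    (z : ℕ → EuclideanSpace ℝ (Fin d) × ℝ) : ℝ :=
  (n.choose s : ℝ)⁻¹ * ∑ S ∈ (Finset.range n).powersetCard s, nearestResponse x S z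

/-- `(w₁, w₂)` solves the two linear equations for the subsampling scales `s₁, s₂` in
dimension `d`. For `0 < d` and positive `s₁, s₂` there is a solution, and then exactly one,
if and only if `s₁ ≠ s₂`. -/
def IsTwoScaleWeight (d s₁ s₂ : ℕ) (w₁ w₂ : ℝ) : Prop :=
  w₁ + w₂ = 1 ∧
    w₁ * (s₁ : ℝ) ^ (-(2 : ℝ) / (d : ℝ)) + w₂ * (s₂ : ℝ) ^ (-(2 : ℝ) / (d : ℝ)) = 0

/-- The two-scale estimator `w₁ D_n(s₁)(x) + w₂ D_n(s₂)(x)`. -/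
def twoScaleDnn {d : ℕ} (w₁ w₂ : ℝ) (n s₁ s₂ : ℕ) (x : EuclideanSpace ℝ (Fin d))
    (z : ℕ → EuclideanSpace ℝ (Fin d) × ℝ) : ℝ :=
  w₁ * dnn n s₁ x z + w₂ * dnn n s₂ x z

/-- `g` is twice continuously differentiable with bounded second derivative in a
neighbourhood of `x`. -/
def IsLocallyC2 {d : ℕ} (g : EuclideanSpace ℝ (Fin d) → ℝ) (x : EuclideanSpace ℝ (Fin d)) : Prop :=
  ∃ U : Set (EuclideanSpace ℝ (Fin d)), IsOpen U ∧ x ∈ U ∧ ContDiffOn ℝ 2 g U ∧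
    ∃ M : ℝ, ∀ y ∈ U, ‖iteratedFDeriv ℝ 2 g y‖ ≤ M

end

/-! Let `g = μ - μ x`. Averaging over subsamples gives each response a weight that depends only on
its distance rank (`dnn_eq_sum_nnWeight`), and the combined weights add up to one. Hence the
estimator is `μ x`, plus the same estimator applied to the values `g (X i)`, plus the noises
weighted by ranks (`twoScaleDnn_eq_add`). The noise term produces the normal limit; the `g` term
produces the bias, and its fluctuations must be shown to be negligible.

The difficulty is uniformity: the two weights are unbounded when the ratio of the scales approaches
one. For `s < t`, the estimator is `dnn n t` plus `-w` times the telescoped increments `dnn n (j +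
1) - dnn n j`. Each increment is `1 / (j + 1)` times a U-statistic whose kernel is the nearest minus
the second nearest response (`dnn_succ_sub_dnn`, `exists_nearestIncrement_eq`), and the weight
equations force `-w * log (t / s) ≤ d / 2` (`IsTwoScaleWeight.neg_mul_log_le`). Thus the telescoped
coefficients have bounded total mass, whatever the ratio. The same device bounds the rank weights.

Noise. Given the features, the ranks are a permutation, so the weighted noise sum has the law of a
sum with deterministic weights (`charFun_rankedSum`). With `m = max s t / n`, all weights are `O(m)`
while the sum of their squares lies between `m / 8` and a constant times `m`
(`IsTwoScaleWeight.rankWeight_bounds`). As `m → 0`, no single weight dominates, and Lindeberg's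
argument applies (`tendsto_prod_charFun`).

Fluctuations of the `g` term. Hoeffding's bound (`variance_uStatistic_le`) gives each U-statistic a
variance of at most a constant times `t / n` times the second moment of its kernel. That moment
tends to zero because the kernel sees values of `g` near `x`, apart from an event of exponentially
small probability (`IsNearestKernel.exists_integral_sq_le`). Minkowski's inequality sums the
telescoped terms, so the variance is `o(m)`, negligible against the noise.

Bias. Let `h s` be the expected nearest response among `s` points. An expansion `h s = β * s ^ (-2 /
d) + R s` with `R` of smaller order is not enough, because `-w` multiplies `R t - R s`; the
increments of `R` must be controlled. The increment `h (s + 1) - h s` is an integral, against a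
kernel living on the scale `u ~ 1 / s`, of the integral of `g` over the ball of probability `u`
around `x`. By Taylor's formula, with the linear term cancelled by symmetry, that inner integral is
asymptotic to a multiple of `u ^ (1 + 2 / d)` (`exists_tendsto_setIntegral_sublevel_div`). Summing
increments gives `|R t - R s| ≤ η * (s ^ (-2 / d) - t ^ (-2 / d))`, and multiplication by `-w` turns
the right side into exactly `η * t ^ (-2 / d)`. -/

/-- The key by which sample points are ordered: distance to `x` first, then the label. -/
noncomputable def distKey {d : ℕ} (x : EuclideanSpace ℝ (Fin d)) (ξ : ℕ → EuclideanSpace ℝ (Fin d))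
    (i : ℕ) : ℝ ×ₗ ℕ :=
  toLex (‖ξ i - x‖, i)

/-- The number of sample points with labels below `n` that come before the `i`-th one. -/
noncomputable def distRank {d : ℕ} (x : EuclideanSpace ℝ (Fin d)) (n : ℕ)
    (ξ : ℕ → EuclideanSpace ℝ (Fin d)) (i : ℕ) : ℕ :=
  ((Finset.range n).filter fun j => distKey x ξ j < distKey x ξ i).card

/-- The weight that `dnn n s` gives to the point of rank `k`. -/
noncomputable def nnWeight (n s k : ℕ) : ℝ := ((n - 1 - k).choose (s - 1) : ℝ) / (n.choose s : ℝ)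

/-! ### Distance ranks and the combinatorics of subsample averages -/

section Ranks

variable {d : ℕ} {x : EuclideanSpace ℝ (Fin d)} {ξ : ℕ → EuclideanSpace ℝ (Fin d)}

lemma distKey_injective : Function.Injective (distKey x ξ) := by
  intro i j h
  have := congrArg (fun p => (ofLex p).2) h
  simpa [distKey] using this

lemma distKey_le_iff {i j : ℕ} : distKey x ξ i ≤ distKey x ξ j ↔
    ‖ξ i - x‖ < ‖ξ j - x‖ ∨ ‖ξ i - x‖ = ‖ξ j - x‖ ∧ i ≤ j := by
  simp [distKey, Prod.Lex.toLex_le_toLex]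

lemma distKey_lt_iff {i j : ℕ} : distKey x ξ i < distKey x ξ j ↔
    ‖ξ i - x‖ < ‖ξ j - x‖ ∨ ‖ξ i - x‖ = ‖ξ j - x‖ ∧ i < j := by
  simp [distKey, Prod.Lex.toLex_lt_toLex]

lemma exists_forall_distKey_le {S : Finset ℕ} (hS : S.Nonempty) :
    ∃ i ∈ S, ∀ j ∈ S, distKey x ξ i ≤ distKey x ξ j :=
  S.exists_min_image (distKey x ξ) hS

/-- The lexicographic order on distance and label encodes the tie-breaking rule, so that the nearest
neighbour becomes the unique minimiser of an injective key. -/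
lemma nearestResponse_eq_of_forall_distKey_le {S : Finset ℕ}
    {z : ℕ → EuclideanSpace ℝ (Fin d) × ℝ} {i : ℕ} (hi : i ∈ S)
    (h : ∀ j ∈ S, distKey x (fun k => (z k).1) i ≤ distKey x (fun k => (z k).1) j) :
    nearestResponse x S z = (z i).2 := by
  have hmem : i ∈ closestLabels x S z := by
    refine Finset.mem_filter.2 ⟨hi, fun j hj => ?_⟩
    rcases distKey_le_iff.1 (h j hj) with h | h
    · exact h.le
    · exact h.1.le
  have hne : (closestLabels x S z).Nonempty := ⟨i, hmem⟩
  have hmin : (closestLabels x S z).min' hne = i := by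
    refine le_antisymm (Finset.min'_le _ _ hmem) (Finset.le_min' _ _ _ fun j hj => ?_)
    have hj' := Finset.mem_filter.1 hj
    rcases distKey_le_iff.1 (h j hj'.1) with h | h
    · exact absurd (hj'.2 i hi) (not_le.2 h)
    · exact h.2
  rw [nearestResponse, dif_pos hne, hmin]

open Classical in
lemma nearestResponse_eq_sum (S : Finset ℕ) (z : ℕ → EuclideanSpace ℝ (Fin d) × ℝ) :
    nearestResponse x S z = ∑ i ∈ S, if ∀ j ∈ S,
      distKey x (fun k => (z k).1) i ≤ distKey x (fun k => (z k).1) j then (z i).2 else 0 := by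
  rcases S.eq_empty_or_nonempty with rfl | hS
  · simp [nearestResponse, closestLabels]
  obtain ⟨i, hi, h⟩ := exists_forall_distKey_le (x := x) (ξ := fun k => (z k).1) hS
  rw [nearestResponse_eq_of_forall_distKey_le hi h, Finset.sum_eq_single i, if_pos h]
  · intro j hj hji
    rw [if_neg]
    intro h'
    exact hji (distKey_injective (le_antisymm (h' i hi) (h j hj)))
  · exact fun h => absurd hi h

lemma distRank_lt {n i : ℕ} (hi : i < n) : distRank x n ξ i < n := by
  have : (Finset.range n).filter (fun j => distKey x ξ j < distKey x ξ i) ⊂ Finset.range n := by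
    refine Finset.filter_ssubset.2 ⟨i, Finset.mem_range.2 hi, lt_irrefl _⟩
  simpa [distRank] using Finset.card_lt_card this

lemma distRank_injOn (n : ℕ) : Set.InjOn (distRank x n ξ) (Finset.range n : Set ℕ) := by
  have key : ∀ i ∈ Finset.range n, ∀ j ∈ Finset.range n, distKey x ξ i < distKey x ξ j →
      distRank x n ξ i < distRank x n ξ j := by
    intro i hi j hj h
    refine Finset.card_lt_card (Finset.ssubset_iff_of_subset ?_ |>.2 ⟨i, ?_, ?_⟩)
    · intro k hk
      rw [Finset.mem_filter] at hk ⊢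
      exact ⟨hk.1, hk.2.trans h⟩
    · exact Finset.mem_filter.2 ⟨hi, h⟩
    · simp
  intro i hi j hj hij
  rcases lt_trichotomy (distKey x ξ i) (distKey x ξ j) with h | h | h
  · exact absurd hij (key i hi j hj h).ne
  · exact distKey_injective h
  · exact absurd hij (key j hj i hi h).ne'

/-- An injective self-map of a finite set is onto. Consequently symmetric expressions in the rank
weights do not depend on the features, which is what makes the noise term tractable. -/
lemma image_distRank (n : ℕ) : (Finset.range n).image (distRank x n ξ) = Finset.range n := by
  refine Finset.eq_of_subset_of_card_le (fun k hk => ?_) ?_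
  · obtain ⟨i, hi, rfl⟩ := Finset.mem_image.1 hk
    exact Finset.mem_range.2 (distRank_lt (Finset.mem_range.1 hi))
  · rw [Finset.card_image_of_injOn (distRank_injOn n)]

lemma prod_distRank {M : Type*} [CommMonoid M] (n : ℕ) (g : ℕ → M) :
    ∏ i ∈ Finset.range n, g (distRank x n ξ i) = ∏ k ∈ Finset.range n, g k := by
  conv_rhs => rw [← image_distRank (x := x) (ξ := ξ) n, Finset.prod_image (distRank_injOn n)]

lemma sum_distRank (n : ℕ) (g : ℕ → ℝ) :
    ∑ i ∈ Finset.range n, g (distRank x n ξ i) = ∑ k ∈ Finset.range n, g k := by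
  conv_rhs => rw [← image_distRank (x := x) (ξ := ξ) n, Finset.sum_image (distRank_injOn n)]

lemma card_filter_distKey_gt {n i : ℕ} (hi : i < n) :
    ((Finset.range n).filter fun j => distKey x ξ i < distKey x ξ j).card
      = n - 1 - distRank x n ξ i := by
  have h1 : ((Finset.range n).filter fun j => distKey x ξ i ≤ distKey x ξ j)
      = insert i ((Finset.range n).filter fun j => distKey x ξ i < distKey x ξ j) := by
    ext j
    simp only [Finset.mem_filter, Finset.mem_insert, Finset.mem_range, le_iff_lt_or_eq]
    constructor
    · rintro ⟨hj, h | h⟩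
      · exact Or.inr ⟨hj, h⟩
      · exact Or.inl (distKey_injective h).symm
    · rintro (rfl | h)
      · exact ⟨hi, Or.inr rfl⟩
      · exact ⟨h.1, Or.inl h.2⟩
  have h2 := Finset.card_filter_add_card_filter_not (s := Finset.range n)
    (fun j => distKey x ξ j < distKey x ξ i)
  simp only [not_lt, Finset.card_range] at h2
  rw [h1, Finset.card_insert_of_notMem (by simp)] at h2
  unfold distRank
  omega

-- Such a subset is `i` together with `s - 1` points of larger key, and `n - 1 - rank` points have a
-- larger key.
open Classical in
lemma card_filter_forall_distKey_le {n s i : ℕ} (hs : 1 ≤ s) (hi : i < n) :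
    (((Finset.range n).powersetCard s).filter fun S => i ∈ S ∧
      ∀ j ∈ S, distKey x ξ i ≤ distKey x ξ j).card = (n - 1 - distRank x n ξ i).choose (s - 1) := by
  rw [← card_filter_distKey_gt hi, ← Finset.card_powersetCard]
  refine Finset.card_nbij' (fun S => S.erase i) (fun T => insert i T) ?_ ?_ ?_ ?_
  · intro S hS
    simp only [Finset.coe_filter, Finset.mem_powersetCard, Set.mem_ofPred_eq] at hS
    obtain ⟨⟨hS, hc⟩, hiS, h⟩ := hS
    simp only [Finset.mem_coe, Finset.mem_powersetCard]
    refine ⟨fun j hj => ?_, by rw [Finset.card_erase_of_mem hiS, hc]⟩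
    rw [Finset.mem_erase] at hj
    exact Finset.mem_filter.2 ⟨hS hj.2, lt_of_le_of_ne (h j hj.2)
      fun e => hj.1 (distKey_injective e).symm⟩
  · intro T hT
    simp only [Finset.mem_coe, Finset.mem_powersetCard] at hT
    obtain ⟨hT, hc⟩ := hT
    have hiT : i ∉ T := fun h => lt_irrefl _ (Finset.mem_filter.1 (hT h)).2
    simp only [Finset.coe_filter, Finset.mem_powersetCard, Set.mem_ofPred_eq]
    refine ⟨⟨?_, by rw [Finset.card_insert_of_notMem hiT, hc]; omega⟩,
      Finset.mem_insert_self _ _, ?_⟩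
    · intro j hj
      rcases Finset.mem_insert.1 hj with rfl | hj
      · exact Finset.mem_range.2 hi
      · exact (Finset.mem_filter.1 (hT hj)).1
    · intro j hj
      rcases Finset.mem_insert.1 hj with rfl | hj
      · exact le_rfl
      · exact (Finset.mem_filter.1 (hT hj)).2.le
  · intro S hS
    simp only [Finset.coe_filter, Set.mem_ofPred_eq] at hS
    exact Finset.insert_erase hS.2.1
  · intro T hT
    simp only [Finset.mem_coe, Finset.mem_powersetCard] at hT
    exact Finset.erase_insert fun h => lt_irrefl _ (Finset.mem_filter.1 (hT.1 h)).2

/-- The estimator is a weighted sum of the responses, the weights depending on the ranks only. -/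
lemma dnn_eq_sum_nnWeight {n s : ℕ} (hs : 1 ≤ s) (z : ℕ → EuclideanSpace ℝ (Fin d) × ℝ) :
    dnn n s x z = ∑ i ∈ Finset.range n,
      nnWeight n s (distRank x n (fun k => (z k).1) i) * (z i).2 := by
  classical
  set ξ : ℕ → EuclideanSpace ℝ (Fin d) := fun k => (z k).1 with hξ
  have h1 : ∀ S ∈ (Finset.range n).powersetCard s, nearestResponse x S z =
      ∑ i ∈ Finset.range n, if i ∈ S ∧ ∀ j ∈ S, distKey x ξ i ≤ distKey x ξ j
        then (z i).2 else 0 := by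
    intro S hS
    rw [nearestResponse_eq_sum, ← Finset.sum_filter, ← Finset.sum_filter]
    refine Finset.sum_congr ?_ fun _ _ => rfl
    ext i
    simp only [Finset.mem_filter]
    have := (Finset.mem_powersetCard.1 hS).1
    exact ⟨fun h => ⟨this h.1, h⟩, fun h => h.2⟩
  rw [dnn, Finset.sum_congr rfl h1, Finset.sum_comm, Finset.mul_sum]
  refine Finset.sum_congr rfl fun i hi => ?_
  rw [← Finset.sum_filter, Finset.sum_const,
    card_filter_forall_distKey_le hs (Finset.mem_range.1 hi), nnWeight, nsmul_eq_mul]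
  ring

/-- Averages over the subsets of size `j` as averages over the subsets of size `j + 1`. -/
lemma sum_powersetCard_succ_sum_erase {n j : ℕ} (g : Finset ℕ → ℝ) :
    ∑ S ∈ (Finset.range n).powersetCard (j + 1), ∑ i ∈ S, g (S.erase i)
      = ((n - j : ℕ) : ℝ) * ∑ T ∈ (Finset.range n).powersetCard j, g T := by
  have h : ∑ S ∈ (Finset.range n).powersetCard (j + 1), ∑ i ∈ S, g (S.erase i)
      = ∑ T ∈ (Finset.range n).powersetCard j, ∑ _i ∈ Finset.range n \ T, g T := by
    rw [Finset.sum_sigma', Finset.sum_sigma']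
    refine Finset.sum_bij' (fun p _ => ⟨p.1.erase p.2, p.2⟩) (fun p _ => ⟨insert p.2 p.1, p.2⟩)
      ?_ ?_ ?_ ?_ ?_
    · rintro ⟨S, i⟩ h
      simp only [Finset.mem_sigma, Finset.mem_powersetCard, Finset.mem_sdiff] at h ⊢
      exact ⟨⟨(Finset.erase_subset _ _).trans h.1.1, by
        rw [Finset.card_erase_of_mem h.2, h.1.2]; rfl⟩, h.1.1 h.2, by simp⟩
    · rintro ⟨T, i⟩ h
      simp only [Finset.mem_sigma, Finset.mem_powersetCard, Finset.mem_sdiff] at h ⊢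
      exact ⟨⟨Finset.insert_subset h.2.1 h.1.1, by
        rw [Finset.card_insert_of_notMem h.2.2, h.1.2]⟩, by simp⟩
    · rintro ⟨S, i⟩ h
      simp only [Finset.mem_sigma] at h
      simp [Finset.insert_erase h.2]
    · rintro ⟨T, i⟩ h
      simp only [Finset.mem_sigma, Finset.mem_sdiff] at h
      simp [Finset.erase_insert h.2.2]
    · rintro ⟨S, i⟩ h
      rfl
  rw [h, Finset.mul_sum]
  refine Finset.sum_congr rfl fun T hT => ?_
  have := Finset.mem_powersetCard.1 hT
  rw [Finset.sum_const, Finset.card_sdiff_of_subset this.1, Finset.card_range, this.2,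
    nsmul_eq_mul]

/-- The kernel of the increment `dnn n (j + 1) - dnn n j`, up to the factor `j + 1`. -/
noncomputable def nearestIncrement (x : EuclideanSpace ℝ (Fin d)) (S : Finset ℕ)
    (z : ℕ → EuclideanSpace ℝ (Fin d) × ℝ) : ℝ :=
  ∑ i ∈ S, (nearestResponse x S z - nearestResponse x (S.erase i) z)

/-- Deleting one element from each `(j + 1)`-subset reaches every `j`-subset `n - j` times, so both
averages become U-statistics of the same order. The gain is the factor `1 / (j + 1)`, whose sum over
the scales is logarithmic. -/
lemma dnn_succ_sub_dnn {n j : ℕ} (hj : j + 1 ≤ n) (z : ℕ → EuclideanSpace ℝ (Fin d) × ℝ) :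
    dnn n (j + 1) x z - dnn n j x z = ((j : ℝ) + 1)⁻¹ * ((n.choose (j + 1) : ℝ)⁻¹ *
      ∑ S ∈ (Finset.range n).powersetCard (j + 1), nearestIncrement x S z) := by
  have h1 : ∑ S ∈ (Finset.range n).powersetCard (j + 1), nearestIncrement x S z
      = ((j : ℝ) + 1) * ∑ S ∈ (Finset.range n).powersetCard (j + 1), nearestResponse x S z
        - ((n - j : ℕ) : ℝ) * ∑ T ∈ (Finset.range n).powersetCard j, nearestResponse x T z := by
    rw [← sum_powersetCard_succ_sum_erase, Finset.mul_sum, ← Finset.sum_sub_distrib]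
    refine Finset.sum_congr rfl fun S hS => ?_
    rw [nearestIncrement, Finset.sum_sub_distrib, Finset.sum_const,
      (Finset.mem_powersetCard.1 hS).2, nsmul_eq_mul]
    push_cast
    ring
  have h2 : (n.choose (j + 1) : ℝ) * ((j : ℝ) + 1) = n.choose j * ((n - j : ℕ) : ℝ) := by
    exact_mod_cast Nat.choose_succ_right_eq n j
  have h3 : (n.choose (j + 1) : ℝ) ≠ 0 := by
    exact_mod_cast (Nat.choose_pos hj).ne'
  have h4 : (n.choose j : ℝ) ≠ 0 := by
    exact_mod_cast (Nat.choose_pos (by omega : j ≤ n)).ne'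
  have h5 : ((n - j : ℕ) : ℝ) = (n.choose (j + 1) : ℝ) * ((j : ℝ) + 1) / n.choose j := by
    rw [h2]; field_simp
  have h6 : (j : ℝ) + 1 ≠ 0 := by positivity
  rw [h1, h5, dnn, dnn]
  field_simp

lemma exists_nearestResponse_eq {S : Finset ℕ} (hS : S.Nonempty)
    (z : ℕ → EuclideanSpace ℝ (Fin d) × ℝ) : ∃ i ∈ S, nearestResponse x S z = (z i).2 ∧
      ∀ j ∈ S, ‖(z i).1 - x‖ ≤ ‖(z j).1 - x‖ := by
  obtain ⟨i, hi, h⟩ := exists_forall_distKey_le (x := x) (ξ := fun k => (z k).1) hS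
  refine ⟨i, hi, nearestResponse_eq_of_forall_distKey_le hi h, fun j hj => ?_⟩
  rcases distKey_le_iff.1 (h j hj) with h | h
  · exact h.le
  · exact h.1.le

/-- Deleting a point other than the nearest one leaves the response unchanged, so only the deletion
of the nearest point contributes. -/
lemma exists_nearestIncrement_eq {S : Finset ℕ} (hS : S.Nonempty)
    (z : ℕ → EuclideanSpace ℝ (Fin d) × ℝ) : ∃ i ∈ S,
      nearestIncrement x S z = nearestResponse x S z - nearestResponse x (S.erase i) z := by
  obtain ⟨i, hi, h⟩ := exists_forall_distKey_le (x := x) (ξ := fun k => (z k).1) hS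
  refine ⟨i, hi, Finset.sum_eq_single i (fun j hj hji => ?_) fun h => absurd hi h⟩
  rw [nearestResponse_eq_of_forall_distKey_le hi h, nearestResponse_eq_of_forall_distKey_le
    (Finset.mem_erase.2 ⟨hji.symm, hi⟩) fun k hk => h k (Finset.mem_of_mem_erase hk), sub_self]

end Ranks

/-! ### Rank weights of a single scale -/

section Weights

lemma nnWeight_nonneg (n s k : ℕ) : 0 ≤ nnWeight n s k := by unfold nnWeight; positivity

lemma sum_range_choose_eq (n m : ℕ) : ∑ k ∈ Finset.range n, k.choose m = n.choose (m + 1) := by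
  induction n with
  | zero => simp
  | succ n ih => rw [Finset.sum_range_succ, ih, Nat.choose_succ_succ, add_comm]

lemma sum_nnWeight {n s : ℕ} (hs : 1 ≤ s) (hsn : s ≤ n) :
    ∑ k ∈ Finset.range n, nnWeight n s k = 1 := by
  have h : ∑ k ∈ Finset.range n, (n - 1 - k).choose (s - 1) = n.choose s := by
    rw [Finset.sum_range_reflect (fun k => k.choose (s - 1)), sum_range_choose_eq]
    congr 1; omega
  have h3 : (n.choose s : ℝ) ≠ 0 := by exact_mod_cast (Nat.choose_pos hsn).ne'
  unfold nnWeight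
  rw [← Finset.sum_div, div_eq_one_iff_eq h3]
  exact_mod_cast h

lemma choose_pred_div_choose {n s : ℕ} (hs : 1 ≤ s) (hsn : s ≤ n) :
    ((n - 1).choose (s - 1) : ℝ) / n.choose s = s / n := by
  obtain ⟨m, rfl⟩ : ∃ m, n = m + 1 := ⟨n - 1, by omega⟩
  obtain ⟨r, rfl⟩ : ∃ r, s = r + 1 := ⟨s - 1, by omega⟩
  have h3 : ((m + 1).choose (r + 1) : ℝ) ≠ 0 := by exact_mod_cast (Nat.choose_pos hsn).ne'
  have h4 : ((m + 1 : ℕ) : ℝ) ≠ 0 := by positivity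
  rw [div_eq_div_iff h3 h4]
  have := Nat.add_one_mul_choose_eq m r
  simp only [Nat.add_sub_cancel]
  exact_mod_cast (by linarith : m.choose r * (m + 1) = (r + 1) * (m + 1).choose (r + 1))

lemma nnWeight_le {n s : ℕ} (hs : 1 ≤ s) (hsn : s ≤ n) (k : ℕ) : nnWeight n s k ≤ s / n := by
  rw [← choose_pred_div_choose hs hsn, nnWeight]
  exact div_le_div_of_nonneg_right
    (by exact_mod_cast Nat.choose_le_choose _ (Nat.sub_le _ _)) (by positivity)

/-- The weight that the point of rank `k` gets as second nearest neighbour. -/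
noncomputable def secondWeight (n j k : ℕ) : ℝ :=
  k * ((n - 1 - k).choose (j - 1) : ℝ) / (n.choose (j + 1) : ℝ)

lemma secondWeight_nonneg (n j k : ℕ) : 0 ≤ secondWeight n j k := by
  unfold secondWeight; positivity

/-- This is the rank version of the increment kernel: the weight as nearest point minus the weight
as second nearest, with the gain `1 / (j + 1)`. -/
lemma nnWeight_succ_sub {n j k : ℕ} (hj : 1 ≤ j) (hjn : j + 1 ≤ n) (hk : k < n) :
    nnWeight n (j + 1) k - nnWeight n j k
      = (nnWeight n (j + 1) k - secondWeight n j k) / (j + 1) := by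
  have h2 : (n.choose (j + 1) : ℝ) * ((j : ℝ) + 1) = n.choose j * ((n - j : ℕ) : ℝ) := by
    exact_mod_cast Nat.choose_succ_right_eq n j
  have h3 : (n.choose (j + 1) : ℝ) ≠ 0 := by
    exact_mod_cast (Nat.choose_pos hjn).ne'
  have h4 : (n.choose j : ℝ) ≠ 0 := by
    exact_mod_cast (Nat.choose_pos (by omega : j ≤ n)).ne'
  have h6 : (j : ℝ) + 1 ≠ 0 := by positivity
  have h7 : ((n - j : ℕ) : ℝ) * ((n - 1 - k).choose (j - 1) : ℝ)
      = j * ((n - 1 - k).choose j : ℝ) + k * ((n - 1 - k).choose (j - 1) : ℝ) := by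
    have h8 := Nat.choose_succ_right_eq (n - 1 - k) (j - 1)
    rw [Nat.sub_add_cancel hj] at h8
    by_cases hle : j - 1 ≤ n - 1 - k
    · have h9 : n - j = (n - 1 - k - (j - 1)) + k := by omega
      rw [h9]
      have : ((n - 1 - k).choose j : ℝ) * j
          = (n - 1 - k).choose (j - 1) * ((n - 1 - k - (j - 1) : ℕ) : ℝ) := by exact_mod_cast h8
      rw [Nat.cast_add]
      linear_combination -this
    · rw [Nat.choose_eq_zero_of_lt (by omega : n - 1 - k < j - 1),
        Nat.choose_eq_zero_of_lt (by omega : n - 1 - k < j)]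
      simp
  have h10 : nnWeight n j k
      = ((n - j : ℕ) : ℝ) * ((n - 1 - k).choose (j - 1) : ℝ) / (n.choose (j + 1) * (j + 1)) := by
    rw [h2, nnWeight]
    have : ((n - j : ℕ) : ℝ) ≠ 0 := by
      have : n - j ≠ 0 := by omega
      exact_mod_cast this
    field_simp
  rw [h10, h7, nnWeight, secondWeight, Nat.add_sub_cancel]
  field_simp
  ring

lemma sum_secondWeight {n j : ℕ} (hj : 1 ≤ j) (hjn : j + 1 ≤ n) :
    ∑ k ∈ Finset.range n, secondWeight n j k = 1 := by
  have h : ∑ k ∈ Finset.range n, (nnWeight n (j + 1) k - nnWeight n j k)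
      = ∑ k ∈ Finset.range n, (nnWeight n (j + 1) k - secondWeight n j k) / (j + 1) :=
    Finset.sum_congr rfl fun k hk => nnWeight_succ_sub hj hjn (Finset.mem_range.1 hk)
  rw [Finset.sum_sub_distrib, sum_nnWeight (by omega) hjn, sum_nnWeight hj (by omega),
    ← Finset.sum_div, Finset.sum_sub_distrib, sum_nnWeight (by omega) hjn, sub_self, eq_comm,
    div_eq_zero_iff] at h
  rcases h with h | h
  · linarith
  · exact absurd h (by positivity)

lemma secondWeight_le {n j k : ℕ} (hj : 1 ≤ j) (hjn : j + 1 ≤ n) (hk : k < n) :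
    secondWeight n j k ≤ (j + 1 : ℕ) / n := by
  rw [← choose_pred_div_choose (by omega) hjn, secondWeight, Nat.add_sub_cancel]
  gcongr
  have h := Nat.add_choose_eq k (n - 1 - k) j
  rw [show k + (n - 1 - k) = n - 1 by omega] at h
  -- A single term of Vandermonde's expansion of `(n - 1).choose j`.
  have h2 : k.choose 1 * (n - 1 - k).choose (j - 1) ≤ (n - 1).choose j := by
    rw [h]
    exact Finset.single_le_sum (f := fun ij : ℕ × ℕ => k.choose ij.1 * (n - 1 - k).choose ij.2)
      (fun _ _ => Nat.zero_le _) (a := (1, j - 1))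
      (Finset.HasAntidiagonal.mem_antidiagonal.2 (show 1 + (j - 1) = j by omega))
  rw [Nat.choose_one_right] at h2
  exact_mod_cast h2

/-- Both weights lie between `0` and `(j + 1) / n`, hence so does the modulus of their difference;
dividing by `j + 1` gives the bound. -/
lemma abs_nnWeight_succ_sub_le {n j k : ℕ} (hj : 1 ≤ j) (hjn : j + 1 ≤ n) (hk : k < n) :
    |nnWeight n (j + 1) k - nnWeight n j k| ≤ 1 / n := by
  have hp := nnWeight_le (by omega) hjn k
  have hq := secondWeight_le hj hjn hk
  have hp0 := nnWeight_nonneg n (j + 1) k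
  have hq0 := secondWeight_nonneg n j k
  have hj0 : (0 : ℝ) < (j : ℝ) + 1 := by positivity
  have e : (1 : ℝ) / n = ((j + 1 : ℕ) : ℝ) / n / (j + 1) := by push_cast; field_simp
  rw [nnWeight_succ_sub hj hjn hk, abs_div, abs_of_pos hj0, e]
  gcongr
  exact abs_sub_le_iff.2 ⟨by linarith, by linarith⟩

lemma sum_abs_nnWeight_succ_sub_le {n j : ℕ} (hj : 1 ≤ j) (hjn : j + 1 ≤ n) :
    ∑ k ∈ Finset.range n, |nnWeight n (j + 1) k - nnWeight n j k| ≤ 2 * (1 / (j + 1)) := by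
  have hj0 : (0 : ℝ) < (j : ℝ) + 1 := by positivity
  calc ∑ k ∈ Finset.range n, |nnWeight n (j + 1) k - nnWeight n j k|
      ≤ ∑ k ∈ Finset.range n, (nnWeight n (j + 1) k + secondWeight n j k) / (j + 1) := by
        refine Finset.sum_le_sum fun k hk => ?_
        rw [nnWeight_succ_sub hj hjn (Finset.mem_range.1 hk), abs_div, abs_of_pos hj0]
        gcongr
        have hp0 := nnWeight_nonneg n (j + 1) k
        have hq0 := secondWeight_nonneg n j k
        exact abs_sub_le_iff.2 ⟨by linarith, by linarith⟩
    _ = 2 * (1 / (j + 1)) := by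
        rw [← Finset.sum_div, Finset.sum_add_distrib, sum_nnWeight (by omega) hjn,
          sum_secondWeight hj hjn]
        ring

/-- A point of low rank is more often nearest than second nearest. The hypothesis is what makes `k *
j` at most the factor `n - 1 - k - (j - 1)` in the ratio of the two binomials. -/
lemma nnWeight_le_succ {n j k : ℕ} (hj : 1 ≤ j) (hk : k * (j + 1) + (j + 1) ≤ n) :
    nnWeight n j k ≤ nnWeight n (j + 1) k := by
  have hjn : j + 1 ≤ n := by omega
  have hkn : k < n := by nlinarith
  rw [← sub_nonneg, nnWeight_succ_sub hj hjn hkn]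
  refine div_nonneg (sub_nonneg.2 ?_) (by positivity)
  rw [secondWeight, nnWeight, Nat.add_sub_cancel]
  gcongr
  have h8 := Nat.choose_succ_right_eq (n - 1 - k) (j - 1)
  rw [Nat.sub_add_cancel hj] at h8
  have h9 : k * j ≤ n - 1 - k - (j - 1) := by
    have : k * (j + 1) = k * j + k := by ring
    omega
  have h10 : k * (n - 1 - k).choose (j - 1) ≤ (n - 1 - k).choose j := by
    refine Nat.le_of_mul_le_mul_right (c := j) ?_ hj
    rw [h8]
    calc k * (n - 1 - k).choose (j - 1) * j = (n - 1 - k).choose (j - 1) * (k * j) := by ring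
      _ ≤ _ := Nat.mul_le_mul_left _ h9
  exact_mod_cast h10

lemma nnWeight_mono {n s t k : ℕ} (hs : 1 ≤ s) (hst : s ≤ t) (hk : k * t + t ≤ n) :
    nnWeight n s k ≤ nnWeight n t k := by
  induction t, hst using Nat.le_induction with
  | base => exact le_rfl
  | succ t hst ih =>
    refine (ih ?_).trans (nnWeight_le_succ (hs.trans hst) hk)
    have : k * (t + 1) = k * t + k := by ring
    omega

/-- A union bound: the `m`-subsets meeting a given set of `k` points number at most `k` times those
containing one given point. Pascal's rule removes the points one by one. -/
lemma choose_sub_mul_le_choose_sub (N m k : ℕ) (hk : k ≤ N) (hm : 1 ≤ m) :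
    (N.choose m : ℝ) - k * ((N - 1).choose (m - 1) : ℝ) ≤ ((N - k).choose m : ℝ) := by
  induction k with
  | zero => simp
  | succ k ih =>
    have h := ih (by omega)
    have h1 : ((N - k).choose m : ℝ)
        = ((N - (k + 1)).choose (m - 1) : ℝ) + ((N - (k + 1)).choose m : ℝ) := by
      obtain ⟨r, rfl⟩ : ∃ r, m = r + 1 := ⟨m - 1, by omega⟩
      rw [show N - k = (N - (k + 1)) + 1 by omega, Nat.choose_succ_succ]
      push_cast
      simp
    have h2 : ((N - (k + 1)).choose (m - 1) : ℝ) ≤ ((N - 1).choose (m - 1) : ℝ) := by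
      exact_mod_cast Nat.choose_le_choose _ (by omega)
    push_cast
    linarith

/-- The union bound costs at most the fraction `k * (t - 1) / (n - 1) ≤ 1 / 2` of the weight `t / n`
of rank zero. -/
lemma le_nnWeight {n t k : ℕ} (ht : 1 ≤ t) (hk : 2 * (k * t) ≤ n) (htn : t ≤ n) (hkn : k < n) :
    (t : ℝ) / (2 * n) ≤ nnWeight n t k := by
  have hn : (0 : ℝ) < n := by exact_mod_cast (by omega : 0 < n)
  have h1 := choose_pred_div_choose ht htn
  have h3 : (0 : ℝ) < n.choose t := by exact_mod_cast Nat.choose_pos htn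
  have key : ((n - 1).choose (t - 1) : ℝ) * (1 / 2) ≤ ((n - 1 - k).choose (t - 1) : ℝ) := by
    rcases Nat.eq_or_lt_of_le ht with rfl | ht
    · simp only [Nat.sub_self, Nat.choose_zero_right]; norm_num
    refine le_trans ?_ (choose_sub_mul_le_choose_sub (n - 1) (t - 1) k (by omega) (by omega))
    have h4 := choose_pred_div_choose (n := n - 1) (s := t - 1) (by omega) (by omega)
    have h5 : (0 : ℝ) < (n - 1).choose (t - 1) := by
      exact_mod_cast Nat.choose_pos (by omega : t - 1 ≤ n - 1)
    rw [div_eq_iff h5.ne'] at h4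
    rw [h4]
    have h6 : (k : ℝ) * (((t - 1 : ℕ) : ℝ) / ((n - 1 : ℕ) : ℝ)) ≤ 1 / 2 := by
      have hn1 : (0 : ℝ) < ((n - 1 : ℕ) : ℝ) := by exact_mod_cast (by omega : 0 < n - 1)
      rw [← mul_div_assoc, div_le_iff₀ hn1]
      have : 2 * (k * (t - 1)) ≤ n - 1 := by
        rcases Nat.eq_zero_or_pos k with rfl | hk0
        · simp
        · obtain ⟨r, rfl⟩ : ∃ r, t = r + 1 := ⟨t - 1, by omega⟩
          have : k * (r + 1) = k * r + k := by ring
          simp only [Nat.add_sub_cancel]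
          omega
      have h7 : (2 : ℝ) * ((k : ℝ) * ((t - 1 : ℕ) : ℝ)) ≤ ((n - 1 : ℕ) : ℝ) := by exact_mod_cast this
      linarith
    nlinarith
  calc (t : ℝ) / (2 * n) = (t / n) * (1 / 2) := by field_simp
    _ = ((n - 1).choose (t - 1) : ℝ) * (1 / 2) / n.choose t := by rw [← h1]; ring
    _ ≤ _ := by rw [nnWeight]; gcongr

end Weights

/-! ### The two-scale weights, uniformly in the ratio of the scales -/

section TwoScale

/-- The weight that `twoScaleDnn w w' n s t` gives to the point of rank `k`. -/
noncomputable def twoScaleRankWeight (w w' : ℝ) (n s t k : ℕ) : ℝ :=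
  w * nnWeight n s k + w' * nnWeight n t k

variable {d s t n : ℕ} {w w' : ℝ}

lemma IsTwoScaleWeight.symm (h : IsTwoScaleWeight d s t w w') : IsTwoScaleWeight d t s w' w :=
  ⟨by rw [add_comm]; exact h.1, by rw [add_comm]; exact h.2⟩

lemma IsTwoScaleWeight.ne (h : IsTwoScaleWeight d s t w w') (hs : 1 ≤ s) : s ≠ t := by
  rintro rfl
  have h2 := h.2
  rw [← add_mul, h.1, one_mul] at h2
  exact (Real.rpow_pos_of_pos (by exact_mod_cast hs) _).ne' h2

lemma rpow_neg_lt_rpow_neg (hd : 0 < d) (hs : 1 ≤ s) (hst : s < t) :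
    (t : ℝ) ^ (-(2 : ℝ) / (d : ℝ)) < (s : ℝ) ^ (-(2 : ℝ) / (d : ℝ)) := by
  have hs0 : (0 : ℝ) < s := by exact_mod_cast hs
  have hd0 : (0 : ℝ) < d := by exact_mod_cast hd
  refine Real.rpow_lt_rpow_of_neg hs0 (by exact_mod_cast hst) ?_
  rw [neg_div]
  exact neg_neg_of_pos (by positivity)

lemma IsTwoScaleWeight.neg_mul_sub (h : IsTwoScaleWeight d s t w w') :
    -w * ((s : ℝ) ^ (-(2 : ℝ) / (d : ℝ)) - (t : ℝ) ^ (-(2 : ℝ) / (d : ℝ)))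
      = (t : ℝ) ^ (-(2 : ℝ) / (d : ℝ)) := by
  have h1 : w' = 1 - w := by linarith [h.1]
  have h2 := h.2
  rw [h1] at h2
  linear_combination -h2

lemma IsTwoScaleWeight.nonpos (h : IsTwoScaleWeight d s t w w') (hd : 0 < d) (hs : 1 ≤ s)
    (hst : s < t) : w ≤ 0 := by
  have h1 := rpow_neg_lt_rpow_neg hd hs hst
  have h2 := h.neg_mul_sub
  have h3 : 0 < (t : ℝ) ^ (-(2 : ℝ) / (d : ℝ)) :=
    Real.rpow_pos_of_pos (by exact_mod_cast (hs.trans hst.le)) _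
  by_contra hw
  push Not at hw
  nlinarith

/-- With `L = log (t / s)` the weight equations say `-w * (exp ((2 / d) * L) - 1) = 1`, and `exp y -
1 ≥ y`. This is the compensation for `w` being unbounded as `t / s → 1`. -/
lemma IsTwoScaleWeight.neg_mul_log_le (h : IsTwoScaleWeight d s t w w') (hd : 0 < d) (hs : 1 ≤ s)
    (hst : s < t) : -w * Real.log (t / s) ≤ d / 2 := by
  have hs0 : (0 : ℝ) < s := by exact_mod_cast hs
  have ht0 : (0 : ℝ) < t := by exact_mod_cast (hs.trans hst.le)
  have hd0 : (0 : ℝ) < d := by exact_mod_cast hd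
  have hw := h.nonpos hd hs hst
  have h2 := h.neg_mul_sub
  set a : ℝ := 2 / d with ha
  have hpow : (s : ℝ) ^ (-(2 : ℝ) / (d : ℝ))
      = Real.exp (a * Real.log (t / s)) * (t : ℝ) ^ (-(2 : ℝ) / (d : ℝ)) := by
    rw [neg_div, ← ha, Real.rpow_def_of_pos hs0, Real.rpow_def_of_pos ht0, ← Real.exp_add,
      Real.log_div ht0.ne' hs0.ne']
    congr 1; ring
  have h3 : 0 < (t : ℝ) ^ (-(2 : ℝ) / (d : ℝ)) := Real.rpow_pos_of_pos ht0 _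
  rw [hpow] at h2
  have h4 : -w * (Real.exp (a * Real.log (t / s)) - 1) = 1 := by
    have : (-w * (Real.exp (a * Real.log (t / s)) - 1)) * (t : ℝ) ^ (-(2 : ℝ) / (d : ℝ))
        = 1 * (t : ℝ) ^ (-(2 : ℝ) / (d : ℝ)) := by linear_combination h2
    exact mul_right_cancel₀ h3.ne' this
  have h5 := Real.add_one_le_exp (a * Real.log (t / s))
  have h6 : -w * (a * Real.log (t / s)) ≤ 1 := by
    rw [← h4]
    exact mul_le_mul_of_nonneg_left (by linarith) (by linarith)
  have h7 : -w * Real.log (t / s) = -w * (a * Real.log (t / s)) * (d / 2) := by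
    rw [ha]; field_simp
  rw [h7]
  nlinarith

lemma sum_Ico_inv_succ_le_log (hs : 1 ≤ s) (hst : s ≤ t) :
    ∑ j ∈ Finset.Ico s t, (1 : ℝ) / (j + 1) ≤ Real.log (t / s) := by
  have hs0 : (0 : ℝ) < s := by exact_mod_cast hs
  induction t, hst using Nat.le_induction with
  | base => simp [div_self hs0.ne']
  | succ t hst ih =>
    have ht0 : (0 : ℝ) < t := by exact_mod_cast (hs.trans hst)
    rw [Finset.sum_Ico_succ_top hst]
    have h1 := Real.one_sub_inv_le_log_of_pos (x := ((t : ℝ) + 1) / t) (by positivity)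
    have h2 : 1 - (((t : ℝ) + 1) / t)⁻¹ = 1 / (t + 1) := by field_simp; ring
    have h3 : Real.log (((t + 1 : ℕ) : ℝ) / s)
        = Real.log (t / s) + Real.log (((t : ℝ) + 1) / t) := by
      rw [← Real.log_mul (by positivity) (by positivity)]
      congr 1; push_cast; field_simp
    rw [h3]
    linarith

lemma IsTwoScaleWeight.neg_mul_sum_le (h : IsTwoScaleWeight d s t w w') (hd : 0 < d) (hs : 1 ≤ s)
    (hst : s < t) : -w * ∑ j ∈ Finset.Ico s t, (1 : ℝ) / (j + 1) ≤ d / 2 := by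
  have hw := h.nonpos hd hs hst
  exact (mul_le_mul_of_nonneg_left (sum_Ico_inv_succ_le_log hs hst.le) (by linarith)).trans
    (h.neg_mul_log_le hd hs hst)

/-- Since the weights add up to one, the possibly large coefficient `-w` multiplies only increments.
-/
lemma twoScaleRankWeight_eq (h : IsTwoScaleWeight d s t w w') (hst : s < t) (k : ℕ) :
    twoScaleRankWeight w w' n s t k = nnWeight n t k
      + -w * ∑ j ∈ Finset.Ico s t, (nnWeight n (j + 1) k - nnWeight n j k) := by
  rw [Finset.sum_Ico_sub (fun j => nnWeight n j k) hst.le, twoScaleRankWeight]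
  have : w' = 1 - w := by linarith [h.1]
  rw [this]; ring

lemma sum_twoScaleRankWeight (h : IsTwoScaleWeight d s t w w') (hs : 1 ≤ s) (ht : 1 ≤ t)
    (hsn : s ≤ n) (htn : t ≤ n) : ∑ k ∈ Finset.range n, twoScaleRankWeight w w' n s t k = 1 := by
  unfold twoScaleRankWeight
  rw [Finset.sum_add_distrib, ← Finset.mul_sum, ← Finset.mul_sum, sum_nnWeight hs hsn,
    sum_nnWeight ht htn, mul_one, mul_one, h.1]

lemma abs_twoScaleRankWeight_le (h : IsTwoScaleWeight d s t w w') (hd : 0 < d) (hs : 1 ≤ s)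
    (hst : s < t) (htn : t ≤ n) {k : ℕ} (hk : k < n) :
    |twoScaleRankWeight w w' n s t k| ≤ (1 + d / 2) * (t / n) := by
  have hw := h.nonpos hd hs hst
  have hn : (0 : ℝ) < n := by exact_mod_cast (by omega : 0 < n)
  rw [twoScaleRankWeight_eq h hst]
  have h1 : |∑ j ∈ Finset.Ico s t, (nnWeight n (j + 1) k - nnWeight n j k)|
      ≤ (∑ j ∈ Finset.Ico s t, (1 : ℝ) / (j + 1)) * (t / n) := by
    rw [Finset.sum_mul]
    refine (Finset.abs_sum_le_sum_abs _ _).trans (Finset.sum_le_sum fun j hj => ?_)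
    have hj' := Finset.mem_Ico.1 hj
    refine (abs_nnWeight_succ_sub_le (by omega) (by omega) hk).trans ?_
    -- The bound `1 / n` on an increment is relaxed to `(1 / (j + 1)) * (t / n)`, so that the
    -- harmonic sum controlled by the weight equations appears.
    have : ((j : ℝ) + 1) ≤ t := by exact_mod_cast hj'.2
    rw [div_mul_div_comm, one_mul, div_le_div_iff₀ hn (by positivity)]
    nlinarith
  calc |nnWeight n t k + -w * ∑ j ∈ Finset.Ico s t, (nnWeight n (j + 1) k - nnWeight n j k)|
      ≤ |nnWeight n t k| + |-w * ∑ j ∈ Finset.Ico s t, (nnWeight n (j + 1) k - nnWeight n j k)| :=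
        abs_add_le _ _
    _ ≤ t / n + -w * ((∑ j ∈ Finset.Ico s t, (1 : ℝ) / (j + 1)) * (t / n)) := by
        rw [abs_mul, abs_of_nonneg (by linarith : 0 ≤ -w), abs_of_nonneg (nnWeight_nonneg _ _ _)]
        exact add_le_add (nnWeight_le (by omega) htn k)
          (mul_le_mul_of_nonneg_left h1 (by linarith))
    _ = (1 + -w * ∑ j ∈ Finset.Ico s t, (1 : ℝ) / (j + 1)) * (t / n) := by ring
    _ ≤ _ := by
        have := h.neg_mul_sum_le hd hs hst
        gcongr

lemma sum_abs_twoScaleRankWeight_le (h : IsTwoScaleWeight d s t w w') (hd : 0 < d) (hs : 1 ≤ s)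
    (hst : s < t) (htn : t ≤ n) :
    ∑ k ∈ Finset.range n, |twoScaleRankWeight w w' n s t k| ≤ 1 + d := by
  have hw := h.nonpos hd hs hst
  calc ∑ k ∈ Finset.range n, |twoScaleRankWeight w w' n s t k|
      ≤ ∑ k ∈ Finset.range n, (nnWeight n t k + -w * ∑ j ∈ Finset.Ico s t,
          |nnWeight n (j + 1) k - nnWeight n j k|) := by
        refine Finset.sum_le_sum fun k _ => ?_
        rw [twoScaleRankWeight_eq h hst]
        refine (abs_add_le _ _).trans ?_
        rw [abs_mul, abs_of_nonneg (by linarith : 0 ≤ -w), abs_of_nonneg (nnWeight_nonneg _ _ _)]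
        gcongr
        · linarith
        · exact Finset.abs_sum_le_sum_abs _ _
    _ = 1 + -w * ∑ j ∈ Finset.Ico s t, ∑ k ∈ Finset.range n,
          |nnWeight n (j + 1) k - nnWeight n j k| := by
        rw [Finset.sum_add_distrib, sum_nnWeight (by omega) htn, ← Finset.mul_sum, Finset.sum_comm]
    _ ≤ 1 + -w * ∑ j ∈ Finset.Ico s t, 2 * ((1 : ℝ) / (j + 1)) := by
        have h0 : 0 ≤ -w := by linarith
        gcongr with j hj
        have hj' := Finset.mem_Ico.1 hj
        exact sum_abs_nnWeight_succ_sub_le (by omega) (by omega)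
    _ ≤ 1 + d := by
        rw [← Finset.mul_sum]
        have := h.neg_mul_sum_le hd hs hst
        linarith

lemma sum_sq_twoScaleRankWeight_le (h : IsTwoScaleWeight d s t w w') (hd : 0 < d) (hs : 1 ≤ s)
    (hst : s < t) (htn : t ≤ n) :
    ∑ k ∈ Finset.range n, twoScaleRankWeight w w' n s t k ^ 2
      ≤ (1 + d / 2) * (1 + d) * (t / n) := by
  calc ∑ k ∈ Finset.range n, twoScaleRankWeight w w' n s t k ^ 2
      ≤ ∑ k ∈ Finset.range n, (1 + d / 2) * (t / n) * |twoScaleRankWeight w w' n s t k| := by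
        refine Finset.sum_le_sum fun k hk => ?_
        rw [← sq_abs, sq]
        gcongr
        exact abs_twoScaleRankWeight_le h hd hs hst htn (Finset.mem_range.1 hk)
    _ ≤ (1 + d / 2) * (t / n) * (1 + d) := by
        rw [← Finset.mul_sum]
        gcongr
        exact sum_abs_twoScaleRankWeight_le h hd hs hst htn
    _ = _ := by ring

/-- Only ranks up to `n / (2 * t)` are needed. There the weight at scale `t` is at least that at
scale `s`, and `-w ≥ 0`, so the combined weight is at least `nnWeight n t k ≥ t / (2 * n)`. At least
`n / (2 * t)` such ranks give `t / (8 * n)`. -/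
lemma le_sum_sq_twoScaleRankWeight (h : IsTwoScaleWeight d s t w w') (hd : 0 < d) (hs : 1 ≤ s)
    (hst : s < t) (htn : 2 * t ≤ n) :
    (t : ℝ) / (8 * n) ≤ ∑ k ∈ Finset.range n, twoScaleRankWeight w w' n s t k ^ 2 := by
  have hw := h.nonpos hd hs hst
  have ht : 0 < t := by omega
  have ht0 : (0 : ℝ) < t := by exact_mod_cast ht
  have hn : (0 : ℝ) < n := by exact_mod_cast (by omega : 0 < n)
  set K := n / (2 * t) + 1 with hK
  have hKn : (n : ℝ) / (2 * t) ≤ K := by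
    rw [hK]; push_cast
    have e : (2 : ℝ) * t = ((2 * t : ℕ) : ℝ) := by push_cast; ring
    have := (Nat.lt_floor_add_one ((n : ℝ) / (2 * t))).le
    rw [e, Nat.floor_div_natCast, Nat.floor_natCast] at this
    rw [e]
    exact this
  have hk : ∀ k < K, 2 * (k * t) ≤ n := by
    intro k hk
    have : k ≤ n / (2 * t) := by omega
    have := (Nat.le_div_iff_mul_le (by omega)).1 this
    linarith
  have hkn : ∀ k < K, k < n := by
    intro k hkK
    have := hk k hkK
    rcases Nat.eq_zero_or_pos k with rfl | h0
    · omega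
    · nlinarith
  have hsub : Finset.range K ⊆ Finset.range n := fun k hk' =>
    Finset.mem_range.2 (hkn k (Finset.mem_range.1 hk'))
  have hlow : ∀ k ∈ Finset.range K, ((t : ℝ) / (2 * n)) ^ 2 ≤
      twoScaleRankWeight w w' n s t k ^ 2 := by
    intro k hkK
    have hkK := Finset.mem_range.1 hkK
    have h1 : (t : ℝ) / (2 * n) ≤ twoScaleRankWeight w w' n s t k := by
      have h2 := hk k hkK
      have h3 := le_nnWeight ht h2 (by omega) (hkn k hkK)
      have h4 : nnWeight n s k ≤ nnWeight n t k := nnWeight_mono hs hst.le (by omega)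
      have h5 : w' = 1 - w := by linarith [h.1]
      rw [twoScaleRankWeight, h5]
      nlinarith
    exact pow_le_pow_left₀ (by positivity) h1 2
  calc (t : ℝ) / (8 * n) = (n / (2 * t)) * ((t : ℝ) / (2 * n)) ^ 2 := by field_simp; norm_num
    _ ≤ K * ((t : ℝ) / (2 * n)) ^ 2 := by gcongr
    _ = ∑ k ∈ Finset.range K, ((t : ℝ) / (2 * n)) ^ 2 := by simp
    _ ≤ ∑ k ∈ Finset.range K, twoScaleRankWeight w w' n s t k ^ 2 := Finset.sum_le_sum hlow
    _ ≤ _ := Finset.sum_le_sum_of_subset_of_nonneg hsub fun _ _ _ => sq_nonneg _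

lemma twoScaleDnn_eq_sum {x : EuclideanSpace ℝ (Fin d)} (hs : 1 ≤ s) (ht : 1 ≤ t)
    (z : ℕ → EuclideanSpace ℝ (Fin d) × ℝ) :
    twoScaleDnn w w' n s t x z = ∑ i ∈ Finset.range n,
      twoScaleRankWeight w w' n s t (distRank x n (fun k => (z k).1) i) * (z i).2 := by
  rw [twoScaleDnn, dnn_eq_sum_nnWeight hs, dnn_eq_sum_nnWeight ht, Finset.mul_sum, Finset.mul_sum,
    ← Finset.sum_add_distrib]
  refine Finset.sum_congr rfl fun i _ => ?_
  rw [twoScaleRankWeight]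
  ring

lemma twoScaleDnn_symm {x : EuclideanSpace ℝ (Fin d)} (z : ℕ → EuclideanSpace ℝ (Fin d) × ℝ) :
    twoScaleDnn w w' n s t x z = twoScaleDnn w' w n t s x z := add_comm _ _

lemma twoScaleRankWeight_symm (k : ℕ) :
    twoScaleRankWeight w w' n s t k = twoScaleRankWeight w' w n t s k := add_comm _ _

lemma twoScaleDnn_eq_sub {x : EuclideanSpace ℝ (Fin d)} (h : IsTwoScaleWeight d s t w w')
    (hst : s < t) (z : ℕ → EuclideanSpace ℝ (Fin d) × ℝ) :
    twoScaleDnn w w' n s t x z = dnn n t x z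
      + ∑ j ∈ Finset.Ico s t, -w * (dnn n (j + 1) x z - dnn n j x z) := by
  rw [← Finset.mul_sum, Finset.sum_Ico_sub (fun j => dnn n j x z) hst.le, twoScaleDnn]
  have : w' = 1 - w := by linarith [h.1]
  rw [this]; ring

end TwoScale

/-! ### Variance inequalities and Hoeffding's bound for U-statistics -/

section Variance

variable {Ω : Type*} [MeasurableSpace Ω] {P : Measure Ω} [IsProbabilityMeasure P]

/-- The variance of `c • X - Y` is a nonnegative quadratic polynomial in `c`, so its discriminant is
not positive. -/
lemma abs_covariance_le_sqrt_mul_sqrt {X Y : Ω → ℝ} (hX : MemLp X 2 P) (hY : MemLp Y 2 P) :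
    |covariance X Y P| ≤ √(variance X P) * √(variance Y P) := by
  have h : ∀ c : ℝ, 0 ≤ variance X P * (c * c) + (-2 * covariance X Y P) * c + variance Y P := by
    intro c
    have h1 : 0 ≤ variance (c • X - Y) P := variance_nonneg _ _
    rw [variance_sub (hX.const_smul c) hY, variance_smul, covariance_smul_left] at h1
    nlinarith
  have hd := discrim_le_zero h
  rw [discrim] at hd
  rw [← Real.sqrt_mul (variance_nonneg _ _)]
  refine Real.abs_le_sqrt ?_
  nlinarith

/-- Minkowski's inequality for standard deviations. -/
lemma variance_sum_mul_le {ι : Type*} (s : Finset ι) (c : ι → ℝ) (X : ι → Ω → ℝ)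
    (hX : ∀ i ∈ s, MemLp (X i) 2 P) :
    variance (fun ω => ∑ i ∈ s, c i * X i ω) P ≤ (∑ i ∈ s, |c i| * √(variance (X i) P)) ^ 2 := by
  have hm : ∀ i ∈ s, MemLp (fun ω => c i * X i ω) 2 P := fun i hi => (hX i hi).const_mul _
  rw [← covariance_self (memLp_finsetSum s hm).1.aemeasurable, covariance_fun_sum_fun_sum' hm hm,
    sq, Finset.sum_mul_sum]
  refine Finset.sum_le_sum fun i hi => Finset.sum_le_sum fun j hj => ?_
  rw [covariance_const_mul_left, covariance_const_mul_right]
  calc c i * (c j * covariance (X i) (X j) P) ≤ |c i * (c j * covariance (X i) (X j) P)| :=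
        le_abs_self _
    _ = |c i| * (|c j| * |covariance (X i) (X j) P|) := by rw [abs_mul, abs_mul]
    _ ≤ |c i| * (|c j| * (√(variance (X i) P) * √(variance (X j) P))) := by
        gcongr
        exact abs_covariance_le_sqrt_mul_sqrt (hX i hi) (hX j hj)
    _ = _ := by ring

lemma variance_average_le {ι : Type*} [Fintype ι] [Nonempty ι] (X : ι → Ω → ℝ) {V : ℝ}
    (hX : ∀ i, MemLp (X i) 2 P) (hV : ∀ i, variance (X i) P ≤ V) :
    variance (fun ω => (Fintype.card ι : ℝ)⁻¹ * ∑ i, X i ω) P ≤ V := by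
  have hV0 : 0 ≤ V := (variance_nonneg _ _).trans (hV (Classical.arbitrary ι))
  have hc : (0 : ℝ) < Fintype.card ι := by exact_mod_cast Fintype.card_pos
  have h := variance_sum_mul_le (P := P) Finset.univ (fun _ => (Fintype.card ι : ℝ)⁻¹) X
    fun i _ => hX i
  simp_rw [Finset.mul_sum]
  refine h.trans ?_
  calc (∑ i, |(Fintype.card ι : ℝ)⁻¹| * √(variance (X i) P)) ^ 2
      ≤ (∑ _i : ι, (Fintype.card ι : ℝ)⁻¹ * √V) ^ 2 := by
        rw [abs_of_pos (inv_pos.2 hc)]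
        gcongr with i
        exact hV i
    _ = V := by
        rw [Finset.sum_const, Finset.card_univ, nsmul_eq_mul, ← mul_assoc,
          mul_inv_cancel₀ hc.ne', one_mul, Real.sq_sqrt hV0]

lemma exists_perm_map_eq {n : ℕ} {S T : Finset (Fin n)} (h : S.card = T.card) :
    ∃ π : Equiv.Perm (Fin n), S.map π.toEmbedding = T := by
  have e : {x // x ∈ S} ≃ {x // x ∈ T} := Fintype.equivOfCardEq (by simpa using h)
  refine ⟨e.extendSubtype, ?_⟩
  refine Finset.eq_of_subset_of_card_le (fun i hi => ?_) (by simp [h])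
  obtain ⟨j, hj, rfl⟩ := Finset.mem_map.1 hi
  exact e.extendSubtype_mem j hj

/-- The average over all subsets of a given size is the average over the images of one of them. -/
lemma card_mul_sum_perm_eq {n t : ℕ} (g : Finset (Fin n) → ℝ) {B : Finset (Fin n)}
    (hB : B.card = t) :
    (n.choose t : ℝ) * ∑ π : Equiv.Perm (Fin n), g (B.map π.toEmbedding)
      = (Fintype.card (Equiv.Perm (Fin n)) : ℝ)
        * ∑ S ∈ (Finset.univ : Finset (Fin n)).powersetCard t, g S := by
  have h1 : ∀ S ∈ (Finset.univ : Finset (Fin n)).powersetCard t,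
      ∑ π : Equiv.Perm (Fin n), g (S.map π.toEmbedding)
        = ∑ π : Equiv.Perm (Fin n), g (B.map π.toEmbedding) := by
    intro S hS
    obtain ⟨ρ, rfl⟩ := exists_perm_map_eq (hB.trans (Finset.mem_powersetCard.1 hS).2.symm)
    refine Fintype.sum_equiv (Equiv.mulRight ρ) _ _ fun π => ?_
    rw [Finset.map_map]
    rfl
  have h2 : ∀ π : Equiv.Perm (Fin n),
      ∑ S ∈ (Finset.univ : Finset (Fin n)).powersetCard t, g (S.map π.toEmbedding)
        = ∑ S ∈ (Finset.univ : Finset (Fin n)).powersetCard t, g S := by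
    intro π
    refine Finset.sum_bij' (fun S _ => S.map π.toEmbedding)
      (fun S _ => S.map π.symm.toEmbedding) ?_ ?_ ?_ ?_ ?_
    · intro S hS; simpa using hS
    · intro S hS; simpa using hS
    · intro S _; ext i; simp
    · intro S _; ext i; simp
    · intro S _; rfl
  calc (n.choose t : ℝ) * ∑ π : Equiv.Perm (Fin n), g (B.map π.toEmbedding)
      = ∑ S ∈ (Finset.univ : Finset (Fin n)).powersetCard t,
          ∑ π : Equiv.Perm (Fin n), g (S.map π.toEmbedding) := by
        rw [Finset.sum_congr rfl h1, Finset.sum_const, Finset.card_powersetCard, Finset.card_univ,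
          Fintype.card_fin, nsmul_eq_mul]
    _ = _ := by
        rw [Finset.sum_comm, Finset.sum_congr rfl fun π _ => h2 π, Finset.sum_const,
          Finset.card_univ, nsmul_eq_mul]

/-- Consecutive blocks of length `t` in `Fin n`. -/
def finBlock (n t l : ℕ) : Finset (Fin n) := Finset.univ.filter fun i => (i : ℕ) / t = l

lemma card_finBlock {n t l : ℕ} (ht : 1 ≤ t) (hl : l < n / t) : (finBlock n t l).card = t := by
  have h : (finBlock n t l).map Fin.valEmbedding = Finset.Ico (l * t) (l * t + t) := by
    ext i
    simp only [finBlock, Finset.mem_map, Finset.mem_filter, Finset.mem_univ, true_and,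
      Fin.valEmbedding_apply, Finset.mem_Ico]
    have hlt : l * t + t ≤ n := by
      have := (Nat.le_div_iff_mul_le ht).1 (Nat.succ_le_of_lt hl)
      rwa [Nat.succ_mul] at this
    constructor
    · rintro ⟨j, hj, rfl⟩
      have h1 := Nat.div_add_mod (j : ℕ) t
      have h2 := Nat.mod_lt (j : ℕ) ht
      rw [hj, mul_comm] at h1
      omega
    · rintro ⟨h1, h2⟩
      refine ⟨⟨i, by omega⟩, ?_, rfl⟩
      exact Nat.div_eq_of_lt_le h1 (by rwa [Nat.succ_mul])
  rw [← Finset.card_map Fin.valEmbedding, h, Nat.card_Ico]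
  omega

lemma disjoint_finBlock {n t k l : ℕ} (h : k ≠ l) : Disjoint (finBlock n t k) (finBlock n t l) := by
  rw [Finset.disjoint_left]
  intro i hi hj
  exact h ((Finset.mem_filter.1 hi).2.symm.trans (Finset.mem_filter.1 hj).2)

/-- Hoeffding's bound for the variance of a U-statistic, on `Fin n`. -/
lemma variance_uStatistic_fin_le {n t : ℕ} (ht : 1 ≤ t) (htn : t ≤ n)
    (g : Finset (Fin n) → Ω → ℝ) {V : ℝ}
    (hg : ∀ S, S.card = t → MemLp (g S) 2 P)
    (hind : ∀ S T, S.card = t → T.card = t → Disjoint S T → IndepFun (g S) (g T) P)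
    (hV : ∀ S, S.card = t → variance (g S) P ≤ V) :
    variance (fun ω => (n.choose t : ℝ)⁻¹ *
      ∑ S ∈ (Finset.univ : Finset (Fin n)).powersetCard t, g S ω) P ≤ V / ((n / t : ℕ) : ℝ) := by
  set b := n / t with hb
  have hb0 : 0 < b := Nat.div_pos htn ht
  have hb0' : (b : ℝ) ≠ 0 := by exact_mod_cast hb0.ne'
  have hch : (n.choose t : ℝ) ≠ 0 := by exact_mod_cast (Nat.choose_pos htn).ne'
  have hcard : (Fintype.card (Equiv.Perm (Fin n)) : ℝ) ≠ 0 := by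
    exact_mod_cast Fintype.card_ne_zero
  have hcardB : ∀ (π : Equiv.Perm (Fin n)), ∀ l ∈ Finset.range b,
      ((finBlock n t l).map π.toEmbedding).card = t := fun π l hl => by
    rw [Finset.card_map, card_finBlock ht (Finset.mem_range.1 hl)]
  -- Hoeffding's device: the U-statistic is the average over all permutations of the mean over `b =
  -- n / t` disjoint blocks. Each block mean has independent terms, hence variance at most `V / b`,
  -- and averaging does not increase this bound.
  set W : Equiv.Perm (Fin n) → Ω → ℝ := fun π ω =>
    (b : ℝ)⁻¹ * ∑ l ∈ Finset.range b, g ((finBlock n t l).map π.toEmbedding) ω with hW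
  have hWmem : ∀ π, MemLp (W π) 2 P := fun π =>
    (memLp_finsetSum _ fun l hl => hg _ (hcardB π l hl)).const_mul _
  have hWvar : ∀ π, variance (W π) P ≤ V / b := by
    intro π
    have h1 : variance (∑ l ∈ Finset.range b, g ((finBlock n t l).map π.toEmbedding)) P
        = ∑ l ∈ Finset.range b, variance (g ((finBlock n t l).map π.toEmbedding)) P := by
      refine IndepFun.variance_sum (fun l hl => hg _ (hcardB π l hl)) fun k hk l hl hkl => ?_
      exact hind _ _ (hcardB π k hk) (hcardB π l hl)
        ((Finset.disjoint_map _).2 (disjoint_finBlock hkl))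
    have h2 : W π = fun ω => (b : ℝ)⁻¹ *
        (∑ l ∈ Finset.range b, g ((finBlock n t l).map π.toEmbedding)) ω := by
      ext ω; simp [hW, Finset.sum_apply]
    rw [h2, variance_const_mul, h1]
    calc (b : ℝ)⁻¹ ^ 2 * ∑ l ∈ Finset.range b, variance (g ((finBlock n t l).map π.toEmbedding)) P
        ≤ (b : ℝ)⁻¹ ^ 2 * ∑ _l ∈ Finset.range b, V := by
          gcongr with l hl
          exact hV _ (hcardB π l hl)
      _ = V / b := by
          rw [Finset.sum_const, Finset.card_range, nsmul_eq_mul]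
          field_simp
  have hU : (fun ω => (n.choose t : ℝ)⁻¹ *
      ∑ S ∈ (Finset.univ : Finset (Fin n)).powersetCard t, g S ω)
      = fun ω => (Fintype.card (Equiv.Perm (Fin n)) : ℝ)⁻¹ * ∑ π, W π ω := by
    ext ω
    have h1 : ∑ π, W π ω = (b : ℝ)⁻¹ * ∑ l ∈ Finset.range b,
        ∑ π : Equiv.Perm (Fin n), g ((finBlock n t l).map π.toEmbedding) ω := by
      rw [Finset.sum_comm, Finset.mul_sum]
    have h2 : ∀ l ∈ Finset.range b,
        ∑ π : Equiv.Perm (Fin n), g ((finBlock n t l).map π.toEmbedding) ω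
          = (n.choose t : ℝ)⁻¹ * ((Fintype.card (Equiv.Perm (Fin n)) : ℝ)
            * ∑ S ∈ (Finset.univ : Finset (Fin n)).powersetCard t, g S ω) := by
      intro l hl
      rw [← card_mul_sum_perm_eq (fun S => g S ω) (card_finBlock ht (Finset.mem_range.1 hl)),
        inv_mul_cancel_left₀ hch]
    rw [h1, Finset.sum_congr rfl h2, Finset.sum_const, Finset.card_range, nsmul_eq_mul,
      inv_mul_cancel_left₀ hb0']
    field_simp
  rw [hU]
  exact variance_average_le W hWmem hWvar

/-- Hoeffding's bound for the variance of a U-statistic. -/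
lemma variance_uStatistic_le {n t : ℕ} (ht : 1 ≤ t) (htn : t ≤ n)
    (g : Finset ℕ → Ω → ℝ) {V : ℝ}
    (hg : ∀ S, S.card = t → MemLp (g S) 2 P)
    (hind : ∀ S T, S.card = t → T.card = t → Disjoint S T → IndepFun (g S) (g T) P)
    (hV : ∀ S, S.card = t → variance (g S) P ≤ V) :
    variance (fun ω => (n.choose t : ℝ)⁻¹ *
      ∑ S ∈ (Finset.range n).powersetCard t, g S ω) P ≤ V / ((n / t : ℕ) : ℝ) := by
  have h := variance_uStatistic_fin_le (P := P) ht htn (fun S => g (S.map Fin.valEmbedding))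
    (fun S hS => hg _ (by simpa using hS))
    (fun S T hS hT hST => hind _ _ (by simpa using hS) (by simpa using hT)
      ((Finset.disjoint_map _).2 hST))
    (fun S hS => hV _ (by simpa using hS))
  have e : ∀ ω, ∑ S ∈ (Finset.range n).powersetCard t, g S ω
      = ∑ S ∈ (Finset.univ : Finset (Fin n)).powersetCard t, g (S.map Fin.valEmbedding) ω := by
    intro ω
    have : Finset.range n = (Finset.univ : Finset (Fin n)).map Fin.valEmbedding := by
      ext i
      simp only [Finset.mem_range, Finset.mem_map, Finset.mem_univ, true_and,
        Fin.valEmbedding_apply]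
      exact ⟨fun h => ⟨⟨i, h⟩, rfl⟩, fun ⟨j, hj⟩ => hj ▸ j.2⟩
    rw [this, Finset.powersetCard_map, Finset.sum_map]
    rfl
  simp_rw [e]
  exact h

end Variance

/-! ### Common properties of the nearest response and of its increment -/

section Kernels

variable {d : ℕ} {x : EuclideanSpace ℝ (Fin d)}

/-- The properties of a kernel depending on the nearest points of a sample that are used for
moment bounds. -/
structure IsNearestKernel (x : EuclideanSpace ℝ (Fin d))
    (K : Finset ℕ → (ℕ → EuclideanSpace ℝ (Fin d) × ℝ) → ℝ) : Prop where
  measurable : ∀ S, Measurable (K S)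
  congr : ∀ S z z', (∀ i ∈ S, z i = z' i) → K S z = K S z'
  sq_le : ∀ S z, K S z ^ 2 ≤ 4 * ∑ i ∈ S, (z i).2 ^ 2
  abs_le : ∀ (S : Finset ℕ) (z : ℕ → EuclideanSpace ℝ (Fin d) × ℝ) (r η : ℝ), S.Nonempty → 0 ≤ η →
    (∀ i ∈ S, ‖(z i).1 - x‖ < r → |(z i).2| ≤ η) →
    (∀ k ∈ S, ∃ i ∈ S, i ≠ k ∧ ‖(z i).1 - x‖ < r) → |K S z| ≤ 2 * η

lemma measurableSet_forall_distKey_le (S : Finset ℕ) (i : ℕ) :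
    MeasurableSet {z : ℕ → EuclideanSpace ℝ (Fin d) × ℝ | ∀ j ∈ S,
      distKey x (fun k => (z k).1) i ≤ distKey x (fun k => (z k).1) j} := by
  simp only [distKey_le_iff]
  have hm : ∀ k, Measurable fun z : ℕ → EuclideanSpace ℝ (Fin d) × ℝ => ‖(z k).1 - x‖ :=
    fun k => by fun_prop
  have : {z : ℕ → EuclideanSpace ℝ (Fin d) × ℝ | ∀ j ∈ S, ‖(z i).1 - x‖ < ‖(z j).1 - x‖ ∨
      ‖(z i).1 - x‖ = ‖(z j).1 - x‖ ∧ i ≤ j} = ⋂ j ∈ S, {z | ‖(z i).1 - x‖ < ‖(z j).1 - x‖ ∨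
      ‖(z i).1 - x‖ = ‖(z j).1 - x‖ ∧ i ≤ j} := by
    ext z; simp
  rw [this]
  refine Finset.measurableSet_biInter _ fun j _ => ?_
  exact (measurableSet_lt (hm i) (hm j)).union
    ((measurableSet_eq_fun (hm i) (hm j)).inter (MeasurableSet.const _))

lemma measurable_nearestResponse (S : Finset ℕ) : Measurable (nearestResponse x S) := by
  have : nearestResponse x S = fun z => ∑ i ∈ S, if ∀ j ∈ S,
      distKey x (fun k => (z k).1) i ≤ distKey x (fun k => (z k).1) j then (z i).2 else 0 :=
    funext fun z => nearestResponse_eq_sum S z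
  rw [this]
  refine Finset.measurable_sum _ fun i _ => ?_
  exact Measurable.ite (measurableSet_forall_distKey_le S i) (by fun_prop) measurable_const

lemma nearestResponse_congr (S : Finset ℕ) (z z' : ℕ → EuclideanSpace ℝ (Fin d) × ℝ)
    (h : ∀ i ∈ S, z i = z' i) : nearestResponse x S z = nearestResponse x S z' := by
  rcases S.eq_empty_or_nonempty with rfl | hS
  · simp [nearestResponse, closestLabels]
  obtain ⟨i, hi, hmin⟩ := exists_forall_distKey_le (x := x) (ξ := fun k => (z k).1) hS
  have hmin' : ∀ j ∈ S, distKey x (fun k => (z' k).1) i ≤ distKey x (fun k => (z' k).1) j := by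
    intro j hj
    have := hmin j hj
    simpa only [distKey, h i hi, h j hj] using this
  rw [nearestResponse_eq_of_forall_distKey_le hi hmin,
    nearestResponse_eq_of_forall_distKey_le hi hmin', h i hi]

lemma abs_nearestResponse_le {S : Finset ℕ} {z : ℕ → EuclideanSpace ℝ (Fin d) × ℝ} {r η : ℝ}
    (hbd : ∀ i ∈ S, ‖(z i).1 - x‖ < r → |(z i).2| ≤ η) (hnear : ∃ i ∈ S, ‖(z i).1 - x‖ < r) :
    |nearestResponse x S z| ≤ η := by
  obtain ⟨i, hi, hir⟩ := hnear
  obtain ⟨j, hj, h1, h2⟩ := exists_nearestResponse_eq (x := x) ⟨i, hi⟩ z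
  rw [h1]
  exact hbd j hj ((h2 i hi).trans_lt hir)

lemma sq_nearestResponse_le (S : Finset ℕ) (z : ℕ → EuclideanSpace ℝ (Fin d) × ℝ) :
    nearestResponse x S z ^ 2 ≤ ∑ i ∈ S, (z i).2 ^ 2 := by
  rcases S.eq_empty_or_nonempty with rfl | hS
  · simp [nearestResponse, closestLabels]
  obtain ⟨j, hj, h1, -⟩ := exists_nearestResponse_eq (x := x) hS z
  rw [h1]
  exact Finset.single_le_sum (f := fun i => (z i).2 ^ 2) (fun _ _ => sq_nonneg _) hj

lemma isNearestKernel_nearestResponse : IsNearestKernel x (nearestResponse x) where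
  measurable := measurable_nearestResponse
  congr := nearestResponse_congr
  sq_le S z := by
    have h := sq_nearestResponse_le (x := x) S z
    have h0 : 0 ≤ ∑ i ∈ S, (z i).2 ^ 2 := Finset.sum_nonneg fun _ _ => sq_nonneg _
    linarith
  abs_le S z r η hS hη hbd hnear := by
    obtain ⟨k, hk⟩ := hS
    obtain ⟨i, hi, -, hir⟩ := hnear k hk
    have := abs_nearestResponse_le hbd ⟨i, hi, hir⟩
    linarith

/-- Because the increment deletes the nearest point, closeness is needed from some point other than
any given `k`. The factor `2` comes from the difference of two responses, and the factor `4` from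
`(a - b) ^ 2 ≤ 2 * a ^ 2 + 2 * b ^ 2`. -/
lemma isNearestKernel_nearestIncrement : IsNearestKernel x (nearestIncrement x) where
  measurable S := Finset.measurable_sum _ fun i _ =>
    (measurable_nearestResponse S).sub (measurable_nearestResponse _)
  congr S z z' h := Finset.sum_congr rfl fun i _ => by
    rw [nearestResponse_congr S z z' h, nearestResponse_congr (S.erase i) z z' fun j hj =>
      h j (Finset.mem_of_mem_erase hj)]
  sq_le S z := by
    rcases S.eq_empty_or_nonempty with rfl | hS
    · simp [nearestIncrement]
    obtain ⟨k, hk, h⟩ := exists_nearestIncrement_eq (x := x) hS z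
    rw [h]
    have h1 := sq_nearestResponse_le (x := x) S z
    have h2 := sq_nearestResponse_le (x := x) (S.erase k) z
    have h3 : ∑ i ∈ S.erase k, (z i).2 ^ 2 ≤ ∑ i ∈ S, (z i).2 ^ 2 :=
      Finset.sum_le_sum_of_subset_of_nonneg (Finset.erase_subset _ _) fun _ _ _ => sq_nonneg _
    nlinarith [sq_nonneg (nearestResponse x S z + nearestResponse x (S.erase k) z)]
  abs_le S z r η hS hη hbd hnear := by
    obtain ⟨k, hk, h⟩ := exists_nearestIncrement_eq (x := x) hS z
    obtain ⟨i, hi, hik, hir⟩ := hnear k hk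
    rw [h]
    have h1 := abs_nearestResponse_le hbd ⟨i, hi, hir⟩
    have h2 := abs_nearestResponse_le (S := S.erase k)
      (fun j hj => hbd j (Finset.mem_of_mem_erase hj)) ⟨i, Finset.mem_erase.2 ⟨hik, hi⟩, hir⟩
    have := abs_sub (nearestResponse x S z) (nearestResponse x (S.erase k) z)
    linarith

end Kernels

/-! ### Second moments of the kernels -/

section Moments

variable {d : ℕ} {x : EuclideanSpace ℝ (Fin d)}
variable {Ω : Type*} [MeasurableSpace Ω] {P : Measure Ω} [IsProbabilityMeasure P]
variable {X : ℕ → Ω → EuclideanSpace ℝ (Fin d)} {g : EuclideanSpace ℝ (Fin d) → ℝ}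
variable {K : Finset ℕ → (ℕ → EuclideanSpace ℝ (Fin d) × ℝ) → ℝ}

omit [IsProbabilityMeasure P] in
lemma IsNearestKernel.memLp {Y : ℕ → Ω → ℝ} (hK : IsNearestKernel x K)
    (hX : ∀ i, Measurable (X i)) (hYm : ∀ i, Measurable (Y i)) (hY : ∀ i, MemLp (Y i) 2 P)
    (S : Finset ℕ) : MemLp (fun ω => K S fun i => (X i ω, Y i ω)) 2 P := by
  have hm : Measurable fun ω => K S fun i => (X i ω, Y i ω) :=
    (hK.measurable S).comp (measurable_pi_lambda _ fun i => (hX i).prodMk (hYm i))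
  rw [memLp_two_iff_integrable_sq hm.aestronglyMeasurable]
  have hint : Integrable (fun ω => 4 * ∑ i ∈ S, Y i ω ^ 2) P :=
    (integrable_finsetSum _ fun i _ => (hY i).integrable_sq).const_mul 4
  refine hint.mono' (hm.pow_const 2).aestronglyMeasurable (ae_of_all _ fun ω => ?_)
  rw [Real.norm_eq_abs, abs_of_nonneg (sq_nonneg _)]
  exact hK.sq_le S _

omit [IsProbabilityMeasure P] in
lemma IsNearestKernel.indepFun (hK : IsNearestKernel x K) (hX : ∀ i, Measurable (X i))
    (hind : iIndepFun X P) (hg : Measurable g) {S T : Finset ℕ} (hST : Disjoint S T) :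
    IndepFun (fun ω => K S fun i => (X i ω, g (X i ω)))
      (fun ω => K T fun i => (X i ω, g (X i ω))) P := by
  classical
  have key : ∀ S : Finset ℕ, ∃ φ : (S → EuclideanSpace ℝ (Fin d)) → ℝ, Measurable φ ∧
      (fun ω => K S fun i => (X i ω, g (X i ω))) = φ ∘ fun ω (i : S) => X i ω := by
    intro S
    -- The kernel ignores labels outside `S`, so the default value `0` there is harmless and the
    -- kernel factors through finitely many coordinates.
    refine ⟨fun a => K S fun i => if h : i ∈ S then (a ⟨i, h⟩, g (a ⟨i, h⟩)) else 0, ?_, ?_⟩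
    · refine (hK.measurable S).comp (measurable_pi_lambda _ fun i => ?_)
      by_cases h : i ∈ S
      · simp only [h, dif_pos]; fun_prop
      · simp only [h, dif_neg, not_false_eq_true]; fun_prop
    · ext ω
      refine hK.congr S _ _ fun i hi => ?_
      simp [hi]
  obtain ⟨φ, hφ, e1⟩ := key S
  obtain ⟨ψ, hψ, e2⟩ := key T
  rw [e1, e2]
  exact (hind.indepFun_finset S T hST hX).comp hφ hψ

omit [IsProbabilityMeasure P] in
lemma integral_mul_prod_eq (hX : ∀ i, Measurable (X i)) (hind : iIndepFun X P)
    {h φ : EuclideanSpace ℝ (Fin d) → ℝ} (hh : Measurable h) (hφ : Measurable φ)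
    {T : Finset ℕ} {i : ℕ} (hi : i ∉ T) :
    ∫ ω, h (X i ω) * ∏ l ∈ T, φ (X l ω) ∂P
      = (∫ ω, h (X i ω) ∂P) * ∏ l ∈ T, ∫ ω, φ (X l ω) ∂P := by
  classical
  set f : ℕ → EuclideanSpace ℝ (Fin d) → ℝ := fun l => if l = i then h else φ with hf
  have hfm : ∀ l, Measurable (f l) := fun l => by
    by_cases hl : l = i <;> simp [hf, hl, hh, hφ]
  have hne : ∀ l ∈ T, l ≠ i := fun l hl e => hi (e ▸ hl)
  have h1 := iIndepFun.integral_fun_prod_comp (X := fun (l : (insert i T : Finset ℕ)) => X l)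
    (hind.precomp Subtype.val_injective) (f := fun l => f l)
    (fun l => (hX l).aemeasurable) (fun l => (hfm l).aestronglyMeasurable)
  rw [Finset.prod_coe_sort (insert i T) (fun l => ∫ ω, f l (X l ω) ∂P),
    Finset.prod_insert hi] at h1
  have h2 : ∀ ω, ∏ l : (insert i T : Finset ℕ), f l (X l ω) = h (X i ω) * ∏ l ∈ T, φ (X l ω) := by
    intro ω
    rw [Finset.prod_coe_sort (insert i T) (fun l => f l (X l ω)), Finset.prod_insert hi]
    congr 1
    · simp [hf]
    · exact Finset.prod_congr rfl fun l hl => by simp [hf, hne l hl]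
  simp_rw [h2] at h1
  rw [h1]
  congr 1
  · simp [hf]
  · exact Finset.prod_congr rfl fun l hl => by simp [hf, hne l hl]

/-- Second moments of kernels: the part where two points are close to `x` is small if the values
are small near `x`; the other part is exponentially small. -/
lemma IsNearestKernel.integral_sq_le (hK : IsNearestKernel x K) (hX : ∀ i, Measurable (X i))
    (hind : iIndepFun X P) (hlaw : ∀ i, P.map (X i) = P.map (X 0)) (hg : Measurable g)
    (hg2 : MemLp (fun ω => g (X 0 ω)) 2 P) {r η : ℝ} (hη : 0 ≤ η)
    (hbd : ∀ y, ‖y - x‖ < r → |g y| ≤ η) {S : Finset ℕ} (hS : S.Nonempty) :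
    ∫ ω, (K S fun i => (X i ω, g (X i ω))) ^ 2 ∂P ≤ 4 * η ^ 2 + 4 * ((S.card : ℝ) ^ 2 *
      ((∫ ω, g (X 0 ω) ^ 2 ∂P) * (P.real {ω | r ≤ ‖X 0 ω - x‖}) ^ (S.card - 2))) := by
  classical
  set q := P.real {ω | r ≤ ‖X 0 ω - x‖} with hq
  set A : Set (EuclideanSpace ℝ (Fin d)) := {y | r ≤ ‖y - x‖} with hA
  have hAm : MeasurableSet A := measurableSet_le measurable_const (by fun_prop)
  set φ : EuclideanSpace ℝ (Fin d) → ℝ := A.indicator fun _ => 1 with hφ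
  have hφm : Measurable φ := measurable_const.indicator hAm
  have hφ0 : ∀ y, 0 ≤ φ y := fun y => Set.indicator_nonneg (fun _ _ => zero_le_one) y
  have hφ1 : ∀ y, φ y ≤ 1 := fun y => Set.indicator_le_self' (fun _ _ => zero_le_one) y
  have hident : ∀ (i : ℕ) (h : EuclideanSpace ℝ (Fin d) → ℝ), Measurable h →
      ∫ ω, h (X i ω) ∂P = ∫ ω, h (X 0 ω) ∂P := by
    intro i h hh
    rw [← integral_map (hX i).aemeasurable hh.aestronglyMeasurable, hlaw i,
      integral_map (hX 0).aemeasurable hh.aestronglyMeasurable]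
  have hφq : ∀ l, ∫ ω, φ (X l ω) ∂P = q := by
    intro l
    rw [hident l φ hφm]
    have : (fun ω => φ (X 0 ω)) = Set.indicator {ω | r ≤ ‖X 0 ω - x‖} fun _ => (1 : ℝ) := by
      ext ω; simp [hφ, hA, Set.indicator]
    rw [this, integral_indicator_const _ (measurableSet_le measurable_const (by fun_prop))]
    simp [hq]
  have hgi2 : ∀ i, Integrable (fun ω => g (X i ω) ^ 2) P := by
    intro i
    have h0 := hg2.integrable_sq
    have hm : AEStronglyMeasurable (fun y => g y ^ 2) (P.map (X 0)) :=
      (hg.pow_const 2).aestronglyMeasurable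
    have h1 : Integrable (fun y => g y ^ 2) (P.map (X 0)) :=
      (integrable_map_measure hm (hX 0).aemeasurable).2 h0
    rw [← hlaw i] at h1 hm
    exact (integrable_map_measure hm (hX i).aemeasurable).1 h1
  -- If all points of `S` other than `k` are far, the product of indicators equals one. Leaving out
  -- `i` as well makes the product independent of `g (X i)`, at the price of the exponent `S.card -
  -- 2`.
  set R : ℕ → ℕ → Ω → ℝ := fun i k ω => g (X i ω) ^ 2 * ∏ l ∈ (S.erase k).erase i, φ (X l ω)
    with hR
  have hprod0 : ∀ (T : Finset ℕ) ω, 0 ≤ ∏ l ∈ T, φ (X l ω) :=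
    fun T ω => Finset.prod_nonneg fun l _ => hφ0 _
  have hR0 : ∀ i k ω, 0 ≤ R i k ω := fun i k ω => mul_nonneg (sq_nonneg _) (hprod0 _ _)
  have hRint : ∀ i k, Integrable (R i k) P := by
    intro i k
    refine (hgi2 i).mono' ?_ (ae_of_all _ fun ω => ?_)
    · exact (((hg.comp (hX i)).pow_const 2).mul
        (Finset.measurable_prod _ fun l _ => hφm.comp (hX l))).aestronglyMeasurable
    · rw [Real.norm_eq_abs, abs_of_nonneg (hR0 i k ω)]
      exact mul_le_of_le_one_right (sq_nonneg _)
        (Finset.prod_le_one (fun l _ => hφ0 _) fun l _ => hφ1 _)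
  have hq0 : 0 ≤ q := measureReal_nonneg
  have hq1 : q ≤ 1 := measureReal_le_one
  have hRle : ∀ i ∈ S, ∀ k ∈ S, ∫ ω, R i k ω ∂P ≤ (∫ ω, g (X 0 ω) ^ 2 ∂P) * q ^ (S.card - 2) := by
    intro i hi k hk
    have h1 := integral_mul_prod_eq hX hind (h := fun y => g y ^ 2) (hg.pow_const 2) hφm
      (T := (S.erase k).erase i) (i := i) (by simp)
    rw [hR]
    simp only
    rw [h1, Finset.prod_congr rfl fun l _ => hφq l, Finset.prod_const,
      hident i (fun y => g y ^ 2) (hg.pow_const 2)]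
    refine mul_le_mul_of_nonneg_left (pow_le_pow_of_le_one hq0 hq1 ?_)
      (integral_nonneg fun ω => sq_nonneg _)
    have h2 := Finset.pred_card_le_card_erase (s := S.erase k) (a := i)
    have h3 := Finset.pred_card_le_card_erase (s := S) (a := k)
    omega
  have hpt : ∀ ω, (K S fun i => (X i ω, g (X i ω))) ^ 2
      ≤ 4 * η ^ 2 + 4 * ∑ i ∈ S, ∑ k ∈ S, R i k ω := by
    intro ω
    have hsum0 : 0 ≤ ∑ i ∈ S, ∑ k ∈ S, R i k ω :=
      Finset.sum_nonneg fun i _ => Finset.sum_nonneg fun k _ => hR0 i k ω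
    by_cases hnear : ∀ k ∈ S, ∃ i ∈ S, i ≠ k ∧ ‖X i ω - x‖ < r
    · have h1 := hK.abs_le S (fun i => (X i ω, g (X i ω))) r η hS hη
        (fun i _ hir => hbd _ hir) hnear
      have h2 : (K S fun i => (X i ω, g (X i ω))) ^ 2 ≤ (2 * η) ^ 2 :=
        sq_le_sq.2 (h1.trans (le_abs_self _))
      nlinarith
    · push Not at hnear
      obtain ⟨k, hk, hfar⟩ := hnear
      have h1 := hK.sq_le S fun i => (X i ω, g (X i ω))
      have h2 : ∑ i ∈ S, g (X i ω) ^ 2 ≤ ∑ i ∈ S, ∑ k ∈ S, R i k ω := by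
        refine Finset.sum_le_sum fun i _ => ?_
        have h3 : R i k ω = g (X i ω) ^ 2 := by
          have : ∏ l ∈ (S.erase k).erase i, φ (X l ω) = 1 := by
            refine Finset.prod_eq_one fun l hl => ?_
            have hl' := Finset.mem_erase.1 (Finset.mem_of_mem_erase hl)
            exact Set.indicator_of_mem (s := A) (hfar l hl'.2 hl'.1) _
          rw [hR]; simp only; rw [this, mul_one]
        rw [← h3]
        exact Finset.single_le_sum (f := fun k => R i k ω) (fun k _ => hR0 i k ω) hk
      nlinarith [sq_nonneg η]
  have hint2 : Integrable (fun ω => 4 * ∑ i ∈ S, ∑ k ∈ S, R i k ω) P :=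
    (integrable_finsetSum S (f := fun i ω => ∑ k ∈ S, R i k ω) fun i _ =>
      integrable_finsetSum _ fun k _ => hRint i k).const_mul 4
  have hint : Integrable (fun ω => 4 * η ^ 2 + 4 * ∑ i ∈ S, ∑ k ∈ S, R i k ω) P :=
    (integrable_const _).add hint2
  calc ∫ ω, (K S fun i => (X i ω, g (X i ω))) ^ 2 ∂P
      ≤ ∫ ω, (4 * η ^ 2 + 4 * ∑ i ∈ S, ∑ k ∈ S, R i k ω) ∂P :=
        integral_mono_of_nonneg (ae_of_all _ fun ω => sq_nonneg _) hint (ae_of_all _ hpt)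
    _ = 4 * η ^ 2 + 4 * ∑ i ∈ S, ∑ k ∈ S, ∫ ω, R i k ω ∂P := by
        rw [integral_add (integrable_const _) hint2,
          integral_const_mul 4 (fun ω => ∑ i ∈ S, ∑ k ∈ S, R i k ω),
          integral_finsetSum S (f := fun i ω => ∑ k ∈ S, R i k ω)
            fun i _ => integrable_finsetSum _ fun k _ => hRint i k]
        simp only [integral_const, probReal_univ, smul_eq_mul, one_mul]
        congr 2
        exact Finset.sum_congr rfl fun i _ => integral_finsetSum _ fun k _ => hRint i k
    _ ≤ 4 * η ^ 2 + 4 * ∑ _i ∈ S, ∑ _k ∈ S, (∫ ω, g (X 0 ω) ^ 2 ∂P) * q ^ (S.card - 2) := by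
        gcongr with i hi k hk
        exact hRle i hi k hk
    _ = _ := by
        rw [Finset.sum_const, Finset.sum_const, nsmul_eq_mul, nsmul_eq_mul]
        ring

/-- The second moment of a kernel tends to `0` with the size of the subsample if the values are
continuous at `x` and vanish there. -/
lemma IsNearestKernel.exists_integral_sq_le (hK : IsNearestKernel x K)
    (hX : ∀ i, Measurable (X i))
    (hind : iIndepFun X P) (hlaw : ∀ i, P.map (X i) = P.map (X 0)) (hg : Measurable g)
    (hg2 : MemLp (fun ω => g (X 0 ω)) 2 P) (hx : x ∈ (P.map (X 0)).support)
    (hgx : g x = 0) (hgc : ContinuousAt g x) {δ : ℝ} (hδ : 0 < δ) :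
    ∃ N, ∀ S : Finset ℕ, N ≤ S.card → ∫ ω, (K S fun i => (X i ω, g (X i ω))) ^ 2 ∂P ≤ δ := by
  obtain ⟨η, hη, hηδ⟩ : ∃ η : ℝ, 0 < η ∧ 4 * η ^ 2 ≤ δ / 2 :=
    ⟨√(δ / 8), Real.sqrt_pos.2 (by positivity), by
      rw [Real.sq_sqrt (by positivity)]; linarith⟩
  obtain ⟨r, hr, hbd⟩ : ∃ r > 0, ∀ y, ‖y - x‖ < r → |g y| ≤ η := by
    obtain ⟨r, hr, h⟩ := Metric.continuousAt_iff.1 hgc η hη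
    refine ⟨r, hr, fun y hy => ?_⟩
    have := h (show dist y x < r by rwa [dist_eq_norm])
    rw [hgx, Real.dist_eq, sub_zero] at this
    exact this.le
  set q := P.real {ω | r ≤ ‖X 0 ω - x‖} with hq
  have hq0 : 0 ≤ q := measureReal_nonneg
  have hq1 : q < 1 := by
    have hball := (Measure.mem_support_iff_forall x).1 hx _ (Metric.ball_mem_nhds x hr)
    rw [Measure.map_apply (hX 0) Metric.isOpen_ball.measurableSet] at hball
    have hm : MeasurableSet (X 0 ⁻¹' Metric.ball x r) := (hX 0) Metric.isOpen_ball.measurableSet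
    have e : {ω | r ≤ ‖X 0 ω - x‖} = (X 0 ⁻¹' Metric.ball x r)ᶜ := by
      ext ω; simp [dist_eq_norm]
    have hpos : 0 < P.real (X 0 ⁻¹' Metric.ball x r) :=
      ENNReal.toReal_pos hball.ne' (measure_ne_top _ _)
    rw [hq, e, probReal_compl_eq_one_sub hm]
    linarith
  set I := ∫ ω, g (X 0 ω) ^ 2 ∂P with hI
  have hlim : Tendsto (fun k : ℕ => 4 * ((k : ℝ) ^ 2 * (I * q ^ (k - 2)))) atTop (𝓝 0) := by
    have h0 := (tendsto_pow_const_mul_const_pow_of_lt_one 2 hq0 hq1)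
    have h1 := (tendsto_pow_const_mul_const_pow_of_lt_one 1 hq0 hq1)
    have h2 := (tendsto_pow_const_mul_const_pow_of_lt_one 0 hq0 hq1)
    have h3 := ((h0.add (h1.const_mul 4)).add (h2.const_mul 4)).const_mul (4 * I)
    simp only [mul_zero, add_zero] at h3
    -- The shift by two clears the truncated subtraction in the exponent; the expansion of `(k + 2)
    -- ^ 2` uses the three limits above.
    refine (tendsto_add_atTop_iff_nat 2).1 (h3.congr fun k => ?_)
    rw [Nat.add_sub_cancel]
    push_cast
    ring
  obtain ⟨N, hN⟩ := eventually_atTop.1 (hlim.eventually_lt_const (half_pos hδ))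
  refine ⟨max N 1, fun S hS => ?_⟩
  have hne : S.Nonempty := Finset.card_pos.1 (by omega)
  have h1 := hK.integral_sq_le hX hind hlaw hg hg2 hη.le hbd hne
  have h2 := hN S.card (le_of_max_le_left hS)
  linarith

end Moments

/-! ### Variance of the two-scale estimator of a function vanishing at the point -/

section TwoScaleVariance

variable {d : ℕ} {x : EuclideanSpace ℝ (Fin d)}
variable {Ω : Type*} [MeasurableSpace Ω] {P : Measure Ω} [IsProbabilityMeasure P]
variable {X : ℕ → Ω → EuclideanSpace ℝ (Fin d)} {g : EuclideanSpace ℝ (Fin d) → ℝ}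
variable {K : Finset ℕ → (ℕ → EuclideanSpace ℝ (Fin d) × ℝ) → ℝ}

omit [IsProbabilityMeasure P] in
lemma memLp_comp_of_map_eq (hX : ∀ i, Measurable (X i)) (hlaw : ∀ i, P.map (X i) = P.map (X 0))
    (hg : Measurable g) (hg2 : MemLp (fun ω => g (X 0 ω)) 2 P) (i : ℕ) :
    MemLp (fun ω => g (X i ω)) 2 P := by
  have h : MemLp g 2 (P.map (X 0)) :=
    (memLp_map_measure_iff hg.aestronglyMeasurable (hX 0).aemeasurable).2 hg2
  rw [← hlaw i] at h
  exact (memLp_map_measure_iff hg.aestronglyMeasurable (hX i).aemeasurable).1 h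

lemma natCast_div_floor_le {n t : ℕ} (ht : 1 ≤ t) (htn : t ≤ n) :
    1 / ((n / t : ℕ) : ℝ) ≤ 2 * (t / n) := by
  have hn : (0 : ℝ) < n := by exact_mod_cast (by omega : 0 < n)
  have hb : 0 < n / t := Nat.div_pos htn ht
  have hb' : (0 : ℝ) < ((n / t : ℕ) : ℝ) := by exact_mod_cast hb
  have h : n ≤ 2 * (t * (n / t)) := by
    have h1 := Nat.div_add_mod n t
    have h2 := Nat.mod_lt n ht
    have h3 : t * 1 ≤ t * (n / t) := Nat.mul_le_mul_left _ hb
    omega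
  have h' : (n : ℝ) ≤ 2 * (t * ((n / t : ℕ) : ℝ)) := by exact_mod_cast h
  rw [div_le_iff₀ hb', ← mul_div_assoc, div_mul_eq_mul_div, le_div_iff₀ hn]
  linarith

lemma IsNearestKernel.variance_average_le (hK : IsNearestKernel x K) (hX : ∀ i, Measurable (X i))
    (hind : iIndepFun X P) (hlaw : ∀ i, P.map (X i) = P.map (X 0)) (hg : Measurable g)
    (hg2 : MemLp (fun ω => g (X 0 ω)) 2 P) {n t : ℕ} (ht : 1 ≤ t) (htn : t ≤ n) {δ : ℝ}
    (hδ0 : 0 ≤ δ)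
    (hδ : ∀ S : Finset ℕ, S.card = t → ∫ ω, (K S fun i => (X i ω, g (X i ω))) ^ 2 ∂P ≤ δ) :
    variance (fun ω => (n.choose t : ℝ)⁻¹ * ∑ S ∈ (Finset.range n).powersetCard t,
      K S fun i => (X i ω, g (X i ω))) P ≤ δ * (2 * (t / n)) := by
  have hm := hK.memLp hX (fun i => hg.comp (hX i)) (memLp_comp_of_map_eq hX hlaw hg hg2)
  refine (variance_uStatistic_le (P := P) ht htn (fun S ω => K S fun i => (X i ω, g (X i ω)))
    (V := δ) (fun S _ => hm S) (fun S T _ _ hST => hK.indepFun hX hind hg hST)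
    fun S hS => (variance_le_expectation_sq (hm S).1).trans (hδ S hS)).trans ?_
  rw [div_eq_mul_one_div]
  exact mul_le_mul_of_nonneg_left (natCast_div_floor_le ht htn) hδ0

lemma variance_twoScaleDnn_le (hd : 0 < d) (hX : ∀ i, Measurable (X i))
    (hind : iIndepFun X P) (hlaw : ∀ i, P.map (X i) = P.map (X 0)) (hg : Measurable g)
    (hg2 : MemLp (fun ω => g (X 0 ω)) 2 P) {s t n : ℕ} {w w' δ : ℝ} (hs : 1 ≤ s) (hst : s < t)
    (htn : t ≤ n) (hw : IsTwoScaleWeight d s t w w') (hδ0 : 0 ≤ δ)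
    (hδ : ∀ S : Finset ℕ, s ≤ S.card →
      ∫ ω, (nearestResponse x S fun i => (X i ω, g (X i ω))) ^ 2 ∂P ≤ δ)
    (hδ' : ∀ S : Finset ℕ, s ≤ S.card →
      ∫ ω, (nearestIncrement x S fun i => (X i ω, g (X i ω))) ^ 2 ∂P ≤ δ) :
    variance (fun ω => twoScaleDnn w w' n s t x fun i => (X i ω, g (X i ω))) P
      ≤ (1 + d / 2) ^ 2 * (δ * (2 * (t / n))) := by
  have hm := memLp_comp_of_map_eq hX hlaw hg hg2
  have hmK : ∀ {K : Finset ℕ → (ℕ → EuclideanSpace ℝ (Fin d) × ℝ) → ℝ}, IsNearestKernel x K →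
      ∀ n j, MemLp (fun ω => (n.choose j : ℝ)⁻¹ * ∑ S ∈ (Finset.range n).powersetCard j,
        K S fun i => (X i ω, g (X i ω))) 2 P := fun hK n j =>
    (memLp_finsetSum _ fun S _ => hK.memLp hX (fun i => hg.comp (hX i)) hm S).const_mul _
  set V := δ * (2 * ((t : ℝ) / n)) with hV
  have hV0 : 0 ≤ V := by positivity
  -- The index `t` stands for the term `dnn n t`, and smaller indices stand for increments, so that
  -- one application of Minkowski's inequality covers both.
  set c : ℕ → ℝ := fun j => if j = t then 1 else -w * (1 / (j + 1)) with hc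
  set Z : ℕ → Ω → ℝ := fun j ω => if j = t then dnn n t x fun i => (X i ω, g (X i ω)) else
    (n.choose (j + 1) : ℝ)⁻¹ * ∑ S ∈ (Finset.range n).powersetCard (j + 1),
      nearestIncrement x S fun i => (X i ω, g (X i ω)) with hZ
  have hw0 := hw.nonpos hd hs hst
  have hZm : ∀ j ∈ Finset.Icc s t, MemLp (Z j) 2 P := by
    intro j _
    by_cases hj : j = t
    · simp only [hZ, hj, if_pos]
      exact hmK isNearestKernel_nearestResponse n t
    · simp only [hZ, hj, if_false]
      exact hmK isNearestKernel_nearestIncrement n (j + 1)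
  have hZv : ∀ j ∈ Finset.Icc s t, variance (Z j) P ≤ V := by
    intro j hj
    have hj := Finset.mem_Icc.1 hj
    by_cases hjt : j = t
    · simp only [hZ, hjt, if_pos]
      exact isNearestKernel_nearestResponse.variance_average_le hX hind hlaw hg hg2 (by omega) htn
        hδ0 fun S hS => hδ S (by omega)
    · simp only [hZ, hjt, if_false]
      refine (isNearestKernel_nearestIncrement.variance_average_le hX hind hlaw hg hg2
        (by omega) (by omega) hδ0 fun S hS => hδ' S (by omega)).trans ?_
      rw [hV]
      have : j + 1 ≤ t := by omega
      gcongr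
  have hsum : ∀ ω, twoScaleDnn w w' n s t x (fun i => (X i ω, g (X i ω)))
      = ∑ j ∈ Finset.Icc s t, c j * Z j ω := by
    intro ω
    rw [← Finset.Ico_insert_right hst.le, Finset.sum_insert (by simp),
      twoScaleDnn_eq_sub hw hst]
    congr 1
    · simp [hc, hZ]
    · refine Finset.sum_congr rfl fun j hj => ?_
      have hj := Finset.mem_Ico.1 hj
      rw [dnn_succ_sub_dnn (by omega)]
      simp only [hc, hZ, hj.2.ne, if_false]
      ring
  have hcs : ∑ j ∈ Finset.Icc s t, |c j| ≤ 1 + d / 2 := by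
    rw [← Finset.Ico_insert_right hst.le, Finset.sum_insert (by simp)]
    have h1 : ∑ j ∈ Finset.Ico s t, |c j| = -w * ∑ j ∈ Finset.Ico s t, (1 : ℝ) / (j + 1) := by
      rw [Finset.mul_sum]
      refine Finset.sum_congr rfl fun j hj => ?_
      have hj := Finset.mem_Ico.1 hj
      simp only [hc, hj.2.ne, if_false]
      exact abs_of_nonneg (mul_nonneg (by linarith) (by positivity))
    rw [h1]
    have h2 := hw.neg_mul_sum_le hd hs hst
    have h3 : |c t| = 1 := by simp [hc]
    linarith
  simp_rw [hsum]
  refine (variance_sum_mul_le (P := P) (Finset.Icc s t) c Z hZm).trans ?_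
  calc (∑ j ∈ Finset.Icc s t, |c j| * √(variance (Z j) P)) ^ 2
      ≤ (∑ j ∈ Finset.Icc s t, |c j| * √V) ^ 2 := by
        gcongr with j hj
        exact hZv j hj
    _ = (∑ j ∈ Finset.Icc s t, |c j|) ^ 2 * V := by
        rw [← Finset.sum_mul, mul_pow, Real.sq_sqrt hV0]
    _ ≤ _ := by gcongr

lemma exists_variance_twoScaleDnn_le (hd : 0 < d) (hX : ∀ i, Measurable (X i))
    (hind : iIndepFun X P) (hlaw : ∀ i, P.map (X i) = P.map (X 0)) (hg : Measurable g)
    (hg2 : MemLp (fun ω => g (X 0 ω)) 2 P) (hx : x ∈ (P.map (X 0)).support)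
    (hgx : g x = 0) (hgc : ContinuousAt g x) {η : ℝ} (hη : 0 < η) :
    ∃ N, ∀ (s t n : ℕ) (w w' : ℝ), N ≤ s → s < t → t ≤ n → IsTwoScaleWeight d s t w w' →
      variance (fun ω => twoScaleDnn w w' n s t x fun i => (X i ω, g (X i ω))) P
        ≤ η * (t / n) := by
  set C : ℝ := 2 * (1 + d / 2) ^ 2 with hC
  have hC0 : 0 < C := by positivity
  obtain ⟨N₁, h₁⟩ := isNearestKernel_nearestResponse.exists_integral_sq_le hX hind hlaw hg hg2 hx
    hgx hgc (δ := η / C) (by positivity)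
  obtain ⟨N₂, h₂⟩ := isNearestKernel_nearestIncrement.exists_integral_sq_le hX hind hlaw hg hg2 hx
    hgx hgc (δ := η / C) (by positivity)
  refine ⟨max 1 (max N₁ N₂), fun s t n w w' hs hst htn hw => ?_⟩
  refine (variance_twoScaleDnn_le hd hX hind hlaw hg hg2 (by omega) hst htn hw
    (δ := η / C) (by positivity) (fun S hS => h₁ S (by omega))
    fun S hS => h₂ S (by omega)).trans (le_of_eq ?_)
  have : η / C * C = η := by field_simp
  calc (1 + (d : ℝ) / 2) ^ 2 * (η / C * (2 * (t / n)))
      = η / C * (2 * (1 + (d : ℝ) / 2) ^ 2) * (t / n) := by ring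
    _ = η * (t / n) := by rw [← hC, this]

/-- The square of a mean is at most the second moment. -/
lemma exists_abs_integral_nearestResponse_le (hX : ∀ i, Measurable (X i))
    (hind : iIndepFun X P) (hlaw : ∀ i, P.map (X i) = P.map (X 0)) (hg : Measurable g)
    (hg2 : MemLp (fun ω => g (X 0 ω)) 2 P) (hx : x ∈ (P.map (X 0)).support)
    (hgx : g x = 0) (hgc : ContinuousAt g x) {η : ℝ} (hη : 0 < η) :
    ∃ N, ∀ S : Finset ℕ, N ≤ S.card →
      |∫ ω, nearestResponse x S (fun i => (X i ω, g (X i ω))) ∂P| ≤ η := by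
  obtain ⟨N, h⟩ := isNearestKernel_nearestResponse.exists_integral_sq_le hX hind hlaw hg hg2 hx
    hgx hgc (δ := η ^ 2) (by positivity)
  refine ⟨N, fun S hS => ?_⟩
  have hm : MemLp (fun ω => nearestResponse x S fun i => (X i ω, g (X i ω))) 2 P :=
    isNearestKernel_nearestResponse.memLp hX (fun i => hg.comp (hX i))
      (memLp_comp_of_map_eq hX hlaw hg hg2) S
  have h1 := variance_nonneg (fun ω => nearestResponse x S fun i => (X i ω, g (X i ω))) P
  rw [variance_eq_sub hm] at h1
  have h2 := h S hS
  refine abs_le_of_sq_le_sq ?_ hη.le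
  simp only [Pi.pow_apply] at h1
  linarith

end TwoScaleVariance

/-! ### Independence of the feature process and the noise process -/

section Independence

variable {Ω : Type*} [MeasurableSpace Ω] {P : Measure Ω} [IsProbabilityMeasure P]

lemma iIndepFun_bool {E : Type*} [MeasurableSpace E] {Z : Bool → Ω → E}
    (h : IndepFun (Z false) (Z true) P) : iIndepFun Z P := by
  rw [iIndepFun_iff_measure_inter_preimage_eq_mul]
  intro S sets hS
  have hcases : ∀ S : Finset Bool, S = ∅ ∨ S = {false} ∨ S = {true} ∨ S = {false, true} := by
    decide
  rcases hcases S with rfl | rfl | rfl | rfl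
  · simp
  · simp
  · simp
  · have := h.measure_inter_preimage_eq_mul _ _ (hS false (by simp)) (hS true (by simp))
    rw [Finset.prod_pair (by decide), ← this]
    congr 1
    ext ω
    simp

/-- If the pairs `(X i, ε i)` are independent, and `X i` is independent of `ε i` for each `i`, then
the process `X` is independent of the process `ε`. -/
lemma indepFun_process_of_pairs {E : Type*} [MeasurableSpace E] [Zero E] {X : ℕ → Ω → E}
    {ε : ℕ → Ω → ℝ} (hX : ∀ i, Measurable (X i)) (hε : ∀ i, Measurable (ε i))
    (hpair : iIndepFun (fun i ω => (X i ω, ε i ω)) P) (hXε : ∀ i, IndepFun (X i) (ε i) P) :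
    IndepFun (fun ω i => X i ω) (fun ω i => ε i ω) P := by
  -- Features and noises are padded with zeros into one common space, so that they form a single
  -- family indexed by `ℕ × Bool`. Independence across `i` and within each pair then yields joint
  -- independence.
  set Z : ℕ → Bool → Ω → E × ℝ := fun i b ω => if b then (0, ε i ω) else (X i ω, 0) with hZ
  have hZm : ∀ i b, Measurable (Z i b) := fun i b => by
    cases b
    · exact (hX i).prodMk measurable_const
    · exact measurable_const.prodMk (hε i)
  have h1 : iIndepFun (fun i ω b => Z i b ω) P := by
    refine hpair.comp (fun (_ : ℕ) p (b : Bool) => if b then ((0 : E), p.2) else (p.1, (0 : ℝ))) fun _ => ?_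
    refine measurable_pi_lambda _ fun b => ?_
    cases b
    · exact measurable_fst.prodMk measurable_const
    · exact measurable_const.prodMk measurable_snd
  have h2 : ∀ i, iIndepFun (Z i) P := fun i => iIndepFun_bool <|
    (hXε i).comp (φ := fun e => (e, (0 : ℝ))) (ψ := fun r => ((0 : E), r))
      (measurable_id.prodMk measurable_const) (measurable_const.prodMk measurable_id)
  have h3 := iIndepFun_uncurry' hZm h1 h2
  refine IndepFun.process_indepFun_process hX hε fun I J => ?_
  have h4 := h3.indepFun_finset (I ×ˢ {false}) (J ×ˢ {true})
    (by
      rw [Finset.disjoint_left]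
      rintro ⟨i, b⟩ hi hj
      simp only [Finset.mem_product, Finset.mem_singleton] at hi hj
      exact absurd (hi.2.symm.trans hj.2) (by decide))
    fun p => hZm p.1 p.2
  exact h4.comp
    (φ := fun a (i : I) => (a ⟨(i, false), by simp⟩).1)
    (ψ := fun a (j : J) => (a ⟨(j, true), by simp⟩).2)
    (measurable_pi_lambda _ fun i => (measurable_pi_apply _).fst)
    (measurable_pi_lambda _ fun j => (measurable_pi_apply _).snd)

end Independence

/-! ### Central limit theorem for rank-weighted noise -/

section WeightedCLT

variable {Ω : Type*} [MeasurableSpace Ω] {P : Measure Ω} [IsProbabilityMeasure P]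

/-- Factors are exchanged one at a time; all remaining factors have norm at most one. -/
lemma norm_prod_sub_prod_le_sum {ι : Type*} (s : Finset ι) (a b : ι → ℂ)
    (ha : ∀ i ∈ s, ‖a i‖ ≤ 1) (hb : ∀ i ∈ s, ‖b i‖ ≤ 1) :
    ‖∏ i ∈ s, a i - ∏ i ∈ s, b i‖ ≤ ∑ i ∈ s, ‖a i - b i‖ := by
  classical
  induction s using Finset.induction_on with
  | empty => simp
  | insert j s hj ih =>
    rw [Finset.prod_insert hj, Finset.prod_insert hj, Finset.sum_insert hj]
    have ih := ih (fun i hi => ha i (Finset.mem_insert_of_mem hi))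
      fun i hi => hb i (Finset.mem_insert_of_mem hi)
    have hP : ‖∏ i ∈ s, a i‖ ≤ 1 := by
      rw [norm_prod]
      exact Finset.prod_le_one (fun _ _ => norm_nonneg _)
        fun i hi => ha i (Finset.mem_insert_of_mem hi)
    have hbj := hb j (Finset.mem_insert_self _ _)
    have e : a j * ∏ i ∈ s, a i - b j * ∏ i ∈ s, b i
        = (a j - b j) * ∏ i ∈ s, a i + b j * (∏ i ∈ s, a i - ∏ i ∈ s, b i) := by ring
    rw [e]
    refine (norm_add_le _ _).trans ?_
    rw [norm_mul, norm_mul]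
    have h1 : ‖a j - b j‖ * ‖∏ i ∈ s, a i‖ ≤ ‖a j - b j‖ :=
      mul_le_of_le_one_right (norm_nonneg _) hP
    have h2 : ‖b j‖ * ‖∏ i ∈ s, a i - ∏ i ∈ s, b i‖ ≤ ‖∏ i ∈ s, a i - ∏ i ∈ s, b i‖ :=
      mul_le_of_le_one_left (norm_nonneg _) hbj
    linarith

/-- The characteristic function of a standardized variable is close to the Gaussian one near `0`. -/
lemma charFun_sub_exp_isLittleO {Y : Ω → ℝ} (hY : AEMeasurable Y P) (h0 : P[Y] = 0)
    (h1 : P[Y ^ 2] = 1) :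
    (fun u : ℝ => charFun (P.map Y) u - Complex.exp (-(u : ℂ) ^ 2 / 2)) =o[𝓝 0]
      fun u : ℝ => u ^ 2 := by
  have h2 := taylor_charFun_two hY h0 h1
  have h3 : (fun u : ℝ => Complex.exp (-(u : ℂ) ^ 2 / 2) - (1 - (u : ℂ) ^ 2 / 2)) =o[𝓝 0]
      fun u : ℝ => u ^ 2 := by
    have h4 : (fun u : ℝ => Complex.exp (-(u : ℂ) ^ 2 / 2) - (1 - (u : ℂ) ^ 2 / 2)) =O[𝓝 0]
        fun u : ℝ => u ^ 4 := by
      refine IsBigO.of_bound 1 ?_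
      filter_upwards [Metric.ball_mem_nhds (0 : ℝ) one_pos] with u hu
      have hu1 : |u| < 1 := by simpa using hu
      have hn : ‖-(u : ℂ) ^ 2 / 2‖ = u ^ 2 / 2 := by
        rw [norm_div, norm_neg, norm_pow, Complex.norm_real, Real.norm_eq_abs, sq_abs]
        simp
      have hu2 : u ^ 2 ≤ 1 := by
        rw [← sq_abs]; nlinarith [abs_nonneg u]
      have := Complex.norm_exp_sub_one_sub_id_le (x := -(u : ℂ) ^ 2 / 2) (by rw [hn]; linarith)
      have e : Complex.exp (-(u : ℂ) ^ 2 / 2) - (1 - (u : ℂ) ^ 2 / 2)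
          = Complex.exp (-(u : ℂ) ^ 2 / 2) - 1 - -(u : ℂ) ^ 2 / 2 := by ring
      rw [e]
      refine this.trans ?_
      rw [hn, Real.norm_eq_abs, abs_of_nonneg (by positivity)]
      nlinarith [sq_nonneg (u ^ 2)]
    exact h4.trans_isLittleO (isLittleO_pow_pow (by norm_num))
  refine (h2.sub h3).congr_left fun u => ?_
  ring

/-- Lindeberg's theorem for weighted sums of a fixed law, for characteristic functions. -/
lemma tendsto_prod_charFun {Y : Ω → ℝ} (hY : AEMeasurable Y P) (h0 : P[Y] = 0)
    (h1 : P[Y ^ 2] = 1) (c : ℕ → ℕ → ℝ)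
    (hc : ∀ᶠ n in atTop, ∑ k ∈ Finset.range n, c n k ^ 2 = 1)
    (hmax : ∀ η > 0, ∀ᶠ n in atTop, ∀ k < n, |c n k| ≤ η) (u : ℝ) :
    Tendsto (fun n => ∏ k ∈ Finset.range n, charFun (P.map Y) (c n k * u)) atTop
      (𝓝 (Complex.exp (-(u : ℂ) ^ 2 / 2))) := by
  have : IsProbabilityMeasure (P.map Y) := Measure.isProbabilityMeasure_map hY
  rw [Metric.tendsto_nhds]
  intro η hη
  obtain ⟨θ, hθ, hθη⟩ : ∃ θ > 0, θ * u ^ 2 < η :=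
    ⟨η / (u ^ 2 + 1), by positivity, by
      rw [div_mul_eq_mul_div, div_lt_iff₀ (by positivity)]; nlinarith⟩
  obtain ⟨δ, hδ, hδθ⟩ := Metric.eventually_nhds_iff.1
    ((charFun_sub_exp_isLittleO hY h0 h1).bound hθ)
  -- Using `|u| + 1` in place of `|u|` avoids a division by zero at `u = 0`.
  have hu1 : 0 < |u| + 1 := by positivity
  filter_upwards [hc, hmax (δ / (2 * (|u| + 1))) (by positivity)] with n hn hm
  have hsmall : ∀ k ∈ Finset.range n, |c n k * u| < δ := by
    intro k hk
    rw [abs_mul]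
    calc |c n k| * |u| ≤ δ / (2 * (|u| + 1)) * (|u| + 1) := by
          gcongr
          · exact hm k (Finset.mem_range.1 hk)
          · linarith
      _ = δ / 2 := by field_simp
      _ < δ := half_lt_self hδ
  have e : Complex.exp (-(u : ℂ) ^ 2 / 2)
      = ∏ k ∈ Finset.range n, Complex.exp (-((c n k * u : ℝ) : ℂ) ^ 2 / 2) := by
    rw [← Complex.exp_sum]
    congr 1
    have : ((∑ k ∈ Finset.range n, c n k ^ 2 : ℝ) : ℂ) = 1 := by rw [hn]; simp
    push_cast at this ⊢
    calc -(u : ℂ) ^ 2 / 2 = -(u : ℂ) ^ 2 / 2 * ∑ k ∈ Finset.range n, (c n k : ℂ) ^ 2 := by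
          rw [this, mul_one]
      _ = _ := by
          rw [Finset.mul_sum]
          exact Finset.sum_congr rfl fun k _ => by ring
  rw [dist_eq_norm, e]
  refine (norm_prod_sub_prod_le_sum _ _ _ (fun k _ => norm_charFun_le_one _) fun k _ => ?_).trans_lt
    ?_
  · rw [Complex.norm_exp]
    have : (-((c n k * u : ℝ) : ℂ) ^ 2 / 2).re = -(c n k * u) ^ 2 / 2 := by
      rw [← Complex.ofReal_pow, ← Complex.ofReal_neg]
      have : ((-(c n k * u) ^ 2 : ℝ) : ℂ) / 2 = ((-(c n k * u) ^ 2 / 2 : ℝ) : ℂ) := by push_cast; ring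
      rw [this, Complex.ofReal_re]
    rw [this, Real.exp_le_one_iff]
    nlinarith [sq_nonneg (c n k * u)]
  · calc ∑ k ∈ Finset.range n, ‖charFun (P.map Y) (c n k * u)
          - Complex.exp (-((c n k * u : ℝ) : ℂ) ^ 2 / 2)‖
        ≤ ∑ k ∈ Finset.range n, θ * u ^ 2 * c n k ^ 2 := by
          refine Finset.sum_le_sum fun k hk => ?_
          have h := hδθ (y := c n k * u) (by simpa using hsmall k hk)
          refine h.trans (le_of_eq ?_)
          rw [Real.norm_eq_abs, abs_of_nonneg (sq_nonneg _)]
          ring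
      _ = θ * u ^ 2 := by rw [← Finset.mul_sum, hn, mul_one]
      _ < η := hθη

variable {d : ℕ} {X : ℕ → Ω → EuclideanSpace ℝ (Fin d)} {ε : ℕ → Ω → ℝ}
  {x : EuclideanSpace ℝ (Fin d)}

lemma measurable_distRank (n i : ℕ) : Measurable fun ξ => distRank x n ξ i := by
  classical
  have h : (fun ξ => distRank x n ξ i) = fun ξ => ∑ j ∈ Finset.range n,
      if distKey x ξ j < distKey x ξ i then 1 else 0 := by
    ext ξ
    rw [distRank, Finset.card_filter]
  rw [h]
  refine Finset.measurable_sum _ fun j _ => ?_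
  refine Measurable.ite ?_ measurable_const measurable_const
  simp only [distKey_lt_iff]
  have hm : ∀ k, Measurable fun ξ : ℕ → EuclideanSpace ℝ (Fin d) => ‖ξ k - x‖ :=
    fun k => by fun_prop
  exact (measurableSet_lt (hm j) (hm i)).union
    ((measurableSet_eq_fun (hm j) (hm i)).inter (MeasurableSet.const _))

lemma measurable_rankedSum (n : ℕ) (c : ℕ → ℝ) :
    Measurable fun p : (ℕ → EuclideanSpace ℝ (Fin d)) × (ℕ → ℝ) =>
      ∑ i ∈ Finset.range n, c (distRank x n p.1 i) * p.2 i := by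
  refine Finset.measurable_sum _ fun i _ => Measurable.mul ?_ ?_
  · exact (measurable_from_top (f := c)).comp ((measurable_distRank n i).comp measurable_fst)
  · exact (measurable_pi_apply i).comp measurable_snd

/-- Conditionally on the features, a sum of the noises weighted by ranks has the law of the sum with
the weights in any fixed order. -/
lemma charFun_rankedSum (hX : ∀ i, Measurable (X i)) (hε : ∀ i, Measurable (ε i))
    (hindε : iIndepFun ε P) (hlawε : ∀ i, P.map (ε i) = P.map (ε 0))
    (hproc : IndepFun (fun ω i => X i ω) (fun ω i => ε i ω) P) (n : ℕ) (c : ℕ → ℝ) (u : ℝ) :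
    charFun (P.map fun ω => ∑ i ∈ Finset.range n,
      c (distRank x n (fun i => X i ω) i) * ε i ω) u
      = ∏ k ∈ Finset.range n, charFun (P.map (ε 0)) (c k * u) := by
  set F : (ℕ → EuclideanSpace ℝ (Fin d)) × (ℕ → ℝ) → ℝ := fun p =>
    ∑ i ∈ Finset.range n, c (distRank x n p.1 i) * p.2 i with hF
  have hFm : Measurable F := measurable_rankedSum n c
  have hXp : Measurable fun ω i => X i ω := measurable_pi_lambda _ hX
  have hεp : Measurable fun ω i => ε i ω := measurable_pi_lambda _ hε
  have hpm : Measurable fun ω => ((fun i => X i ω), fun i => ε i ω) := hXp.prodMk hεp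
  set ν := P.map fun ω i => X i ω with hν
  set ρ := P.map fun ω i => ε i ω with hρ
  have hνp : IsProbabilityMeasure ν := Measure.isProbabilityMeasure_map hXp.aemeasurable
  have hρp : IsProbabilityMeasure ρ := Measure.isProbabilityMeasure_map hεp.aemeasurable
  have hmap : P.map (fun ω => ∑ i ∈ Finset.range n,
      c (distRank x n (fun i => X i ω) i) * ε i ω) = (ν.prod ρ).map F := by
    rw [← (indepFun_iff_map_prod_eq_prod_map_map hXp.aemeasurable hεp.aemeasurable).1 hproc,
      Measure.map_map hFm hpm]
    rfl
  have hexp : Measurable fun p : (ℕ → EuclideanSpace ℝ (Fin d)) × (ℕ → ℝ) =>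
      Complex.exp (u * F p * Complex.I) := by fun_prop
  have hint : Integrable (fun p : (ℕ → EuclideanSpace ℝ (Fin d)) × (ℕ → ℝ) =>
      Complex.exp (u * F p * Complex.I)) (ν.prod ρ) := by
    refine (integrable_const (1 : ℝ)).mono' hexp.aestronglyMeasurable (ae_of_all _ fun p => ?_)
    rw [← Complex.ofReal_mul, Complex.norm_exp_ofReal_mul_I]
  -- With the features frozen at `ξ`, the ranks permute `range n`. The characteristic function is
  -- therefore the same product for every `ξ`, and integrating over `ξ` changes nothing.
  have hinner : ∀ ξ, ∫ e, Complex.exp (u * F (ξ, e) * Complex.I) ∂ρ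
      = ∏ k ∈ Finset.range n, charFun (P.map (ε 0)) (c k * u) := by
    intro ξ
    have hGm : Measurable fun e => F (ξ, e) := hFm.comp measurable_prodMk_left
    have h1 : ∫ e, Complex.exp (u * F (ξ, e) * Complex.I) ∂ρ
        = charFun (P.map fun ω => ∑ i ∈ Finset.range n, c (distRank x n ξ i) * ε i ω) u := by
      have h2 : P.map (fun ω => ∑ i ∈ Finset.range n, c (distRank x n ξ i) * ε i ω)
          = ρ.map fun e => F (ξ, e) := by
        rw [hρ, Measure.map_map hGm hεp]; rfl
      rw [h2, charFun_apply_real, integral_map hGm.aemeasurable (by fun_prop)]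
    have hind : iIndepFun (fun i ω => c (distRank x n ξ i) * ε i ω) P :=
      hindε.comp (fun i r => c (distRank x n ξ i) * r) fun i => measurable_const_mul _
    rw [h1, iIndepFun.charFun_map_fun_finsetSum_eq_prod
      (fun i _ => ((hε i).const_mul _).aemeasurable) (hind.restrict _), Finset.prod_apply,
      ← prod_distRank (x := x) (ξ := ξ) n fun k => charFun (P.map (ε 0)) (c k * u)]
    refine Finset.prod_congr rfl fun i _ => ?_
    rw [charFun_map_mul_comp (hε i).aemeasurable, hlawε i]
  rw [hmap, charFun_apply_real, integral_map hFm.aemeasurable (by fun_prop), integral_prod _ hint]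
  simp_rw [hinner]
  simp

lemma tendsto_charFun_rankedSum (hX : ∀ i, Measurable (X i)) (hε : ∀ i, Measurable (ε i))
    (hindε : iIndepFun ε P) (hlawε : ∀ i, P.map (ε i) = P.map (ε 0))
    (hproc : IndepFun (fun ω i => X i ω) (fun ω i => ε i ω) P)
    (h0 : ∫ ω, ε 0 ω ∂P = 0) (h2 : MemLp (ε 0) 2 P) (hv : 0 < variance (ε 0) P)
    (c : ℕ → ℕ → ℝ)
    (hc : ∀ᶠ n in atTop, variance (ε 0) P * ∑ k ∈ Finset.range n, c n k ^ 2 = 1)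
    (hmax : ∀ η > 0, ∀ᶠ n in atTop, ∀ k < n, |c n k| ≤ η) (u : ℝ) :
    Tendsto (fun n => charFun (P.map fun ω => ∑ i ∈ Finset.range n,
      c n (distRank x n (fun i => X i ω) i) * ε i ω) u) atTop
      (𝓝 (charFun (gaussianReal 0 1) u)) := by
  set v := variance (ε 0) P with hvdef
  have hsv : 0 < √v := Real.sqrt_pos.2 hv
  set Y : Ω → ℝ := fun ω => (√v)⁻¹ * ε 0 ω with hYdef
  have hY : AEMeasurable Y P := ((hε 0).const_mul _).aemeasurable
  have hY0 : P[Y] = 0 := by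
    rw [hYdef, integral_const_mul, h0, mul_zero]
  have hY1 : P[Y ^ 2] = 1 := by
    have e : v = ∫ ω, ε 0 ω ^ 2 ∂P := by
      rw [hvdef, variance_eq_sub h2, h0]; simp
    simp only [hYdef, Pi.pow_apply, mul_pow]
    rw [integral_const_mul, ← e, inv_pow, Real.sq_sqrt hv.le, inv_mul_cancel₀ hv.ne']
  have hlim := tendsto_prod_charFun hY hY0 hY1 (fun n k => √v * c n k)
    (by
      filter_upwards [hc] with n hn
      rw [← hn, Finset.mul_sum]
      exact Finset.sum_congr rfl fun k _ => by rw [mul_pow, Real.sq_sqrt hv.le])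
    (fun η hη => by
      filter_upwards [hmax (η / √v) (by positivity)] with n hn k hk
      rw [abs_mul, abs_of_pos hsv]
      have := mul_le_mul_of_nonneg_left (hn k hk) hsv.le
      rwa [mul_div_cancel₀ _ hsv.ne'] at this) u
  have hgauss : charFun (gaussianReal 0 1) u = Complex.exp (-(u : ℂ) ^ 2 / 2) := by
    rw [charFun_gaussianReal]
    congr 1
    push_cast
    ring
  rw [hgauss]
  refine hlim.congr fun n => ?_
  rw [charFun_rankedSum hX hε hindε hlawε hproc]
  refine Finset.prod_congr rfl fun k _ => ?_
  rw [hYdef, charFun_map_mul_comp (hε 0).aemeasurable]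
  congr 1
  field_simp

/-- Central limit theorem for sums of the noises weighted by ranks. -/
lemma tendstoInDistribution_rankedSum (hX : ∀ i, Measurable (X i)) (hε : ∀ i, Measurable (ε i))
    (hindε : iIndepFun ε P) (hlawε : ∀ i, P.map (ε i) = P.map (ε 0))
    (hproc : IndepFun (fun ω i => X i ω) (fun ω i => ε i ω) P)
    (h0 : ∫ ω, ε 0 ω ∂P = 0) (h2 : MemLp (ε 0) 2 P) (hv : 0 < variance (ε 0) P)
    (c : ℕ → ℕ → ℝ)
    (hc : ∀ᶠ n in atTop, variance (ε 0) P * ∑ k ∈ Finset.range n, c n k ^ 2 = 1)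
    (hmax : ∀ η > 0, ∀ᶠ n in atTop, ∀ k < n, |c n k| ≤ η) :
    TendstoInDistribution (fun n ω => ∑ i ∈ Finset.range n,
      c n (distRank x n (fun i => X i ω) i) * ε i ω) atTop (id : ℝ → ℝ) (fun _ => P)
      (gaussianReal 0 1) where
  forall_aemeasurable n := ((measurable_rankedSum n (c n)).comp
    ((measurable_pi_lambda _ hX).prodMk (measurable_pi_lambda _ hε))).aemeasurable
  tendsto := by
    refine ProbabilityMeasure.tendsto_iff_tendsto_charFun.2 fun u => ?_
    rw! [Measure.map_id]
    exact tendsto_charFun_rankedSum hX hε hindε hlawε hproc h0 h2 hv c hc hmax u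

end WeightedCLT

/-! ### Taylor expansion and integrals over small balls -/

section LocalExpansion

variable {E : Type*} [NormedAddCommGroup E] [NormedSpace ℝ E]

/-- Second order Taylor expansion with Peano remainder. -/
lemma exists_taylor_two_of_contDiffAt {g : E → ℝ} {x : E} (hg : ContDiffAt ℝ 2 g x) :
    ∃ (L : E →L[ℝ] ℝ) (B : E →L[ℝ] E →L[ℝ] ℝ),
      (fun v => g (x + v) - g x - L v - 2⁻¹ * B v v) =o[𝓝 0] fun v => ‖v‖ ^ 2 := by
  set L := fderiv ℝ g x with hL
  set B := fderiv ℝ (fderiv ℝ g) x with hB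
  have hsymm : ∀ v w, B v w = B w v := fun v w =>
    hg.isSymmSndFDerivAt (by simp) v w
  have hB' : HasFDerivAt (fderiv ℝ g) B x :=
    ((hg.fderiv_right (m := 1) (by norm_num)).differentiableAt (by norm_num)).hasFDerivAt
  refine ⟨L, B, ?_⟩
  rw [isLittleO_iff]
  intro c hc
  have h1 := (hasFDerivAt_iff_isLittleO_nhds_zero.1 hB').bound hc
  have h2 : ∀ᶠ v in 𝓝 (0 : E), DifferentiableAt ℝ g (x + v) := by
    have h3 : ∀ᶠ y in 𝓝 x, DifferentiableAt ℝ g y := by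
      filter_upwards [hg.eventually (by simp)] with y hy
      exact hy.differentiableAt (by norm_num)
    have h4 : Tendsto (fun v : E => x + v) (𝓝 0) (𝓝 x) := by
      have : Continuous fun v : E => x + v := by fun_prop
      simpa using this.tendsto 0
    exact h4.eventually h3
  obtain ⟨δ, hδ, hball⟩ := Metric.eventually_nhds_iff.1 (h1.and h2)
  refine Metric.eventually_nhds_iff.2 ⟨δ, hδ, fun v hv => ?_⟩
  have hv' : ‖v‖ < δ := by simpa using hv
  set φ : E → ℝ := fun v => g (x + v) - g x - L v - 2⁻¹ * B v v with hφ
  have hder : ∀ u ∈ Metric.closedBall (0 : E) ‖v‖,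
      HasFDerivWithinAt φ (fderiv ℝ g (x + u) - L - B u) (Metric.closedBall 0 ‖v‖) u := by
    intro u hu
    have hu' : dist u 0 < δ := (Metric.mem_closedBall.1 hu).trans_lt hv'
    have d1 : HasFDerivAt (fun u => g (x + u)) (fderiv ℝ g (x + u)) u := by
      have := (hball hu').2.hasFDerivAt.comp u ((hasFDerivAt_id u).const_add x)
      rwa [ContinuousLinearMap.comp_id] at this
    have d2 : HasFDerivAt (fun u => B u u) (B u + B.flip u) u := by
      have := B.hasFDerivAt.clm_apply (hasFDerivAt_id u)
      simpa using this
    have d3 := ((d1.sub_const (g x)).sub L.hasFDerivAt).sub (d2.const_mul (2⁻¹ : ℝ))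
    -- Symmetry of the second derivative turns the derivative of `2⁻¹ * B u u` into `B u`. The
    -- derivative of the remainder is then the first-order error of `fderiv ℝ g`, and the mean value
    -- inequality on the ball of radius `‖v‖` supplies the second factor `‖v‖`.
    have e : fderiv ℝ g (x + u) - L - (2⁻¹ : ℝ) • (B u + B.flip u)
        = fderiv ℝ g (x + u) - L - B u := by
      ext w
      simp only [sub_apply, smul_apply,
        add_apply, ContinuousLinearMap.flip_apply, smul_eq_mul]
      rw [hsymm w u]
      ring
    rw [e] at d3
    exact d3.hasFDerivWithinAt
  have hbd : ∀ u ∈ Metric.closedBall (0 : E) ‖v‖, ‖fderiv ℝ g (x + u) - L - B u‖ ≤ c * ‖v‖ := by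
    intro u hu
    have hu' : dist u 0 < δ := (Metric.mem_closedBall.1 hu).trans_lt hv'
    have hun : ‖u‖ ≤ ‖v‖ := by simpa using hu
    exact (hball hu').1.trans (by gcongr)
  have := Convex.norm_image_sub_le_of_norm_hasFDerivWithin_le hder hbd (convex_closedBall _ _)
    (Metric.mem_closedBall_self (norm_nonneg v)) (show v ∈ Metric.closedBall (0 : E) ‖v‖ by simp)
  have h0 : φ 0 = 0 := by simp [hφ]
  rw [h0, sub_zero, sub_zero] at this
  refine this.trans (le_of_eq ?_)
  rw [Real.norm_eq_abs, abs_of_nonneg (sq_nonneg _)]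
  ring

variable [MeasurableSpace E] [BorelSpace E] [FiniteDimensional ℝ E] (μ : Measure E)
  [μ.IsAddHaarMeasure]

lemma setIntegral_closedBall_isLittleO {φ : E → ℝ} {k : ℕ} (h : φ =o[𝓝 0] fun v => ‖v‖ ^ k) :
    (fun r : ℝ => ∫ v in Metric.closedBall 0 r, φ v ∂μ) =o[𝓝[>] 0]
      fun r => r ^ (Module.finrank ℝ E + k) := by
  rw [isLittleO_iff]
  intro c hc
  set V := μ.real (Metric.ball (0 : E) 1) with hV
  have hV0 : 0 ≤ V := measureReal_nonneg
  obtain ⟨δ, hδ, hball⟩ := Metric.eventually_nhds_iff.1 (h.bound (show 0 < c / (V + 1) by positivity))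
  filter_upwards [Ioo_mem_nhdsGT hδ] with r hr
  have hr0 : 0 < r := hr.1
  have hle : ∀ v ∈ Metric.closedBall (0 : E) r, ‖φ v‖ ≤ c / (V + 1) * r ^ k := by
    intro v hv
    have hvr : ‖v‖ ≤ r := by simpa using hv
    refine (hball (show dist v 0 < δ by simpa using hvr.trans_lt hr.2)).trans ?_
    rw [norm_pow, norm_norm]
    gcongr
  refine (norm_setIntegral_le_of_norm_le_const measure_closedBall_lt_top hle).trans ?_
  rw [Measure.addHaar_real_closedBall μ 0 hr0.le, Real.norm_eq_abs, abs_of_pos (by positivity)]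
  calc c / (V + 1) * r ^ k * (r ^ Module.finrank ℝ E * V)
      = c * r ^ (Module.finrank ℝ E + k) * (V / (V + 1)) := by rw [pow_add]; ring
    _ ≤ c * r ^ (Module.finrank ℝ E + k) * 1 := by
        gcongr
        rw [div_le_one (by positivity)]
        linarith
    _ = _ := mul_one _

/-- The reflection `v ↦ -v` preserves the ball and the measure and changes the sign of the
integrand. This removes the first-order term of the bias. -/
lemma setIntegral_closedBall_clm_eq_zero (L : E →L[ℝ] ℝ) (r : ℝ) :
    ∫ v in Metric.closedBall 0 r, L v ∂μ = 0 := by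
  rw [← integral_indicator Metric.isClosed_closedBall.measurableSet]
  have h := integral_neg_eq_self (fun v => (Metric.closedBall (0 : E) r).indicator (fun v => L v) v) μ
  have e : ∀ v, (Metric.closedBall (0 : E) r).indicator (fun v => L v) (-v)
      = -(Metric.closedBall (0 : E) r).indicator (fun v => L v) v := by
    intro v
    by_cases hv : ‖v‖ ≤ r
    · rw [Set.indicator_of_mem (by simpa using hv), Set.indicator_of_mem (by simpa using hv), map_neg]
    · rw [Set.indicator_of_notMem (by simpa using hv), Set.indicator_of_notMem (by simpa using hv),
        neg_zero]
  simp_rw [e] at h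
  rw [integral_neg] at h
  linarith

lemma setIntegral_closedBall_bilin (B : E →L[ℝ] E →L[ℝ] ℝ) {r : ℝ} (hr : 0 < r) :
    ∫ v in Metric.closedBall 0 r, B v v ∂μ
      = r ^ (Module.finrank ℝ E + 2) * ∫ v in Metric.closedBall 0 1, B v v ∂μ := by
  have h := Measure.setIntegral_comp_smul_of_pos μ (fun v => B v v) (Metric.closedBall (0 : E) 1) hr
  rw [smul_closedBall _ _ zero_le_one, smul_zero, Real.norm_eq_abs, abs_of_pos hr, mul_one,
    smul_eq_mul] at h
  simp only [map_smul, smul_apply, smul_eq_mul] at h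
  have e : ∀ v : E, r * (r * B v v) = r ^ 2 * B v v := fun v => by ring
  simp_rw [e] at h
  rw [integral_const_mul] at h
  have hne : r ^ Module.finrank ℝ E ≠ 0 := by positivity
  rw [eq_inv_mul_iff_mul_eq₀ hne] at h
  rw [← h, pow_add]
  ring

omit [NormedSpace ℝ E] [FiniteDimensional ℝ E] in
lemma setIntegral_closedBall_translate (g : E → ℝ) (x : E) (r : ℝ) :
    ∫ y in Metric.closedBall x r, g y ∂μ = ∫ v in Metric.closedBall 0 r, g (x + v) ∂μ := by
  rw [← (measurePreserving_add_left μ x).setIntegral_preimage_emb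
    (measurableEmbedding_addLeft x)]
  congr 2
  ext v
  simp

/-- Integrals over small balls of a `C²` function vanishing at the centre. -/
lemma exists_tendsto_setIntegral_closedBall_div {g : E → ℝ} {x : E} (hg : ContDiffAt ℝ 2 g x)
    (hgx : g x = 0) : ∃ κ : ℝ, Tendsto (fun r : ℝ => (∫ y in Metric.closedBall x r, g y ∂μ)
      / r ^ (Module.finrank ℝ E + 2)) (𝓝[>] 0) (𝓝 κ) := by
  obtain ⟨L, B, h⟩ := exists_taylor_two_of_contDiffAt hg
  set φ : E → ℝ := fun v => g (x + v) - g x - L v - 2⁻¹ * B v v with hφ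
  have hlo := setIntegral_closedBall_isLittleO μ h
  refine ⟨2⁻¹ * ∫ v in Metric.closedBall 0 1, B v v ∂μ, ?_⟩
  have hcont : ∃ δ > 0, ContinuousOn (fun v => g (x + v)) (Metric.closedBall 0 δ) := by
    obtain ⟨δ, hδ, hc⟩ := Metric.eventually_nhds_iff.1 (hg.eventually (by simp))
    refine ⟨δ / 2, half_pos hδ, fun v hv => ?_⟩
    have hv' : dist (x + v) x < δ := by
      have : ‖v‖ ≤ δ / 2 := by simpa using hv
      simpa using this.trans_lt (half_lt_self hδ)
    exact ((hc hv').continuousAt.comp (f := fun v => x + v) (by fun_prop)).continuousWithinAt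
  obtain ⟨δ, hδ, hcont⟩ := hcont
  have h0 := (isLittleO_iff_tendsto' (by
    filter_upwards [self_mem_nhdsWithin] with r hr hr0
    exact absurd hr0 (pow_pos hr _).ne')).1 hlo
  have h1 := h0.add_const (2⁻¹ * ∫ v in Metric.closedBall 0 1, B v v ∂μ)
  rw [zero_add] at h1
  refine h1.congr' ?_
  filter_upwards [Ioo_mem_nhdsGT hδ] with r hr
  have hr0 : 0 < r := hr.1
  have hsub : Metric.closedBall (0 : E) r ⊆ Metric.closedBall 0 δ :=
    Metric.closedBall_subset_closedBall hr.2.le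
  have hK : IsCompact (Metric.closedBall (0 : E) r) := isCompact_closedBall 0 r
  have i1 : IntegrableOn (fun v => g (x + v)) (Metric.closedBall 0 r) μ :=
    (hcont.mono hsub).integrableOn_compact hK
  have i2 : IntegrableOn (fun v => L v) (Metric.closedBall 0 r) μ :=
    L.continuous.continuousOn.integrableOn_compact hK
  have i3 : IntegrableOn (fun v => 2⁻¹ * B v v) (Metric.closedBall 0 r) μ :=
    ContinuousOn.integrableOn_compact hK (by fun_prop)
  have e : ∫ v in Metric.closedBall 0 r, φ v ∂μ = (∫ y in Metric.closedBall x r, g y ∂μ)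
      - 2⁻¹ * (r ^ (Module.finrank ℝ E + 2) * ∫ v in Metric.closedBall 0 1, B v v ∂μ) := by
    have : ∀ v, φ v = g (x + v) - L v - 2⁻¹ * B v v := fun v => by simp [hφ, hgx]
    simp_rw [this]
    rw [integral_sub (f := fun v => g (x + v) - L v) (i1.sub i2) i3, integral_sub i1 i2, setIntegral_closedBall_clm_eq_zero,
      integral_const_mul, setIntegral_closedBall_bilin μ B hr0, sub_zero,
      setIntegral_closedBall_translate μ g x r]
  have hp : r ^ (Module.finrank ℝ E + 2) ≠ 0 := by positivity
  rw [e]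
  field_simp
  ring

lemma tendsto_setIntegral_closedBall_div {f : E → ℝ} {x : E}
    (hf : ∀ᶠ y in 𝓝 x, ContinuousAt f y) :
    Tendsto (fun r : ℝ => (∫ y in Metric.closedBall x r, f y ∂μ) / r ^ Module.finrank ℝ E)
      (𝓝[>] 0) (𝓝 (f x * μ.real (Metric.ball 0 1))) := by
  have h : (fun v => f (x + v) - f x) =o[𝓝 0] fun v : E => ‖v‖ ^ 0 := by
    simp only [pow_zero]
    rw [isLittleO_one_iff]
    have : Tendsto (fun v : E => f (x + v)) (𝓝 0) (𝓝 (f x)) := by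
      refine hf.self_of_nhds.tendsto.comp ?_
      have : Continuous fun v : E => x + v := by fun_prop
      simpa using this.tendsto 0
    simpa using this.sub_const (f x)
  have hlo := setIntegral_closedBall_isLittleO μ h
  rw [add_zero] at hlo
  obtain ⟨δ, hδ, hc⟩ := Metric.eventually_nhds_iff.1 hf
  have h0 := (isLittleO_iff_tendsto' (by
    filter_upwards [self_mem_nhdsWithin] with r hr hr0
    exact absurd hr0 (pow_pos hr _).ne')).1 hlo
  have h1 := h0.add_const (f x * μ.real (Metric.ball 0 1))
  rw [zero_add] at h1
  refine h1.congr' ?_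
  filter_upwards [Ioo_mem_nhdsGT hδ] with r hr
  have hr0 : 0 < r := hr.1
  have i1 : IntegrableOn (fun v => f (x + v)) (Metric.closedBall 0 r) μ := by
    refine ContinuousOn.integrableOn_compact (isCompact_closedBall 0 r) fun v hv => ?_
    have hv' : dist (x + v) x < δ := by
      have : ‖v‖ ≤ r := by simpa using hv
      simpa using this.trans_lt hr.2
    exact ((hc hv').comp (f := fun v => x + v) (by fun_prop)).continuousWithinAt
  have hfin : IsFiniteMeasure (μ.restrict (Metric.closedBall (0 : E) r)) :=
    ⟨by simpa using measure_closedBall_lt_top⟩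
  rw [integral_sub i1 (integrable_const _), setIntegral_closedBall_translate μ f x r]
  have hp : r ^ Module.finrank ℝ E ≠ 0 := by positivity
  have e : ∫ _v in Metric.closedBall (0 : E) r, f x ∂μ
      = r ^ Module.finrank ℝ E * μ.real (Metric.ball 0 1) * f x := by
    rw [setIntegral_const, Measure.addHaar_real_closedBall μ 0 hr0.le, smul_eq_mul]
  rw [e]
  field_simp
  ring

end LocalExpansion

/-! ### The expected nearest response as an integral -/

section Expectation

variable {d : ℕ} {x : EuclideanSpace ℝ (Fin d)}
variable {Ω : Type*} [MeasurableSpace Ω] {P : Measure Ω} [IsProbabilityMeasure P]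
variable {X : ℕ → Ω → EuclideanSpace ℝ (Fin d)} {g : EuclideanSpace ℝ (Fin d) → ℝ}

/-- By Fubini: with `X i` fixed, a tie places `X j` on a sphere around `x`, which is null for its
law. -/
lemma ae_norm_sub_ne (hX : ∀ i, Measurable (X i)) (hind : iIndepFun X P)
    (hlaw : ∀ i, P.map (X i) = P.map (X 0))
    (hsph : ∀ r, P.map (X 0) (Metric.sphere x r) = 0) {i j : ℕ} (hij : i ≠ j) :
    ∀ᵐ ω ∂P, ‖X i ω - x‖ ≠ ‖X j ω - x‖ := by
  set A : Set (EuclideanSpace ℝ (Fin d) × EuclideanSpace ℝ (Fin d)) :=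
    {p | ‖p.1 - x‖ = ‖p.2 - x‖} with hA
  have hAm : MeasurableSet A := measurableSet_eq_fun (by fun_prop) (by fun_prop)
  have hp := Measure.isProbabilityMeasure_map (μ := P) (hX i).aemeasurable
  have hp' := Measure.isProbabilityMeasure_map (μ := P) (hX j).aemeasurable
  have h0 : ((P.map (X i)).prod (P.map (X j))) A = 0 := by
    rw [Measure.measure_prod_null hAm]
    refine ae_of_all _ fun a => ?_
    have : Prod.mk a ⁻¹' A = Metric.sphere x ‖a - x‖ := by
      ext b
      simp [hA, eq_comm]
    change P.map (X j) (Prod.mk a ⁻¹' A) = 0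
    rw [this, hlaw j]
    exact hsph _
  rw [← (indepFun_iff_map_prod_eq_prod_map_map (hX i).aemeasurable (hX j).aemeasurable).1
    (hind.indepFun hij), Measure.map_apply ((hX i).prodMk (hX j)) hAm] at h0
  exact measure_eq_zero_iff_ae_notMem.1 h0

/-- The contribution of one label to the expected nearest response. -/
lemma integral_indicator_nearest (hX : ∀ i, Measurable (X i)) (hind : iIndepFun X P)
    (hlaw : ∀ i, P.map (X i) = P.map (X 0)) (hg : Measurable g)
    (hg1 : Integrable g (P.map (X 0))) {S : Finset ℕ} {i : ℕ} (hi : i ∈ S) :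
    ∫ ω, {ω | ∀ j ∈ S.erase i, ‖X i ω - x‖ < ‖X j ω - x‖}.indicator (fun ω => g (X i ω)) ω ∂P
      = ∫ y, g y * (1 - (P.map (X 0)).real (Metric.closedBall x ‖y - x‖)) ^ (S.card - 1)
          ∂(P.map (X 0)) := by
  classical
  set T := S.erase i with hT
  have hcard : T.card = S.card - 1 := Finset.card_erase_of_mem hi
  set ν := P.map (X 0) with hν
  have hνp : IsProbabilityMeasure ν := Measure.isProbabilityMeasure_map (hX 0).aemeasurable
  set Y : Ω → T → EuclideanSpace ℝ (Fin d) := fun ω j => X j ω with hYdef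
  have hY : Measurable Y := measurable_pi_lambda _ fun j => hX j
  have hYp : IsProbabilityMeasure (P.map Y) := Measure.isProbabilityMeasure_map hY.aemeasurable
  have hindY : IndepFun (X i) Y P := by
    have h := hind.indepFun_finset {i} T (by simp [hT]) hX
    exact h.comp (φ := fun a : (({i} : Finset ℕ) → EuclideanSpace ℝ (Fin d)) =>
      a ⟨i, Finset.mem_singleton_self i⟩) (ψ := id) (measurable_pi_apply _) measurable_id
  set A : Set (EuclideanSpace ℝ (Fin d) × (T → EuclideanSpace ℝ (Fin d))) :=
    {p | ∀ j : T, ‖p.1 - x‖ < ‖p.2 j - x‖} with hA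
  have hAm : MeasurableSet A := by
    have : A = ⋂ j : T, {p | ‖p.1 - x‖ < ‖p.2 j - x‖} := by ext p; simp [hA]
    rw [this]
    exact MeasurableSet.iInter fun j => measurableSet_lt (by fun_prop) (by fun_prop)
  have hlawprod : P.map (fun ω => (X i ω, Y ω)) = ν.prod (P.map Y) := by
    rw [(indepFun_iff_map_prod_eq_prod_map_map (hX i).aemeasurable hY.aemeasurable).1 hindY,
      hlaw i]
  have hgm : Measurable (A.indicator fun p => g p.1) := (hg.comp measurable_fst).indicator hAm
  have h1 : ∫ ω, {ω | ∀ j ∈ T, ‖X i ω - x‖ < ‖X j ω - x‖}.indicator (fun ω => g (X i ω)) ω ∂P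
      = ∫ p, A.indicator (fun p => g p.1) p ∂(ν.prod (P.map Y)) := by
    rw [← hlawprod, integral_map ((hX i).prodMk hY).aemeasurable hgm.aestronglyMeasurable]
    refine integral_congr_ae (ae_of_all _ fun ω => ?_)
    simp only [Set.indicator]
    congr 1
    simp [hA, hYdef]
  have hint : Integrable (A.indicator fun p => g p.1) (ν.prod (P.map Y)) :=
    (hg1.comp_fst (P.map Y)).indicator hAm
  rw [h1, integral_prod _ hint]
  refine integral_congr_ae (ae_of_all _ fun y => ?_)
  have hAy : MeasurableSet (Prod.mk y ⁻¹' A) := measurable_prodMk_left hAm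
  have h2 : (fun b => A.indicator (fun p => g p.1) (y, b))
      = (Prod.mk y ⁻¹' A).indicator fun _ => g y := by
    ext b; simp [Set.indicator]
  simp only
  rw [h2, integral_indicator_const _ hAy, smul_eq_mul, mul_comm]
  congr 1
  set B : Set (EuclideanSpace ℝ (Fin d)) := (Metric.closedBall x ‖y - x‖)ᶜ with hB
  have hBm : MeasurableSet B := Metric.isClosed_closedBall.measurableSet.compl
  have h3 : P (Y ⁻¹' (Prod.mk y ⁻¹' A)) = ∏ _j ∈ T, ν B := by
    have h4 := hind.measure_inter_preimage_eq_mul T (sets := fun _ => B) fun _ _ => hBm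
    have h5 : Y ⁻¹' (Prod.mk y ⁻¹' A) = ⋂ j ∈ T, X j ⁻¹' B := by
      ext ω
      simp [hA, hB, hYdef, dist_eq_norm]
    rw [h5, h4]
    refine Finset.prod_congr rfl fun j _ => ?_
    rw [← Measure.map_apply (hX j) hBm, hlaw j]
  have h6 : ν.real B = 1 - ν.real (Metric.closedBall x ‖y - x‖) :=
    probReal_compl_eq_one_sub Metric.isClosed_closedBall.measurableSet
  rw [measureReal_def, Measure.map_apply hY hAy, h3, Finset.prod_const, ENNReal.toReal_pow, hcard,
    ← measureReal_def, h6]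

/-- Ties being null, the response is almost surely a sum over labels of the event that the label is
strictly nearest, and all labels contribute equally. A point at `y` is nearest when the `S.card - 1`
others avoid the closed ball through `y`. -/
lemma integral_nearestResponse_eq (hX : ∀ i, Measurable (X i)) (hind : iIndepFun X P)
    (hlaw : ∀ i, P.map (X i) = P.map (X 0)) (hg : Measurable g)
    (hg1 : Integrable g (P.map (X 0)))
    (hsph : ∀ r, P.map (X 0) (Metric.sphere x r) = 0) (S : Finset ℕ) :
    ∫ ω, nearestResponse x S (fun i => (X i ω, g (X i ω))) ∂P
      = S.card * ∫ y, g y * (1 - (P.map (X 0)).real (Metric.closedBall x ‖y - x‖)) ^ (S.card - 1)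
          ∂(P.map (X 0)) := by
  have hae : ∀ᵐ ω ∂P, ∀ i ∈ S, ∀ j ∈ S, i ≠ j → ‖X i ω - x‖ ≠ ‖X j ω - x‖ := by
    refine (Finset.eventually_all S).2 fun i _ => (Finset.eventually_all S).2 fun j _ => ?_
    by_cases hij : i = j
    · exact ae_of_all _ fun ω h => absurd hij h
    · filter_upwards [ae_norm_sub_ne hX hind hlaw hsph hij] with ω h _ using h
  have h1 : (fun ω => nearestResponse x S fun i => (X i ω, g (X i ω))) =ᵐ[P] fun ω => ∑ i ∈ S,
      {ω | ∀ j ∈ S.erase i, ‖X i ω - x‖ < ‖X j ω - x‖}.indicator (fun ω => g (X i ω)) ω := by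
    filter_upwards [hae] with ω hω
    rw [nearestResponse_eq_sum]
    refine Finset.sum_congr rfl fun i hi => ?_
    simp only [Set.indicator, Set.mem_ofPred_eq]
    congr 1
    refine propext ⟨fun h j hj => ?_, fun h j hj => ?_⟩
    · have hj' := Finset.mem_erase.1 hj
      rcases distKey_le_iff.1 (h j hj'.2) with h | h
      · exact h
      · exact absurd h.1 (hω i hi j hj'.2 hj'.1.symm)
    · by_cases hji : j = i
      · rw [hji]
      · exact distKey_le_iff.2 (Or.inl (h j (Finset.mem_erase.2 ⟨hji, hj⟩)))
  rw [integral_congr_ae h1, integral_finsetSum]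
  · rw [Finset.sum_congr rfl fun i hi => integral_indicator_nearest hX hind hlaw hg hg1 hi,
      Finset.sum_const, nsmul_eq_mul]
  · intro i _
    have hgi : Integrable (fun ω => g (X i ω)) P := by
      rw [← hlaw i] at hg1
      exact (integrable_map_measure hg.aestronglyMeasurable (hX i).aemeasurable).1 hg1
    refine hgi.indicator ?_
    have : {ω | ∀ j ∈ S.erase i, ‖X i ω - x‖ < ‖X j ω - x‖}
        = ⋂ j ∈ S.erase i, {ω | ‖X i ω - x‖ < ‖X j ω - x‖} := by ext ω; simp
    rw [this]
    exact Finset.measurableSet_biInter _ fun j _ =>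
      measurableSet_lt ((hX i).sub_const x).norm ((hX j).sub_const x).norm

end Expectation

/-! ### From asymptotics of increments to an expansion with controlled remainder -/

section Increments

/-- After factoring out `s ^ (-a)`, this is minus the difference quotient of `y ^ (-a)` at `1` with
step `1 / s`. -/
lemma tendsto_rpow_mul_rpow_neg_sub {a : ℝ} :
    Tendsto (fun s : ℕ => (s : ℝ) ^ (a + 1) * ((s : ℝ) ^ (-a) - ((s + 1 : ℕ) : ℝ) ^ (-a))) atTop
      (𝓝 a) := by
  have h1 : HasDerivAt (fun y : ℝ => y ^ (-a)) (-a) 1 := by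
    have := Real.hasDerivAt_rpow_const (x := 1) (p := -a) (Or.inl one_ne_zero)
    simpa using this
  have h2 : Tendsto (fun s : ℕ => ((s : ℝ))⁻¹) atTop (𝓝[≠] 0) := by
    refine tendsto_nhdsWithin_iff.2 ⟨tendsto_inv_atTop_nhds_zero_nat, ?_⟩
    filter_upwards [eventually_gt_atTop 0] with s hs
    have : (0 : ℝ) < s := by exact_mod_cast hs
    exact (inv_pos.2 this).ne'
  have h3 := (h1.tendsto_slope_zero.comp h2).neg
  rw [neg_neg] at h3
  refine h3.congr' ?_
  filter_upwards [eventually_gt_atTop 0] with s hs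
  have hs0 : (0 : ℝ) < s := by exact_mod_cast hs
  have e : (1 + (s : ℝ)⁻¹) = ((s + 1 : ℕ) : ℝ) * (s : ℝ)⁻¹ := by push_cast; field_simp
  simp only [Function.comp_apply, inv_inv, smul_eq_mul, Real.one_rpow]
  rw [e, Real.mul_rpow (by positivity) (by positivity), Real.inv_rpow hs0.le,
    Real.rpow_neg hs0.le a, inv_inv, Real.rpow_add hs0, Real.rpow_one]
  have : (s : ℝ) ^ a ≠ 0 := (Real.rpow_pos_of_pos hs0 a).ne'
  field_simp
  ring

/-- A null sequence whose increments are asymptotic to a multiple of `s ^ (-a - 1)` is, up to a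
smaller error with small increments, a multiple of `s ^ (-a)`. -/
lemma exists_expansion_of_tendsto_increment {a ℓ : ℝ} (ha : 0 < a) {h : ℕ → ℝ}
    (h0 : Tendsto h atTop (𝓝 0))
    (hinc : Tendsto (fun s : ℕ => (s : ℝ) ^ (a + 1) * (h (s + 1) - h s)) atTop (𝓝 ℓ)) :
    ∃ β : ℝ, ∀ η > 0, ∃ N : ℕ, ∀ s t : ℕ, N ≤ s → s ≤ t →
      |(h t - β * (t : ℝ) ^ (-a)) - (h s - β * (s : ℝ) ^ (-a))|
        ≤ η * ((s : ℝ) ^ (-a) - (t : ℝ) ^ (-a)) ∧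
      |h s - β * (s : ℝ) ^ (-a)| ≤ η * (s : ℝ) ^ (-a) := by
  refine ⟨-ℓ / a, fun η hη => ?_⟩
  -- The increments of `s ^ (-a)` are asymptotic to `-a * s ^ (-a - 1)`, so this choice makes the
  -- rescaled increments of `R` tend to zero.
  set β := -ℓ / a with hβ
  set R : ℕ → ℝ := fun s => h s - β * (s : ℝ) ^ (-a) with hR
  have hδ := tendsto_rpow_mul_rpow_neg_sub (a := a)
  have hlim : Tendsto (fun s : ℕ => (s : ℝ) ^ (a + 1) * (R (s + 1) - R s)) atTop (𝓝 0) := by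
    have := hinc.add (hδ.const_mul β)
    have e : ℓ + β * a = 0 := by rw [hβ]; field_simp; ring
    rw [e] at this
    refine this.congr fun s => ?_
    rw [hR]; ring
  have hlim2 : Tendsto (fun s : ℕ => η * ((s : ℝ) ^ (a + 1) *
      ((s : ℝ) ^ (-a) - ((s + 1 : ℕ) : ℝ) ^ (-a))) - |(s : ℝ) ^ (a + 1) * (R (s + 1) - R s)|) atTop
      (𝓝 (η * a)) := by
    simpa using (hδ.const_mul η).sub hlim.abs
  obtain ⟨N, hN⟩ := eventually_atTop.1 ((hlim2.eventually_const_lt (show 0 < η * a by positivity)).and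
    (eventually_gt_atTop 0))
  have hstep : ∀ s, N ≤ s → |R (s + 1) - R s|
      ≤ η * ((s : ℝ) ^ (-a) - ((s + 1 : ℕ) : ℝ) ^ (-a)) := by
    intro s hs
    obtain ⟨h1, h2⟩ := hN s hs
    have hs0 : (0 : ℝ) < s := by exact_mod_cast h2
    have hp : 0 < (s : ℝ) ^ (a + 1) := Real.rpow_pos_of_pos hs0 _
    rw [abs_mul, abs_of_pos hp] at h1
    have h3 : (s : ℝ) ^ (a + 1) * |R (s + 1) - R s|
        ≤ (s : ℝ) ^ (a + 1) * (η * ((s : ℝ) ^ (-a) - ((s + 1 : ℕ) : ℝ) ^ (-a))) := by linarith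
    exact le_of_mul_le_mul_left h3 hp
  have hmain : ∀ s t : ℕ, N ≤ s → s ≤ t →
      |R t - R s| ≤ η * ((s : ℝ) ^ (-a) - (t : ℝ) ^ (-a)) := by
    intro s t hs hst
    induction t, hst using Nat.le_induction with
    | base => simp
    | succ t hst ih =>
      have h1 := hstep t (hs.trans hst)
      have h2 := abs_add_le (R (t + 1) - R t) (R t - R s)
      rw [sub_add_sub_cancel] at h2
      linarith
  refine ⟨N, fun s t hs hst => ⟨hmain s t hs hst, ?_⟩⟩
  -- Letting `t → ∞` in the increment bound, where `R t → 0`, bounds `R s` itself.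
  have hpow : Tendsto (fun t : ℕ => (t : ℝ) ^ (-a)) atTop (𝓝 0) :=
    (tendsto_rpow_neg_atTop ha).comp tendsto_natCast_atTop_atTop
  have hR0 : Tendsto R atTop (𝓝 0) := by simpa using h0.sub (hpow.const_mul β)
  have hl : Tendsto (fun t => |R t - R s|) atTop (𝓝 |R s|) := by
    simpa using (hR0.sub_const (R s)).abs
  have hr : Tendsto (fun t : ℕ => η * ((s : ℝ) ^ (-a) - (t : ℝ) ^ (-a))) atTop
      (𝓝 (η * (s : ℝ) ^ (-a))) := by
    simpa using (hpow.const_sub ((s : ℝ) ^ (-a))).const_mul η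
  exact le_of_tendsto_of_tendsto hl hr ((eventually_ge_atTop s).mono fun t ht => hmain s t hs ht)

end Increments

/-! ### Increments of the expected response as Laplace-type integrals -/

section Kernel

/-- The kernel representing the increments of the expected nearest response. -/
noncomputable def incrementKernel (r : ℕ) (u : ℝ) : ℝ :=
  (r + 2) * (1 - u) ^ r * (2 - (r + 3) * u)

lemma continuous_incrementKernel (r : ℕ) : Continuous (incrementKernel r) := by
  unfold incrementKernel; fun_prop

lemma integral_incrementKernel (r : ℕ) (a : ℝ) :
    ∫ u in a..1, incrementKernel r u = (1 - a) ^ (r + 1) * (1 - (r + 3) * a) := by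
  have hd : ∀ u ∈ Set.uIcc a 1, HasDerivAt (fun u : ℝ => -((1 - u) ^ (r + 1) * (1 - (r + 3) * u)))
      (incrementKernel r u) u := by
    intro u _
    have h1 : HasDerivAt (fun u : ℝ => 1 - u) (-1) u := by
      simpa using (hasDerivAt_id u).const_sub 1
    have h2 : HasDerivAt (fun u : ℝ => 1 - ((r : ℝ) + 3) * u) (-((r : ℝ) + 3)) u := by
      simpa using ((hasDerivAt_id u).const_mul ((r : ℝ) + 3)).const_sub 1
    have h3 := ((h1.pow (r + 1)).mul h2).neg
    refine h3.congr_deriv ?_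
    simp only [incrementKernel, Nat.add_sub_cancel, Pi.pow_apply]
    push_cast
    ring
  rw [intervalIntegral.integral_eq_sub_of_hasDerivAt hd
    ((continuous_incrementKernel r).intervalIntegrable _ _)]
  simp

variable {α : Type*} [MeasurableSpace α] {ν : Measure α} [IsFiniteMeasure ν]

/-- The increments of the expected nearest response in terms of partial expectations. -/
lemma integral_mul_eq_setIntegral_incrementKernel {m U : α → ℝ} (hm : Integrable m ν)
    (hU : Measurable U) (hU0 : ∀ y, 0 ≤ U y) (hU1 : ∀ y, U y ≤ 1) (r : ℕ) :
    ∫ y, m y * ((1 - U y) ^ (r + 1) * (1 - (r + 3) * U y)) ∂ν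
      = ∫ u in Set.Ioc 0 1, incrementKernel r u * ∫ y in {y | U y ≤ u}, m y ∂ν := by
  -- The factor in front of `m y` is written as the integral of the kernel from `U y` to `1`.
  -- Exchanging the integrals leaves the integral of `m` over a sublevel set of `U`.
  have hpt : ∀ y, m y * ((1 - U y) ^ (r + 1) * (1 - (r + 3) * U y))
      = ∫ u in Set.Ioc (0 : ℝ) 1, {p : α × ℝ | U p.1 ≤ p.2}.indicator
          (fun p => m p.1 * incrementKernel r p.2) (y, u) := by
    intro y
    have h1 : (fun u => {p : α × ℝ | U p.1 ≤ p.2}.indicator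
        (fun p => m p.1 * incrementKernel r p.2) (y, u))
        = (Set.Ici (U y)).indicator fun u => m y * incrementKernel r u := by
      ext u; simp [Set.indicator]
    rw [h1, setIntegral_indicator measurableSet_Ici, ← integral_incrementKernel,
      ← intervalIntegral.integral_const_mul, intervalIntegral.integral_of_le (hU1 y)]
    refine setIntegral_congr_set ?_
    have h2 : Set.Ioc (U y) 1 ⊆ Set.Ioc 0 1 ∩ Set.Ici (U y) := fun u hu =>
      ⟨⟨(hU0 y).trans_lt hu.1, hu.2⟩, hu.1.le⟩
    have h3 : Set.Ioc 0 1 ∩ Set.Ici (U y) ⊆ Set.Icc (U y) 1 := fun u hu => ⟨hu.2, hu.1.2⟩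
    exact (LE.le.eventuallyLE h2).antisymm
      ((LE.le.eventuallyLE h3).trans Ioc_ae_eq_Icc.symm.le)
  have hset : MeasurableSet {p : α × ℝ | U p.1 ≤ p.2} :=
    measurableSet_le (hU.comp measurable_fst) measurable_snd
  have hK : Integrable (incrementKernel r) (volume.restrict (Set.Ioc 0 1)) :=
    ((continuous_incrementKernel r).continuousOn.integrableOn_Icc (a := 0) (b := 1)).mono_set
      Set.Ioc_subset_Icc_self
  have hint : Integrable (Function.uncurry fun y u => {p : α × ℝ | U p.1 ≤ p.2}.indicator
      (fun p => m p.1 * incrementKernel r p.2) (y, u))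
      (ν.prod (volume.restrict (Set.Ioc 0 1))) := by
    have := (hm.mul_prod hK).indicator hset
    exact this
  simp_rw [hpt]
  rw [integral_integral_swap hint]
  refine integral_congr_ae (ae_of_all _ fun u => ?_)
  have hs : MeasurableSet {y | U y ≤ u} := measurableSet_le hU measurable_const
  have h1 : (fun y => {p : α × ℝ | U p.1 ≤ p.2}.indicator
      (fun p => m p.1 * incrementKernel r p.2) (y, u))
      = {y | U y ≤ u}.indicator fun y => incrementKernel r u * m y := by
    ext y; simp [Set.indicator, mul_comm]
  simp only
  rw [h1, integral_indicator hs, integral_const_mul]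

lemma measurable_setIntegral_le {m U : α → ℝ} (hm : Measurable m) (hU : Measurable U) :
    Measurable fun u : ℝ => ∫ y in {y | U y ≤ u}, m y ∂ν := by
  have h : (fun u : ℝ => ∫ y in {y | U y ≤ u}, m y ∂ν)
      = fun u : ℝ => ∫ y, {p : ℝ × α | U p.2 ≤ p.1}.indicator (fun p => m p.2) (u, y) ∂ν := by
    ext u
    have hs : MeasurableSet {y | U y ≤ u} := measurableSet_le hU measurable_const
    rw [← integral_indicator hs]
    congr 1
  rw [h]
  have hset : MeasurableSet {p : ℝ × α | U p.2 ≤ p.1} :=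
    measurableSet_le (hU.comp measurable_snd) measurable_fst
  have hmeas : Measurable ({p : ℝ × α | U p.2 ≤ p.1}.indicator fun p => m p.2) :=
    (hm.comp measurable_snd).indicator hset
  exact (hmeas.stronglyMeasurable.integral_prod_right' (ν := ν)).measurable

/-- Laplace-type asymptotics of integrals against `incrementKernel`. -/
lemma exists_tendsto_setIntegral_incrementKernel {a κ C : ℝ} (ha : 0 < a) {M : ℝ → ℝ}
    (hM : Measurable M) (hMlim : Tendsto (fun u => M u / u ^ (a + 1)) (𝓝[>] 0) (𝓝 κ))
    (hMC : ∀ u, |M u| ≤ C) :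
    ∃ ℓ : ℝ, Tendsto (fun r : ℕ => ((r : ℝ) + 2) ^ (a + 1) *
      ∫ u in Set.Ioc 0 1, incrementKernel r u * M u) atTop (𝓝 ℓ) := by
  have hC0 : 0 ≤ C := (abs_nonneg _).trans (hMC 0)
  -- The limit gives the power bound near zero; away from zero the uniform bound `C` gives it. A
  -- bound for all `u > 0` is needed for domination.
  obtain ⟨C', hC'0, hC'⟩ : ∃ C', 0 ≤ C' ∧ ∀ u > 0, |M u| ≤ C' * u ^ (a + 1) := by
    have h1 := hMlim.abs.eventually_lt_const (lt_add_one |κ|)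
    obtain ⟨δ, hδ, h2⟩ := mem_nhdsGT_iff_exists_Ioo_subset.1 h1
    have hδ' : (0 : ℝ) < δ := hδ
    have hp : 0 < δ ^ (a + 1) := Real.rpow_pos_of_pos hδ' _
    refine ⟨max (|κ| + 1) (C / δ ^ (a + 1)), le_max_of_le_left (by positivity), fun u hu => ?_⟩
    have hup : 0 < u ^ (a + 1) := Real.rpow_pos_of_pos hu _
    rcases lt_or_ge u δ with h | h
    · have h3 : |M u / u ^ (a + 1)| < |κ| + 1 := h2 ⟨hu, h⟩
      rw [abs_div, abs_of_pos hup, div_lt_iff₀ hup] at h3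
      exact h3.le.trans (mul_le_mul_of_nonneg_right (le_max_left _ _) hup.le)
    · have h3 : δ ^ (a + 1) ≤ u ^ (a + 1) := Real.rpow_le_rpow hδ'.le h (by linarith)
      calc |M u| ≤ C := hMC u
        _ = C / δ ^ (a + 1) * δ ^ (a + 1) := by field_simp
        _ ≤ C / δ ^ (a + 1) * u ^ (a + 1) := by gcongr
        _ ≤ _ := mul_le_mul_of_nonneg_right (le_max_right _ _) hup.le
  -- Substitution `v = (r + 2) * u`, with extension by zero beyond `r + 2`, puts all integrals on
  -- one half-line.
  set F : ℕ → ℝ → ℝ := fun r v => (Set.Iic ((r : ℝ) + 2)).indicator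
    (fun v => ((r : ℝ) + 2) ^ (a + 1) * ((1 - v / (r + 2)) ^ r * (2 - (r + 3) * (v / (r + 2)))
      * M (v / (r + 2)))) v with hF
  have hchange : ∀ r : ℕ, ((r : ℝ) + 2) ^ (a + 1) *
      ∫ u in Set.Ioc 0 1, incrementKernel r u * M u = ∫ v in Set.Ioi 0, F r v := by
    intro r
    have hs : (0 : ℝ) < (r : ℝ) + 2 := by positivity
    have h1 := integral_comp_mul_left_Ioi
      (fun u => (Set.Iic (1 : ℝ)).indicator (fun u => incrementKernel r u * M u) u) 0
      (inv_pos.2 hs)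
    rw [mul_zero, inv_inv, setIntegral_indicator measurableSet_Iic, Set.Ioi_inter_Iic,
      smul_eq_mul] at h1
    have h2 : ∀ v, F r v = ((r : ℝ) + 2) ^ (a + 1) * ((r : ℝ) + 2)⁻¹ * (Set.Iic (1 : ℝ)).indicator
        (fun u => incrementKernel r u * M u) (((r : ℝ) + 2)⁻¹ * v) := by
      intro v
      have hiff : ((r : ℝ) + 2)⁻¹ * v ∈ Set.Iic (1 : ℝ) ↔ v ∈ Set.Iic ((r : ℝ) + 2) := by
        rw [Set.mem_Iic, Set.mem_Iic, inv_mul_le_iff₀ hs, mul_one]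
      simp only [hF]
      by_cases hv : v ∈ Set.Iic ((r : ℝ) + 2)
      · rw [Set.indicator_of_mem hv, Set.indicator_of_mem (hiff.2 hv), incrementKernel,
          ← div_eq_inv_mul]
        field_simp
      · rw [Set.indicator_of_notMem hv, Set.indicator_of_notMem fun h => hv (hiff.1 h), mul_zero]
    simp_rw [h2]
    rw [integral_const_mul, h1]
    field_simp
  simp_rw [hchange]
  refine ⟨∫ v in Set.Ioi 0, Real.exp (-v) * (2 - v) * (κ * v ^ (a + 1)), ?_⟩
  -- The rate `1 / 3` comes from `r / (r + 2) ≥ 1 / 3` for `r ≥ 1`, applied to `(1 - v / (r + 2)) ^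
  -- r ≤ exp (-v * r / (r + 2))`.
  refine tendsto_integral_filter_of_dominated_convergence
    (fun v => Real.exp (-(1 / 3) * v) * (2 + 2 * v) * (C' * v ^ (a + 1))) ?_ ?_ ?_ ?_
  · refine Eventually.of_forall fun r => Measurable.aestronglyMeasurable ?_
    refine Measurable.indicator ?_ measurableSet_Iic
    have : Measurable fun v : ℝ => M (v / (r + 2)) := hM.comp (by fun_prop)
    fun_prop
  · filter_upwards [eventually_ge_atTop 1] with r hr
    have hs : (0 : ℝ) < (r : ℝ) + 2 := by positivity
    have hr1 : (1 : ℝ) ≤ r := by exact_mod_cast hr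
    filter_upwards [ae_restrict_mem measurableSet_Ioi] with v hv
    have hv0 : (0 : ℝ) < v := hv
    have hR : 0 ≤ Real.exp (-(1 / 3) * v) * (2 + 2 * v) * (C' * v ^ (a + 1)) := by positivity
    simp only [hF]
    by_cases hvs : v ∈ Set.Iic ((r : ℝ) + 2)
    · have hvs' : v ≤ (r : ℝ) + 2 := hvs
      rw [Set.indicator_of_mem hvs, Real.norm_eq_abs, abs_mul, abs_mul, abs_mul,
        abs_of_pos (Real.rpow_pos_of_pos hs _)]
      have hq0 : 0 ≤ v / ((r : ℝ) + 2) := by positivity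
      have hq1 : v / ((r : ℝ) + 2) ≤ 1 := (div_le_one hs).2 hvs'
      have e1 : |(1 - v / ((r : ℝ) + 2)) ^ r| ≤ Real.exp (-(1 / 3) * v) := by
        rw [abs_of_nonneg (pow_nonneg (by linarith) _)]
        calc (1 - v / ((r : ℝ) + 2)) ^ r ≤ (Real.exp (-(v / ((r : ℝ) + 2)))) ^ r := by
              exact pow_le_pow_left₀ (by linarith) (Real.one_sub_le_exp_neg _) r
          _ = Real.exp (-(v / ((r : ℝ) + 2)) * r) := by
              rw [← Real.exp_nat_mul]; ring_nf
          _ ≤ Real.exp (-(1 / 3) * v) := by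
              rw [Real.exp_le_exp]
              have : (1 / 3) * v ≤ v / ((r : ℝ) + 2) * r := by
                have h : v / ((r : ℝ) + 2) * r = v * r / ((r : ℝ) + 2) := by ring
                rw [h, le_div_iff₀ hs]
                nlinarith
              linarith
      have e2 : |2 - ((r : ℝ) + 3) * (v / ((r : ℝ) + 2))| ≤ 2 + 2 * v := by
        have : ((r : ℝ) + 3) * (v / ((r : ℝ) + 2)) ≤ 2 * v := by
          rw [← mul_div_assoc, div_le_iff₀ hs]
          nlinarith
        have h0 : 0 ≤ ((r : ℝ) + 3) * (v / ((r : ℝ) + 2)) := by positivity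
        exact abs_le.2 ⟨by linarith, by linarith⟩
      have e3 : ((r : ℝ) + 2) ^ (a + 1) * |M (v / ((r : ℝ) + 2))| ≤ C' * v ^ (a + 1) := by
        have h1 := hC' (v / ((r : ℝ) + 2)) (by positivity)
        rw [Real.div_rpow hv0.le hs.le] at h1
        have hp : 0 < ((r : ℝ) + 2) ^ (a + 1) := Real.rpow_pos_of_pos hs _
        calc ((r : ℝ) + 2) ^ (a + 1) * |M (v / ((r : ℝ) + 2))|
            ≤ ((r : ℝ) + 2) ^ (a + 1) * (C' * (v ^ (a + 1) / ((r : ℝ) + 2) ^ (a + 1))) := by gcongr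
          _ = C' * v ^ (a + 1) := by field_simp
      calc ((r : ℝ) + 2) ^ (a + 1) * (|(1 - v / ((r : ℝ) + 2)) ^ r|
            * |2 - ((r : ℝ) + 3) * (v / ((r : ℝ) + 2))| * |M (v / ((r : ℝ) + 2))|)
          = |(1 - v / ((r : ℝ) + 2)) ^ r| * |2 - ((r : ℝ) + 3) * (v / ((r : ℝ) + 2))|
            * (((r : ℝ) + 2) ^ (a + 1) * |M (v / ((r : ℝ) + 2))|) := by ring
        _ ≤ _ := by gcongr
    · rw [Set.indicator_of_notMem hvs, norm_zero]
      exact hR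
  · have h1 := integrableOn_rpow_mul_exp_neg_mul_rpow (p := 1) (s := a + 1) (b := 1 / 3)
      (by linarith) one_pos (by norm_num)
    have h2 := integrableOn_rpow_mul_exp_neg_mul_rpow (p := 1) (s := a + 2) (b := 1 / 3)
      (by linarith) one_pos (by norm_num)
    refine ((h1.const_mul (2 * C')).add (h2.const_mul (2 * C'))).congr ?_
    filter_upwards [ae_restrict_mem measurableSet_Ioi] with v hv
    have hv0 : (0 : ℝ) < v := hv
    have e : v ^ (a + 2) = v ^ (a + 1) * v := by
      rw [← Real.rpow_add_one hv0.ne']; congr 1; ring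
    simp only [Pi.add_apply, Real.rpow_one]
    rw [e]
    ring
  · filter_upwards [ae_restrict_mem measurableSet_Ioi] with v hv
    have hv0 : (0 : ℝ) < v := hv
    have hsinf : Tendsto (fun r : ℕ => (r : ℝ) + 2) atTop atTop :=
      tendsto_atTop_add_const_right _ _ tendsto_natCast_atTop_atTop
    have hq : Tendsto (fun r : ℕ => v / ((r : ℝ) + 2)) atTop (𝓝 0) := hsinf.const_div_atTop v
    have hqpos : Tendsto (fun r : ℕ => v / ((r : ℝ) + 2)) atTop (𝓝[>] 0) :=
      tendsto_nhdsWithin_iff.2 ⟨hq, Eventually.of_forall fun r => by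
        change 0 < v / ((r : ℝ) + 2); positivity⟩
    -- The exponential limit is available for the exponent `r + 2`; the two surplus factors tend to
    -- one and are divided out.
    have t1 : Tendsto (fun r : ℕ => (1 - v / ((r : ℝ) + 2)) ^ r) atTop (𝓝 (Real.exp (-v))) := by
      have h1 := (Real.tendsto_one_add_div_pow_exp (-v)).comp (tendsto_add_atTop_nat 2)
      have h2 : Tendsto (fun r : ℕ => (1 - v / ((r : ℝ) + 2)) ^ 2) atTop (𝓝 1) := by
        simpa using (hq.const_sub 1).pow 2
      have h3 := h1.div h2 one_ne_zero
      rw [div_one] at h3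
      refine h3.congr' ?_
      filter_upwards [hq.eventually_lt_const one_pos] with r hr
      have hne : (1 - v / ((r : ℝ) + 2)) ≠ 0 := by linarith
      simp only [Pi.div_apply, Function.comp_apply]
      push_cast
      rw [neg_div, ← sub_eq_add_neg, pow_add, mul_div_assoc, div_self (pow_ne_zero 2 hne), mul_one]
    have t2 : Tendsto (fun r : ℕ => 2 - ((r : ℝ) + 3) * (v / ((r : ℝ) + 2))) atTop
        (𝓝 (2 - v)) := by
      have h1 : Tendsto (fun r : ℕ => v + v / ((r : ℝ) + 2)) atTop (𝓝 v) := by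
        simpa using hq.const_add v
      refine (h1.const_sub 2).congr fun r => ?_
      have hs : (0 : ℝ) < (r : ℝ) + 2 := by positivity
      field_simp
      ring
    have t3 : Tendsto (fun r : ℕ => ((r : ℝ) + 2) ^ (a + 1) * M (v / ((r : ℝ) + 2))) atTop
        (𝓝 (κ * v ^ (a + 1))) := by
      refine ((hMlim.comp hqpos).mul_const (v ^ (a + 1))).congr fun r => ?_
      have hs : (0 : ℝ) < (r : ℝ) + 2 := by positivity
      have hp : 0 < ((r : ℝ) + 2) ^ (a + 1) := Real.rpow_pos_of_pos hs _
      have hvp : 0 < v ^ (a + 1) := Real.rpow_pos_of_pos hv0 _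
      simp only [Function.comp_apply]
      rw [Real.div_rpow hv0.le hs.le]
      field_simp
    refine ((t1.mul t2).mul t3).congr' ?_
    filter_upwards [hsinf.eventually_ge_atTop v] with r hr
    simp only [hF]
    rw [Set.indicator_of_mem (show v ∈ Set.Iic ((r : ℝ) + 2) from hr)]
    ring

end Kernel

/-! ### The radial distribution function -/

section RadialLaw

variable {E : Type*} [NormedAddCommGroup E] [MeasurableSpace E] [BorelSpace E]
variable {ν : Measure E} [IsFiniteMeasure ν] {x : E}

lemma continuous_measureReal_closedBall (hsph : ∀ r, ν (Metric.sphere x r) = 0) :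
    Continuous fun r : ℝ => ν.real (Metric.closedBall x r) := by
  have hF : (fun r : ℝ => ν.real (Metric.closedBall x r))
      = fun r => ∫ y, (Metric.closedBall x r).indicator (fun _ => (1 : ℝ)) y ∂ν := by
    ext r
    rw [integral_indicator Metric.isClosed_closedBall.measurableSet, setIntegral_const, smul_eq_mul,
      mul_one]
  rw [hF, continuous_iff_continuousAt]
  intro r
  refine continuousAt_of_dominated (bound := fun _ => 1) ?_ ?_ (integrable_const _) ?_
  · exact Eventually.of_forall fun r =>
      (measurable_const.indicator Metric.isClosed_closedBall.measurableSet).aestronglyMeasurable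
  · refine Eventually.of_forall fun r => Eventually.of_forall fun y => ?_
    by_cases h : y ∈ Metric.closedBall x r <;> simp [h]
  · have h : ∀ᵐ y ∂ν, y ∉ Metric.sphere x r := measure_eq_zero_iff_ae_notMem.1 (hsph r)
    filter_upwards [h] with y hy
    rcases lt_or_gt_of_ne (show dist y x ≠ r from hy) with h | h
    · refine (continuousAt_const (y := (1 : ℝ))).congr ?_
      filter_upwards [lt_mem_nhds h] with r' hr'
      rw [Set.indicator_of_mem]
      exact Metric.mem_closedBall.2 hr'.le
    · refine (continuousAt_const (y := (0 : ℝ))).congr ?_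
      filter_upwards [gt_mem_nhds h] with r' hr'
      rw [Set.indicator_of_notMem]
      exact fun h' => absurd (Metric.mem_closedBall.1 h') (not_le.2 hr')

/-- Small sublevel sets of the radial distribution function are balls. -/
lemma exists_sublevel_eq_closedBall (hsph : ∀ r, ν (Metric.sphere x r) = 0) {δ u : ℝ}
    (hδ : 0 < δ) (hu : 0 < u) (huδ : u < ν.real (Metric.closedBall x δ)) :
    ∃ r, 0 < r ∧ r < δ ∧ ν.real (Metric.closedBall x r) = u ∧
      {y | ν.real (Metric.closedBall x ‖y - x‖) ≤ u} = Metric.closedBall x r := by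
  set F : ℝ → ℝ := fun r => ν.real (Metric.closedBall x r) with hFdef
  have hF : Continuous F := continuous_measureReal_closedBall hsph
  have hmono : Monotone F := fun a b hab => measureReal_mono (Metric.closedBall_subset_closedBall hab)
  have hF0 : F 0 = 0 := by
    have h := hsph 0
    rw [Metric.sphere_zero] at h
    simp [hFdef, Measure.real, h]
  obtain ⟨r₀, hr₀, hr₀u⟩ : ∃ r ∈ Set.Icc 0 δ, F r = u :=
    intermediate_value_Icc hδ.le hF.continuousOn ⟨by rw [hF0]; exact hu.le, huδ.le⟩
  have hcomp : IsCompact (Set.Icc 0 δ ∩ F ⁻¹' {u}) :=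
    isCompact_Icc.inter_right (isClosed_singleton.preimage hF)
  -- The radial distribution function may be flat at level `u`; only the greatest radius of that
  -- level describes the whole sublevel set.
  obtain ⟨r, ⟨hr, hru⟩, hmax⟩ := hcomp.exists_isGreatest ⟨r₀, hr₀, hr₀u⟩
  have hru' : F r = u := hru
  have hlt : ∀ ρ, F ρ ≤ u → ρ < δ := fun ρ hρ => by
    by_contra h
    exact absurd (hmono (not_lt.1 h)) (not_le.2 (hρ.trans_lt huδ))
  refine ⟨r, ?_, hlt r hru'.le, hru', ?_⟩
  · refine lt_of_le_of_ne hr.1 fun h => ?_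
    rw [← h, hF0] at hru'
    exact hu.ne hru'
  · ext y
    rw [mem_closedBall_iff_norm]
    refine ⟨fun hy => ?_, fun hy => (hmono hy).trans hru'.le⟩
    have hy' : F ‖y - x‖ ≤ u := hy
    by_contra h
    have h := not_le.1 h
    exact absurd (hmax ⟨⟨norm_nonneg _, (hlt _ hy').le⟩,
      le_antisymm hy' (hru'.symm.le.trans (hmono h.le))⟩) (not_le.2 h)

end RadialLaw

/-! ### Integrals over balls of prescribed probability -/

section Density

variable {E : Type*} [NormedAddCommGroup E] [NormedSpace ℝ E] [FiniteDimensional ℝ E]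
variable [MeasurableSpace E] [BorelSpace E] {μ : Measure E} [μ.IsAddHaarMeasure]
variable {ν : Measure E} [IsFiniteMeasure ν] {f g : E → ℝ} {x : E}

-- If `f x < c`, then `f < c` on a neighbourhood by continuity. It has positive measure because `x`
-- is in the support, contradicting the almost sure bound.
omit [NormedSpace ℝ E] [FiniteDimensional ℝ E] [BorelSpace E] [IsFiniteMeasure ν] in
lemma le_of_mem_support_of_ae_le (hx : x ∈ ν.support) (hfc : ContinuousAt f x) {c : ℝ}
    (hc : ∀ᵐ y ∂ν, c ≤ f y) : c ≤ f x := by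
  by_contra h
  have h1 : {y | f y < c} ∈ 𝓝 x := hfc.eventually_lt_const (not_le.1 h)
  have h2 := (Measure.mem_support_iff_forall x).1 hx _ h1
  refine h2.ne' ?_
  simpa only [not_le] using ae_iff.1 hc

omit [NormedAddCommGroup E] [NormedSpace ℝ E] [FiniteDimensional ℝ E] [BorelSpace E]
  [μ.IsAddHaarMeasure] [IsFiniteMeasure ν] in
lemma setIntegral_eq_of_withDensity_ofReal (hf : Measurable f) (hf0 : ∀ y, 0 ≤ f y)
    (hν : ν = μ.withDensity fun y => ENNReal.ofReal (f y)) {A : Set E} (hA : MeasurableSet A)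
    (m : E → ℝ) : ∫ y in A, m y ∂ν = ∫ y in A, m y * f y ∂μ := by
  rw [hν, setIntegral_withDensity_eq_setIntegral_toReal_smul hf.ennreal_ofReal
    (Eventually.of_forall fun _ => ENNReal.ofReal_lt_top) _ hA]
  refine integral_congr_ae (Eventually.of_forall fun y => ?_)
  simp only [ENNReal.toReal_ofReal (hf0 y), smul_eq_mul]
  ring

/-- Around a point where the density is positive and both functions are `C²`, the integral of
`g - g x` over the `ν`-sublevel sets of the distance to `x` is of exact order `1 + 2 / dim`. -/
lemma exists_tendsto_setIntegral_sublevel_div [Nontrivial E] (hf : Measurable f)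
    (hf0 : ∀ y, 0 ≤ f y) (hν : ν = μ.withDensity fun y => ENNReal.ofReal (f y))
    (hfx : 0 < f x) (hfC : ContDiffAt ℝ 2 f x) (hgC : ContDiffAt ℝ 2 g x) (hgx : g x = 0) :
    ∃ κ : ℝ, Tendsto (fun u : ℝ =>
      (∫ y in {y | ν.real (Metric.closedBall x ‖y - x‖) ≤ u}, g y ∂ν)
        / u ^ (2 / (Module.finrank ℝ E : ℝ) + 1)) (𝓝[>] 0) (𝓝 κ) := by
  have hsph : ∀ r, ν (Metric.sphere x r) = 0 := fun r => by
    rw [hν]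
    exact withDensity_absolutelyContinuous _ _ (Measure.addHaar_sphere μ x r)
  set n := Module.finrank ℝ E with hn
  have hn0 : (0 : ℝ) < n := by exact_mod_cast Module.finrank_pos
  set F : ℝ → ℝ := fun r => ν.real (Metric.closedBall x r) with hFdef
  have hFint : ∀ r, F r = ∫ y in Metric.closedBall x r, f y ∂μ := fun r => by
    have h := setIntegral_eq_of_withDensity_ofReal hf hf0 hν
      (Metric.isClosed_closedBall (x := x) (ε := r)).measurableSet fun _ => 1
    simpa using h
  obtain ⟨κ₁, hκ₁⟩ := exists_tendsto_setIntegral_closedBall_div μ (hgC.mul hfC)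
    (by simp [hgx])
  have hcont : ∀ᶠ y in 𝓝 x, ContinuousAt f y := by
    filter_upwards [hfC.eventually (by simp)] with y hy
    exact hy.continuousAt
  have hκ₂ := tendsto_setIntegral_closedBall_div μ hcont
  set κ₂ := f x * μ.real (Metric.ball 0 1) with hκ₂def
  have hκ₂pos : 0 < κ₂ := by
    refine mul_pos hfx (ENNReal.toReal_pos ?_ measure_ball_lt_top.ne)
    exact (Metric.measure_ball_pos μ 0 one_pos).ne'
  have hlim : Tendsto (fun r : ℝ => (∫ y in Metric.closedBall x r, g y ∂ν) / F r ^ (2 / (n : ℝ) + 1))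
      (𝓝[>] 0) (𝓝 (κ₁ / κ₂ ^ (2 / (n : ℝ) + 1))) := by
    refine (hκ₁.div (hκ₂.rpow_const (Or.inl hκ₂pos.ne')) (Real.rpow_pos_of_pos hκ₂pos _).ne').congr' ?_
    filter_upwards [self_mem_nhdsWithin] with r hr
    have hr0 : (0 : ℝ) < r := hr
    simp only [Pi.div_apply]
    rw [← hFint r, ← hn, Real.div_rpow measureReal_nonneg (by positivity),
      setIntegral_eq_of_withDensity_ofReal hf hf0 hν Metric.isClosed_closedBall.measurableSet]
    -- The exponent `2 / n + 1` is the one for which a power of the ball's probability, of order `r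
    -- ^ n`, matches the order `r ^ (n + 2)` of the numerator.
    have h : (r ^ n) ^ (2 / (n : ℝ) + 1) = r ^ (n + 2) := by
      rw [← Real.rpow_natCast r n, ← Real.rpow_mul hr0.le, ← Real.rpow_natCast r (n + 2)]
      congr 1
      push_cast
      field_simp
      ring
    rw [h, div_div_div_cancel_right₀ (by positivity)]
  refine ⟨κ₁ / κ₂ ^ (2 / (n : ℝ) + 1), fun W hW => ?_⟩
  -- The radial distribution function need not be injective, so it is not inverted. Each small `u`
  -- gets some radius whose ball is the sublevel set and has mass `u`, and the limit in `r` is read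
  -- off there.
  obtain ⟨δ, hδ, hδW⟩ := mem_nhdsGT_iff_exists_Ioo_subset.1
    (inter_mem (hlim hW) ((hκ₂.eventually_const_lt hκ₂pos)))
  have hδ' : (0 : ℝ) < δ := hδ
  have hFδ : 0 < F (δ / 2) := by
    have h := (hδW ⟨half_pos hδ', half_lt_self hδ'⟩).2
    have h' : 0 < (∫ y in Metric.closedBall x (δ / 2), f y ∂μ) / (δ / 2) ^ n := h
    rw [← hFint] at h'
    exact (div_pos_iff_of_pos_right (by positivity)).1 h'
  rw [mem_map]
  filter_upwards [Ioo_mem_nhdsGT hFδ] with u hu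
  obtain ⟨r, hr0, hrδ, hru, hball⟩ :=
    exists_sublevel_eq_closedBall hsph (half_pos hδ') hu.1 hu.2
  have h := (hδW (show r ∈ Set.Ioo 0 δ from ⟨hr0, by linarith⟩)).1
  simp only [Set.mem_preimage, hFdef, hru] at h
  simpa only [Set.mem_preimage, hball] using h

end Density

/-! ### Expansion of the bias and cancellation of its leading term -/

section Bias

variable {d : ℕ} {x : EuclideanSpace ℝ (Fin d)}
variable {Ω : Type*} [MeasurableSpace Ω] {P : Measure Ω} [IsProbabilityMeasure P]
variable {X : ℕ → Ω → EuclideanSpace ℝ (Fin d)} {f g : EuclideanSpace ℝ (Fin d) → ℝ}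

/-- First-order expansion of the bias of the nearest neighbour response in the sample size,
together with control of the increments of the remainder. -/
lemma exists_expansion_integral_nearestResponse (hd : 0 < d) (hX : ∀ i, Measurable (X i))
    (hind : iIndepFun X P) (hlaw : ∀ i, P.map (X i) = P.map (X 0)) (hg : Measurable g)
    (hg2 : MemLp (fun ω => g (X 0 ω)) 2 P) (hx : x ∈ (P.map (X 0)).support)
    (hf : Measurable f) (hf0 : ∀ y, 0 ≤ f y)
    (hdens : P.map (X 0) = volume.withDensity fun y => ENNReal.ofReal (f y))
    (hfx : 0 < f x) (hfC : ContDiffAt ℝ 2 f x) (hgC : ContDiffAt ℝ 2 g x) (hgx : g x = 0) :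
    ∃ (h : ℕ → ℝ) (β : ℝ),
      (∀ S : Finset ℕ, ∫ ω, nearestResponse x S (fun i => (X i ω, g (X i ω))) ∂P = h S.card) ∧
      ∀ η > 0, ∃ N : ℕ, ∀ s t : ℕ, N ≤ s → s ≤ t →
        |(h t - β * (t : ℝ) ^ (-(2 / (d : ℝ)))) - (h s - β * (s : ℝ) ^ (-(2 / (d : ℝ))))|
          ≤ η * ((s : ℝ) ^ (-(2 / (d : ℝ))) - (t : ℝ) ^ (-(2 / (d : ℝ)))) ∧
        |h s - β * (s : ℝ) ^ (-(2 / (d : ℝ)))| ≤ η * (s : ℝ) ^ (-(2 / (d : ℝ))) := by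
  have : Nonempty (Fin d) := ⟨⟨0, hd⟩⟩
  have : IsProbabilityMeasure (P.map (X 0)) :=
    Measure.isProbabilityMeasure_map (hX 0).aemeasurable
  set ν := P.map (X 0) with hν
  have hsph : ∀ r, ν (Metric.sphere x r) = 0 := fun r => by
    rw [hdens]
    exact withDensity_absolutelyContinuous _ _ (Measure.addHaar_sphere volume x r)
  have hg1 : Integrable g ν :=
    (integrable_map_measure hg.aestronglyMeasurable (hX 0).aemeasurable).2
      (hg2.integrable (by norm_num))
  set U : EuclideanSpace ℝ (Fin d) → ℝ := fun y => ν.real (Metric.closedBall x ‖y - x‖) with hUdef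
  have hmono : Monotone fun r : ℝ => ν.real (Metric.closedBall x r) := fun a b hab =>
    measureReal_mono (Metric.closedBall_subset_closedBall hab)
  have hU : Measurable U := hmono.measurable.comp (by fun_prop)
  have hU0 : ∀ y, 0 ≤ U y := fun y => measureReal_nonneg
  have hU1 : ∀ y, U y ≤ 1 := fun y => measureReal_le_one
  set h : ℕ → ℝ := fun s => s * ∫ y, g y * (1 - U y) ^ (s - 1) ∂ν with hh
  have hS : ∀ S : Finset ℕ,
      ∫ ω, nearestResponse x S (fun i => (X i ω, g (X i ω))) ∂P = h S.card := fun S =>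
    integral_nearestResponse_eq hX hind hlaw hg hg1 hsph S
  have hpow : ∀ k : ℕ, Integrable (fun y => g y * (1 - U y) ^ k) ν := fun k => by
    refine hg1.mul_bdd (c := 1) (by fun_prop) (Eventually.of_forall fun y => ?_)
    rw [Real.norm_eq_abs, abs_of_nonneg (pow_nonneg (by linarith [hU1 y]) _)]
    exact pow_le_one₀ (by linarith [hU1 y]) (by linarith [hU0 y])
  have ha : (0 : ℝ) < 2 / d := by positivity
  have hM := exists_tendsto_setIntegral_sublevel_div hf hf0 hdens hfx hfC hgC hgx
  rw [finrank_euclideanSpace_fin] at hM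
  obtain ⟨κ, hκ⟩ := hM
  obtain ⟨ℓ, hℓ⟩ := exists_tendsto_setIntegral_incrementKernel ha
    (measurable_setIntegral_le hg hU) hκ (C := ∫ y, |g y| ∂ν) fun u => by
      refine (abs_integral_le_integral_abs).trans ?_
      exact setIntegral_le_integral hg1.abs (Eventually.of_forall fun y => abs_nonneg _)
  have hinc : Tendsto (fun s : ℕ => (s : ℝ) ^ (2 / (d : ℝ) + 1) * (h (s + 1) - h s)) atTop
      (𝓝 ℓ) := by
    -- The sample size is `s = r + 2`: then `(r + 3) * (1 - U) ^ (r + 2) - (r + 2) * (1 - U) ^ (r +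
    -- 1)` equals `(1 - U) ^ (r + 1) * (1 - (r + 3) * U)`, the form represented by `incrementKernel
    -- r`.
    rw [← tendsto_add_atTop_iff_nat 2]
    refine hℓ.congr fun r => ?_
    rw [← integral_mul_eq_setIntegral_incrementKernel hg1 hU hU0 hU1 r]
    push_cast
    congr 1
    simp only [hh]
    rw [← integral_const_mul, ← integral_const_mul,
      ← integral_sub ((hpow _).const_mul _) ((hpow _).const_mul _)]
    refine integral_congr_ae (Eventually.of_forall fun y => ?_)
    simp only [Nat.add_sub_cancel, show r + 2 - 1 = r + 1 by omega]
    push_cast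
    ring
  have h0 : Tendsto h atTop (𝓝 0) := by
    rw [Metric.tendsto_atTop]
    intro η hη
    obtain ⟨N, hN⟩ := exists_abs_integral_nearestResponse_le hX hind hlaw hg hg2 hx hgx
      hgC.continuousAt (half_pos hη)
    refine ⟨N, fun s hs => ?_⟩
    have := hN (Finset.range s) (by simpa using hs)
    rw [hS, Finset.card_range] at this
    rw [Real.dist_eq, sub_zero]
    linarith
  obtain ⟨β, hβ⟩ := exists_expansion_of_tendsto_increment ha h0 hinc
  exact ⟨h, β, hS, hβ⟩

omit [IsProbabilityMeasure P] in
lemma integral_dnn {z : ℕ → Ω → EuclideanSpace ℝ (Fin d) × ℝ} {s n : ℕ} {e : ℝ} (hsn : s ≤ n)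
    (hint : ∀ S : Finset ℕ, Integrable (fun ω => nearestResponse x S fun i => z i ω) P)
    (he : ∀ S : Finset ℕ, S.card = s → ∫ ω, nearestResponse x S (fun i => z i ω) ∂P = e) :
    ∫ ω, dnn n s x (fun i => z i ω) ∂P = e := by
  simp only [dnn]
  rw [integral_const_mul, integral_finsetSum _ fun S _ => hint S,
    Finset.sum_congr rfl fun S hS => he S (Finset.mem_powersetCard.1 hS).2, Finset.sum_const,
    Finset.card_powersetCard, Finset.card_range, nsmul_eq_mul, ← mul_assoc, inv_mul_cancel₀,
    one_mul]
  exact_mod_cast (Nat.choose_pos hsn).ne'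

omit [IsProbabilityMeasure P] in
lemma memLp_dnn {z : ℕ → Ω → EuclideanSpace ℝ (Fin d) × ℝ} {p : ENNReal} (n s : ℕ)
    (hz : ∀ S : Finset ℕ, MemLp (fun ω => nearestResponse x S fun i => z i ω) p P) :
    MemLp (fun ω => dnn n s x fun i => z i ω) p P :=
  (memLp_finsetSum _ fun S _ => hz S).const_mul _

omit [IsProbabilityMeasure P] in
lemma memLp_twoScaleDnn {z : ℕ → Ω → EuclideanSpace ℝ (Fin d) × ℝ} {p : ENNReal}
    (w w' : ℝ) (n s t : ℕ)
    (hz : ∀ S : Finset ℕ, MemLp (fun ω => nearestResponse x S fun i => z i ω) p P) :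
    MemLp (fun ω => twoScaleDnn w w' n s t x fun i => z i ω) p P :=
  ((memLp_dnn n s hz).const_mul w).add ((memLp_dnn n t hz).const_mul w')

/-- The second weight equation cancels the term in `β` exactly. What is left is `R t - w * (R t - R
s)`, and `-w * (s ^ (-2 / d) - t ^ (-2 / d)) = t ^ (-2 / d)` absorbs the size of `w`. -/
lemma exists_abs_integral_twoScaleDnn_le (hd : 0 < d) (hX : ∀ i, Measurable (X i))
    (hind : iIndepFun X P) (hlaw : ∀ i, P.map (X i) = P.map (X 0)) (hg : Measurable g)
    (hg2 : MemLp (fun ω => g (X 0 ω)) 2 P) (hx : x ∈ (P.map (X 0)).support)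
    (hf : Measurable f) (hf0 : ∀ y, 0 ≤ f y)
    (hdens : P.map (X 0) = volume.withDensity fun y => ENNReal.ofReal (f y))
    (hfx : 0 < f x) (hfC : ContDiffAt ℝ 2 f x) (hgC : ContDiffAt ℝ 2 g x) (hgx : g x = 0)
    {η : ℝ} (hη : 0 < η) :
    ∃ N, ∀ (s t n : ℕ) (w w' : ℝ), N ≤ s → s < t → t ≤ n → IsTwoScaleWeight d s t w w' →
      |∫ ω, twoScaleDnn w w' n s t x (fun i => (X i ω, g (X i ω))) ∂P|
        ≤ η * (t : ℝ) ^ (-(2 : ℝ) / (d : ℝ)) := by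
  obtain ⟨h, β, hS, hβ⟩ := exists_expansion_integral_nearestResponse hd hX hind hlaw hg hg2 hx hf
    hf0 hdens hfx hfC hgC hgx
  obtain ⟨N, hN⟩ := hβ (η / 2) (half_pos hη)
  refine ⟨N + 1, fun s t n w w' hNs hst htn hw => ?_⟩
  have hs : 1 ≤ s := by omega
  have hint2 : ∀ S : Finset ℕ, MemLp (fun ω => nearestResponse x S fun i =>
      (X i ω, g (X i ω))) 2 P := fun S =>
    (isNearestKernel_nearestResponse).memLp hX (fun i => hg.comp (hX i))
      (memLp_comp_of_map_eq hX hlaw hg hg2) S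
  have hint : ∀ S : Finset ℕ, Integrable (fun ω => nearestResponse x S fun i =>
      (X i ω, g (X i ω))) P := fun S => (hint2 S).integrable (by norm_num)
  have hD : ∀ s, Integrable (fun ω => dnn n s x fun i => (X i ω, g (X i ω))) P := fun s =>
    (memLp_dnn n s hint2).integrable (by norm_num)
  have hE : ∫ ω, twoScaleDnn w w' n s t x (fun i => (X i ω, g (X i ω))) ∂P
      = w * h s + w' * h t := by
    simp only [twoScaleDnn]
    rw [integral_add ((hD s).const_mul w) ((hD t).const_mul w'),
      integral_const_mul, integral_const_mul,
      integral_dnn (hst.le.trans htn) hint fun S hSs => (hS S).trans (by rw [hSs]),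
      integral_dnn htn hint fun S hSs => (hS S).trans (by rw [hSs])]
  have hwn := hw.nonpos hd hs hst
  have hws := hw.neg_mul_sub
  obtain ⟨hw1, hw2⟩ := hw
  obtain ⟨hR, -⟩ := hN s t (by omega) hst.le
  obtain ⟨-, hRt⟩ := hN t t (by omega) le_rfl
  rw [← neg_div] at hR hRt
  set A := (s : ℝ) ^ (-(2 : ℝ) / (d : ℝ))
  set B := (t : ℝ) ^ (-(2 : ℝ) / (d : ℝ))
  have hid : w * h s + w' * h t = (h t - β * B) + (-w) * ((h t - β * B) - (h s - β * A)) := by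
    linear_combination β * hw2 + (h t - β * B) * hw1
  rw [hE, hid]
  calc |(h t - β * B) + (-w) * ((h t - β * B) - (h s - β * A))|
      ≤ |h t - β * B| + |(-w) * ((h t - β * B) - (h s - β * A))| := abs_add_le _ _
    _ = |h t - β * B| + (-w) * |(h t - β * B) - (h s - β * A)| := by
        rw [abs_mul, abs_of_nonneg (neg_nonneg.2 hwn)]
    _ ≤ η / 2 * B + (-w) * (η / 2 * (A - B)) := by
        gcongr
        exact neg_nonneg.2 hwn
    _ = η / 2 * B + η / 2 * (-w * (A - B)) := by ring
    _ = η * B := by rw [hws]; ring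

end Bias

/-! ### Weight bounds without an order on the scales -/

section Symmetric

variable {d s t n : ℕ} {w w' : ℝ}

lemma IsTwoScaleWeight.rankWeight_bounds (h : IsTwoScaleWeight d s t w w') (hd : 0 < d)
    (hs : 1 ≤ s) (ht : 1 ≤ t) (hsn : 2 * s ≤ n) (htn : 2 * t ≤ n) :
    (∀ k < n, |twoScaleRankWeight w w' n s t k| ≤ (1 + d / 2) * ((max s t : ℕ) / n)) ∧
      ∑ k ∈ Finset.range n, twoScaleRankWeight w w' n s t k ^ 2
        ≤ (1 + d / 2) * (1 + d) * ((max s t : ℕ) / n) ∧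
      ((max s t : ℕ) : ℝ) / (8 * n)
        ≤ ∑ k ∈ Finset.range n, twoScaleRankWeight w w' n s t k ^ 2 := by
  rcases lt_or_gt_of_ne (h.ne hs) with hst | hst
  · rw [max_eq_right hst.le]
    exact ⟨fun k hk => abs_twoScaleRankWeight_le h hd hs hst (by omega) hk,
      sum_sq_twoScaleRankWeight_le h hd hs hst (by omega),
      le_sum_sq_twoScaleRankWeight h hd hs hst htn⟩
  · rw [max_eq_left hst.le]
    simp only [twoScaleRankWeight_symm (w := w) (w' := w')]
    exact ⟨fun k hk => abs_twoScaleRankWeight_le h.symm hd ht hst (by omega) hk,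
      sum_sq_twoScaleRankWeight_le h.symm hd ht hst (by omega),
      le_sum_sq_twoScaleRankWeight h.symm hd ht hst hsn⟩

end Symmetric

/-! ### Splitting into signal and noise -/

section Decomposition

variable {d : ℕ} {x : EuclideanSpace ℝ (Fin d)}
variable {Ω : Type*} [MeasurableSpace Ω] {P : Measure Ω} [IsProbabilityMeasure P]
variable {X : ℕ → Ω → EuclideanSpace ℝ (Fin d)} {f g : EuclideanSpace ℝ (Fin d) → ℝ}
variable {ε : ℕ → Ω → ℝ}

/-- The two-scale estimator splits into the value at `x`, the estimator of the centred
regression function, and a weighted sum of the noise. -/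
lemma twoScaleDnn_eq_add {w w' : ℝ} {n s t : ℕ} (h : IsTwoScaleWeight d s t w w') (hs : 1 ≤ s)
    (ht : 1 ≤ t) (hsn : s ≤ n) (htn : t ≤ n) (ξ : ℕ → EuclideanSpace ℝ (Fin d)) (e : ℕ → ℝ)
    (μ : EuclideanSpace ℝ (Fin d) → ℝ) :
    twoScaleDnn w w' n s t x (fun i => (ξ i, μ (ξ i) + e i))
      = μ x + twoScaleDnn w w' n s t x (fun i => (ξ i, μ (ξ i) - μ x))
        + ∑ i ∈ Finset.range n, twoScaleRankWeight w w' n s t (distRank x n ξ i) * e i := by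
  rw [twoScaleDnn_eq_sum hs ht, twoScaleDnn_eq_sum hs ht]
  have h1 : μ x = ∑ i ∈ Finset.range n,
      twoScaleRankWeight w w' n s t (distRank x n ξ i) * μ x := by
    rw [← Finset.sum_mul, sum_distRank, sum_twoScaleRankWeight h hs ht hsn htn, one_mul]
  conv_rhs => enter [1, 1]; rw [h1]
  rw [← Finset.sum_add_distrib, ← Finset.sum_add_distrib]
  refine Finset.sum_congr rfl fun i _ => ?_
  ring

lemma integrable_rankedSum_term (hX : ∀ i, Measurable (X i))
    (hproc : IndepFun (fun ω i => X i ω) (fun ω i => ε i ω) P) (h1 : ∀ i, Integrable (ε i) P)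
    {n i : ℕ} (hi : i < n) (c : ℕ → ℝ) :
    Integrable (fun ω => c (distRank x n (fun i => X i ω) i) * ε i ω) P ∧
      ∫ ω, c (distRank x n (fun i => X i ω) i) * ε i ω ∂P
        = (∫ ω, c (distRank x n (fun i => X i ω) i) ∂P) * ∫ ω, ε i ω ∂P := by
  have hc : Measurable fun ξ : ℕ → EuclideanSpace ℝ (Fin d) => c (distRank x n ξ i) :=
    (measurable_of_countable c).comp (measurable_distRank n i)
  have hcX : Measurable fun ω => c (distRank x n (fun i => X i ω) i) :=
    hc.comp (measurable_pi_lambda _ hX)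
  have hind : IndepFun (fun ω => c (distRank x n (fun i => X i ω) i)) (ε i) P :=
    hproc.comp hc (measurable_pi_apply i)
  refine ⟨hind.integrable_mul (Integrable.of_bound hcX.aestronglyMeasurable
    (∑ k ∈ Finset.range n, |c k|) (Eventually.of_forall fun ω => ?_)) (h1 i),
    hind.integral_fun_mul_eq_mul_integral hcX.aestronglyMeasurable (h1 i).aestronglyMeasurable⟩
  exact Finset.single_le_sum (f := fun k => |c k|) (fun k _ => abs_nonneg _)
    (Finset.mem_range.2 (distRank_lt hi))

lemma integral_rankedSum_eq_zero (hX : ∀ i, Measurable (X i))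
    (hproc : IndepFun (fun ω i => X i ω) (fun ω i => ε i ω) P) (h1 : ∀ i, Integrable (ε i) P)
    (h0 : ∀ i, ∫ ω, ε i ω ∂P = 0) (n : ℕ) (c : ℕ → ℝ) :
    ∫ ω, ∑ i ∈ Finset.range n, c (distRank x n (fun i => X i ω) i) * ε i ω ∂P = 0 := by
  rw [integral_finsetSum _ fun i hi =>
    (integrable_rankedSum_term hX hproc h1 (Finset.mem_range.1 hi) c).1]
  refine Finset.sum_eq_zero fun i hi => ?_
  rw [(integrable_rankedSum_term hX hproc h1 (Finset.mem_range.1 hi) c).2, h0, mul_zero]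

lemma exists_twoScaleDnn_mean_variance_le (hd : 0 < d) (hX : ∀ i, Measurable (X i))
    (hind : iIndepFun X P) (hlaw : ∀ i, P.map (X i) = P.map (X 0)) (hg : Measurable g)
    (hg2 : MemLp (fun ω => g (X 0 ω)) 2 P) (hx : x ∈ (P.map (X 0)).support)
    (hf : Measurable f) (hf0 : ∀ y, 0 ≤ f y)
    (hdens : P.map (X 0) = volume.withDensity fun y => ENNReal.ofReal (f y))
    (hfx : 0 < f x) (hfC : ContDiffAt ℝ 2 f x) (hgC : ContDiffAt ℝ 2 g x) (hgx : g x = 0)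
    {η : ℝ} (hη : 0 < η) :
    ∃ N, ∀ (s t n : ℕ) (w w' : ℝ), N ≤ s → N ≤ t → s ≤ n → t ≤ n → IsTwoScaleWeight d s t w w' →
      |∫ ω, twoScaleDnn w w' n s t x (fun i => (X i ω, g (X i ω))) ∂P|
        ≤ η * ((s : ℝ) ^ (-(2 : ℝ) / (d : ℝ)) + (t : ℝ) ^ (-(2 : ℝ) / (d : ℝ))) ∧
      variance (fun ω => twoScaleDnn w w' n s t x fun i => (X i ω, g (X i ω))) P
        ≤ η * ((max s t : ℕ) / n) := by
  obtain ⟨N₁, hN₁⟩ := exists_abs_integral_twoScaleDnn_le hd hX hind hlaw hg hg2 hx hf hf0 hdens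
    hfx hfC hgC hgx hη
  obtain ⟨N₂, hN₂⟩ := exists_variance_twoScaleDnn_le hd hX hind hlaw hg hg2 hx hgx
    hgC.continuousAt hη
  refine ⟨max 1 (max N₁ N₂), fun s t n w w' hs ht hsn htn h => ?_⟩
  simp only [max_le_iff] at hs ht
  have hs0 : (0 : ℝ) ≤ η * (s : ℝ) ^ (-(2 : ℝ) / (d : ℝ)) := by positivity
  have ht0 : (0 : ℝ) ≤ η * (t : ℝ) ^ (-(2 : ℝ) / (d : ℝ)) := by positivity
  rcases lt_or_gt_of_ne (h.ne hs.1) with hst | hst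
  · rw [max_eq_right hst.le]
    exact ⟨(hN₁ s t n w w' hs.2.1 hst htn h).trans (by linarith), hN₂ s t n w w' hs.2.2 hst htn h⟩
  · rw [max_eq_left hst.le]
    simp only [twoScaleDnn_symm (w := w) (w' := w')]
    exact ⟨(hN₁ t s n w' w ht.2.1 hst hsn h.symm).trans (by linarith),
      hN₂ t s n w' w ht.2.2 hst hsn h.symm⟩

/-- Normalised centred variables tend to `0` in probability when their variances do. -/
lemma tendstoInMeasure_zero_of_variance {T : ℕ → Ω → ℝ} {σ : ℕ → ℝ} (hT : ∀ n, MemLp (T n) 2 P)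
    (hσ : ∀ n, 0 < σ n)
    (h : Tendsto (fun n => variance (T n) P / σ n ^ 2) atTop (𝓝 0)) :
    TendstoInMeasure P (fun n ω => (T n ω - ∫ ω, T n ω ∂P) / σ n) atTop 0 := by
  rw [tendstoInMeasure_iff_norm]
  intro δ hδ
  have hlim : Tendsto (fun n => ENNReal.ofReal (variance (T n) P / σ n ^ 2 / δ ^ 2)) atTop (𝓝 0) := by
    have h' := ENNReal.tendsto_ofReal (h.div_const (δ ^ 2))
    rwa [zero_div, ENNReal.ofReal_zero] at h'
  refine tendsto_of_tendsto_of_tendsto_of_le_of_le tendsto_const_nhds hlim (fun _ => zero_le)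
    fun n => ?_
  have h1 := meas_ge_le_variance_div_sq (hT n) (mul_pos hδ (hσ n))
  rw [mul_pow, ← div_div, div_right_comm] at h1
  refine (measure_mono fun ω hω => ?_).trans h1
  have h2 : δ ≤ ‖(T n ω - ∫ ω, T n ω ∂P) / σ n - 0‖ := hω
  rw [sub_zero, norm_div, Real.norm_eq_abs, Real.norm_of_nonneg (hσ n).le, le_div_iff₀ (hσ n)] at h2
  exact h2

end Decomposition

/-! ### Assembly of the theorem -/

lemma IsLocallyC2.contDiffAt {d : ℕ} {g : EuclideanSpace ℝ (Fin d) → ℝ}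
    {x : EuclideanSpace ℝ (Fin d)} (h : IsLocallyC2 g x) : ContDiffAt ℝ 2 g x := by
  obtain ⟨U, hU, hxU, hg, -⟩ := h
  exact hg.contDiffAt (hU.mem_nhds hxU)

theorem theorem3 {d : ℕ} (hd : 0 < d)
    {Ω : Type*} [MeasurableSpace Ω] (P : Measure Ω) [IsProbabilityMeasure P]
    -- features, noises and responses; regression function, density, evaluation point
    (X : ℕ → Ω → EuclideanSpace ℝ (Fin d)) (ε Y : ℕ → Ω → ℝ)
    (μ f : EuclideanSpace ℝ (Fin d) → ℝ) (x : EuclideanSpace ℝ (Fin d))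
    (hX : ∀ i, Measurable (X i)) (hε : ∀ i, Measurable (ε i)) (hμ : Measurable μ)
    -- the model: `Y = μ(X) + ε`, noise independent of the feature, i.i.d. sample
    (hY : ∀ i ω, Y i ω = μ (X i ω) + ε i ω)
    (hXε : ∀ i, IndepFun (X i) (ε i) P)
    (hindep : iIndepFun (fun i ω => (X i ω, Y i ω)) P)
    (hident : ∀ i, IdentDistrib (fun ω => (X i ω, Y i ω)) (fun ω => (X 0 ω, Y 0 ω)) P P)
    -- the feature has density `f`, bounded away from `0` and `∞` on the feature distribution
    (hf : Measurable f) (hf_nonneg : ∀ y, 0 ≤ f y)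
    (hdens : P.map (X 0) = volume.withDensity (fun y => ENNReal.ofReal (f y)))
    (hbdd : ∃ c C : ℝ, 0 < c ∧ ∀ᵐ y ∂(P.map (X 0)), c ≤ f y ∧ f y ≤ C)
    (hx : x ∈ (P.map (X 0)).support)
    (hfC2 : IsLocallyC2 f x) (hμC2 : IsLocallyC2 μ x)
    -- moments
    (hY2 : MemLp (Y 0) 2 P) (hε2 : MemLp (ε 0) 2 P)
    (hε_mean : ∫ ω, ε 0 ω ∂P = 0) (hε_var : 0 < variance (ε 0) P)
    -- subsampling scales and weights
    (s₁ s₂ : ℕ → ℕ)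
    (hs₁ : Tendsto s₁ atTop atTop) (hs₂ : Tendsto s₂ atTop atTop)
    (hs₁n : Tendsto (fun n : ℕ => (s₁ n : ℝ) / (n : ℝ)) atTop (𝓝 0))
    (hs₂n : Tendsto (fun n : ℕ => (s₂ n : ℝ) / (n : ℝ)) atTop (𝓝 0))
    (w₁ w₂ : ℕ → ℝ)
    (hw : ∀ᶠ n in atTop, IsTwoScaleWeight d (s₁ n) (s₂ n) (w₁ n) (w₂ n)) :
    let D : ℕ → Ω → ℝ := fun n ω =>
      twoScaleDnn (w₁ n) (w₂ n) n (s₁ n) (s₂ n) x (fun i => (X i ω, Y i ω))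
    ∃ Λ σ : ℕ → ℝ,
      -- `Λ` is the bias of the two-scale estimator
      (∀ n, Integrable (D n) P ∧ ∫ ω, D n ω ∂P = μ x + Λ n) ∧
      Λ =o[atTop] (fun n : ℕ => (s₁ n : ℝ) ^ (-(2 : ℝ) / (d : ℝ)) +
        (s₂ n : ℝ) ^ (-(2 : ℝ) / (d : ℝ))) ∧
      (∀ n, 0 < σ n) ∧
      (fun n => σ n ^ 2) =O[atTop]
        (fun n : ℕ => (s₁ n : ℝ) / (n : ℝ) + (s₂ n : ℝ) / (n : ℝ)) ∧
      TendstoInDistribution (fun n ω => (D n ω - μ x - Λ n) / σ n) atTop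
        (id : ℝ → ℝ) (fun _ => P) (gaussianReal 0 1) := by 
  intro D
  set g : EuclideanSpace ℝ (Fin d) → ℝ := fun y => μ y - μ x with hgdef
  have hg : Measurable g := hμ.sub_const _
  have hgx : g x = 0 := sub_self _
  have hfC : ContDiffAt ℝ 2 f x := hfC2.contDiffAt
  have hgC : ContDiffAt ℝ 2 g x := hμC2.contDiffAt.sub contDiffAt_const
  have hfx : 0 < f x := by
    obtain ⟨c, C, hc, hb⟩ := hbdd
    exact hc.trans_le (le_of_mem_support_of_ae_le hx hfC.continuousAt (hb.mono fun _ h => h.1))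
  have hind : iIndepFun X P := hindep.comp (fun _ => Prod.fst) fun _ => measurable_fst
  have hφ : Measurable fun p : EuclideanSpace ℝ (Fin d) × ℝ => p.2 - μ p.1 := by fun_prop
  have hεY : ∀ i ω, ε i ω = Y i ω - μ (X i ω) := fun i ω => by rw [hY]; ring
  have hpair : iIndepFun (fun i ω => (X i ω, ε i ω)) P := by
    simp only [hεY]
    exact hindep.comp (fun _ p => (p.1, p.2 - μ p.1)) fun _ => measurable_fst.prodMk hφ
  have hindε : iIndepFun ε P := hpair.comp (fun _ => Prod.snd) fun _ => measurable_snd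
  have hlaw : ∀ i, P.map (X i) = P.map (X 0) := fun i => ((hident i).comp measurable_fst).map_eq
  have hidε : ∀ i, IdentDistrib (ε i) (ε 0) P P := fun i => by
    have h := (hident i).comp hφ
    have e : ∀ i, ((fun p : EuclideanSpace ℝ (Fin d) × ℝ => p.2 - μ p.1) ∘
        fun ω => (X i ω, Y i ω)) = ε i := fun i => funext fun ω => (hεY i ω).symm
    rwa [e, e] at h
  have hproc := indepFun_process_of_pairs hX hε hpair hXε
  have hε1 : ∀ i, Integrable (ε i) P := fun i =>
    (hidε i).integrable_iff.2 (hε2.integrable (by norm_num))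
  have hε0 : ∀ i, ∫ ω, ε i ω ∂P = 0 := fun i => (hidε i).integral_eq.trans hε_mean
  have hg2 : MemLp (fun ω => g (X 0 ω)) 2 P := by
    refine ((hY2.sub hε2).sub (memLp_const (μ x))).congr_norm
      (hg.comp (hX 0)).aestronglyMeasurable (Eventually.of_forall fun ω => ?_)
    simp only [Pi.sub_apply, hgdef, hY]
    ring_nf
  have hYm : ∀ i, Measurable (Y i) := fun i => by
    have e : Y i = fun ω => μ (X i ω) + ε i ω := funext (hY i)
    rw [e]
    exact (hμ.comp (hX i)).add (hε i)
  have hYL : ∀ i, MemLp (Y i) 2 P := fun i => ((hident i).comp measurable_snd).memLp_iff.2 hY2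
  have hDint : ∀ n, Integrable (D n) P := fun n =>
    (memLp_twoScaleDnn _ _ n _ _ fun S =>
      isNearestKernel_nearestResponse.memLp hX hYm hYL S).integrable (by norm_num)
  set T : ℕ → Ω → ℝ := fun n ω =>
    twoScaleDnn (w₁ n) (w₂ n) n (s₁ n) (s₂ n) x fun i => (X i ω, g (X i ω)) with hTdef
  have hT2 : ∀ n, MemLp (T n) 2 P := fun n => memLp_twoScaleDnn _ _ n _ _ fun S =>
    isNearestKernel_nearestResponse.memLp hX (fun i => hg.comp (hX i))
      (memLp_comp_of_map_eq hX hlaw hg hg2) S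
  set W : ℕ → ℕ → ℝ := fun n k => twoScaleRankWeight (w₁ n) (w₂ n) n (s₁ n) (s₂ n) k with hWdef
  set Z : ℕ → Ω → ℝ := fun n ω =>
    ∑ i ∈ Finset.range n, W n (distRank x n (fun i => X i ω) i) * ε i ω with hZdef
  have hZint : ∀ n, Integrable (Z n) P := fun n => integrable_finsetSum _ fun i hi =>
    (integrable_rankedSum_term hX hproc hε1 (Finset.mem_range.1 hi) (W n)).1
  have hZ0 : ∀ n, ∫ ω, Z n ω ∂P = 0 := fun n =>
    integral_rankedSum_eq_zero hX hproc hε1 hε0 n (W n)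
  -- Common order of magnitude of the largest rank weight and of the sum of squared rank weights.
  set m : ℕ → ℝ := fun n => ((max (s₁ n) (s₂ n) : ℕ) : ℝ) / n with hmdef
  have hhalf : ∀ s : ℕ → ℕ, Tendsto (fun n : ℕ => (s n : ℝ) / (n : ℝ)) atTop (𝓝 0) →
      ∀ᶠ n : ℕ in atTop, 2 * s n ≤ n := fun s hs => by
    filter_upwards [hs.eventually_lt_const (show (0 : ℝ) < 1 / 2 by norm_num),
      eventually_gt_atTop 0] with n hn hn0
    have hn0' : (0 : ℝ) < n := by exact_mod_cast hn0
    rw [div_lt_iff₀ hn0'] at hn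
    have : (2 * s n : ℝ) ≤ n := by linarith
    exact_mod_cast this
  have hgood : ∀ N : ℕ, ∀ᶠ n in atTop, (IsTwoScaleWeight d (s₁ n) (s₂ n) (w₁ n) (w₂ n) ∧
      1 ≤ s₁ n ∧ 1 ≤ s₂ n ∧ N ≤ s₁ n ∧ N ≤ s₂ n) ∧ 2 * s₁ n ≤ n ∧ 2 * s₂ n ≤ n ∧ 1 ≤ n :=
    fun N => by
      filter_upwards [hw, hs₁.eventually_ge_atTop (max 1 N), hs₂.eventually_ge_atTop (max 1 N),
        hhalf s₁ hs₁n, hhalf s₂ hs₂n, eventually_ge_atTop 1] with n h1 h2 h3 h4 h5 h6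
      exact ⟨⟨h1, by omega, by omega, by omega, by omega⟩, h4, h5, h6⟩
  have hm0 : Tendsto m atTop (𝓝 0) := by
    have h := hs₁n.max hs₂n
    rw [max_self] at h
    refine h.congr fun n => ?_
    rw [hmdef]
    push_cast
    exact (max_div_div_right n.cast_nonneg _ _)
  set v := variance (ε 0) P with hv
  set Q : ℕ → ℝ := fun n => ∑ k ∈ Finset.range n, W n k ^ 2 with hQdef
  have hQ0 : ∀ n, 0 ≤ Q n := fun n => Finset.sum_nonneg fun k _ => sq_nonneg _
  -- The noise alone fixes the scale: `v * Q n` is the variance of the weighted noise. The default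
  -- `1` keeps `σ` positive where `Q n = 0`, which happens for finitely many `n` only.
  set σ : ℕ → ℝ := fun n => if 0 < Q n then √(v * Q n) else 1 with hσdef
  have hσ : ∀ n, 0 < σ n := fun n => by
    simp only [hσdef]
    split_ifs with h
    · exact Real.sqrt_pos.2 (mul_pos hε_var h)
    · exact one_pos
  have hσsq : ∀ n, 0 < Q n → σ n ^ 2 = v * Q n := fun n h => by
    simp only [hσdef, if_pos h]
    exact Real.sq_sqrt (mul_pos hε_var h).le
  have hbounds : ∀ᶠ n in atTop, 0 < m n ∧ (∀ k < n, |W n k| ≤ (1 + d / 2) * m n) ∧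
      Q n ≤ (1 + d / 2) * (1 + d) * m n ∧ m n / 8 ≤ Q n := by
    filter_upwards [hgood 0] with n ⟨⟨h, h1, h2, _, _⟩, h3, h4, h5⟩
    obtain ⟨b1, b2, b3⟩ := h.rankWeight_bounds hd h1 h2 h3 h4
    refine ⟨?_, b1, b2, ?_⟩
    · have e1 : (0 : ℝ) < (max (s₁ n) (s₂ n) : ℕ) := by exact_mod_cast (by omega)
      have e2 : (0 : ℝ) < n := by exact_mod_cast h5
      exact div_pos e1 e2
    · rwa [hmdef, div_div, mul_comm (n : ℝ)]
  have hdecomp : ∀ᶠ n in atTop, (∀ ω, D n ω = μ x + T n ω + Z n ω) ∧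
      ∫ ω, D n ω ∂P - μ x = ∫ ω, T n ω ∂P := by
    filter_upwards [hgood 0] with n ⟨⟨h, h1, h2, _, _⟩, h3, h4, _⟩
    have e : ∀ ω, D n ω = μ x + T n ω + Z n ω := fun ω => by
      simp only [D, hY]
      exact twoScaleDnn_eq_add h h1 h2 (by omega) (by omega) (fun i => X i ω)
        (fun i => ε i ω) μ
    refine ⟨e, ?_⟩
    have hT1 : Integrable (T n) P := (hT2 n).integrable (by norm_num)
    rw [integral_congr_ae (Eventually.of_forall e),
      integral_add (f := fun ω => μ x + T n ω) ((integrable_const _).add hT1) (hZint n),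
      integral_add (integrable_const _) hT1, hZ0]
    simp
  refine ⟨fun n => ∫ ω, D n ω ∂P - μ x, σ, fun n => ⟨hDint n, by ring⟩, ?_, hσ, ?_, ?_⟩
  · rw [isLittleO_iff]
    intro η hη
    obtain ⟨N, hN⟩ := exists_twoScaleDnn_mean_variance_le hd hX hind hlaw hg hg2 hx hf hf_nonneg
      hdens hfx hfC hgC hgx hη
    filter_upwards [hgood N, hdecomp] with n ⟨⟨h, h1, h2, h3, h4⟩, h5, h6, _⟩ hD
    rw [hD.2, Real.norm_eq_abs, Real.norm_of_nonneg (by positivity)]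
    exact (hN _ _ n _ _ h3 h4 (by omega) (by omega) h).1
  · refine IsBigO.of_bound (v * ((1 + d / 2) * (1 + d))) ?_
    filter_upwards [hbounds] with n ⟨hm, _, hQ, hQ'⟩
    have hQpos : 0 < Q n := by linarith
    have hmle : m n ≤ (s₁ n : ℝ) / n + (s₂ n : ℝ) / n := by
      rw [← add_div]
      refine div_le_div_of_nonneg_right ?_ n.cast_nonneg
      exact_mod_cast max_le (Nat.le_add_right _ _) (Nat.le_add_left _ _)
    rw [hσsq n hQpos, Real.norm_of_nonneg (mul_pos hε_var hQpos).le,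
      Real.norm_of_nonneg (by positivity), mul_assoc v]
    exact mul_le_mul_of_nonneg_left (hQ.trans (by gcongr)) hε_var.le
  · have hclt := tendstoInDistribution_rankedSum (x := x) hX hε hindε (fun i => (hidε i).map_eq)
      hproc hε_mean hε2 hε_var (fun n k => W n k / σ n) ?_ ?_
    -- Slutsky's argument: the normalised estimator differs from the normalised noise by the centred
    -- `g` term over `σ n`, which tends to zero in probability.
    · refine tendstoInDistribution_of_tendstoInMeasure_sub _ _ hclt ?_ fun n =>
        (((hDint n).aestronglyMeasurable.aemeasurable.sub_const _).sub_const _).div_const _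
      have hvar : Tendsto (fun n => variance (T n) P / σ n ^ 2) atTop (𝓝 0) := by
        rw [Metric.tendsto_nhds]
        intro η hη
        -- Since `σ n ^ 2 = v * Q n ≥ v * m n / 8`, the constant `v * η / 16` makes the variance
        -- ratio at most `η / 2`.
        obtain ⟨N, hN⟩ := exists_twoScaleDnn_mean_variance_le hd hX hind hlaw hg hg2 hx hf hf_nonneg
          hdens hfx hfC hgC hgx (show 0 < v * η / 16 by positivity)
        filter_upwards [hgood N, hbounds] with n ⟨⟨h, h1, h2, h3, h4⟩, h5, h6, _⟩ ⟨hm, _, _, hQ'⟩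
        have hQpos : 0 < Q n := by linarith
        have hT := (hN _ _ n _ _ h3 h4 (by omega) (by omega) h).2
        have hT' : variance (T n) P ≤ v * η / 16 * m n := hT
        rw [Real.dist_eq, sub_zero, abs_of_nonneg (div_nonneg (variance_nonneg _ _) (sq_nonneg _)),
          hσsq n hQpos, div_lt_iff₀ (mul_pos hε_var hQpos)]
        have h7 : 0 < v * η * m n := by positivity
        have h8 : v * η * (m n / 8) ≤ v * η * Q n := by gcongr
        linarith
      refine (tendstoInMeasure_zero_of_variance hT2 hσ hvar).congr' ?_ (Eventually.of_forall fun _ => rfl)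
      filter_upwards [hdecomp] with n hn
      refine Eventually.of_forall fun ω => ?_
      simp only [Pi.sub_apply]
      rw [hn.1 ω, hn.2]
      simp only [div_mul_eq_mul_div]
      rw [← Finset.sum_div, ← sub_div]
      congr 1
      simp only [hZdef]
      ring
    · filter_upwards [hbounds] with n ⟨hm, _, _, hQ'⟩
      have hQpos : 0 < Q n := by linarith
      simp only [div_pow]
      rw [← Finset.sum_div, hσsq n hQpos]
      change v * (Q n / (v * Q n)) = 1
      have := hε_var.ne'
      field_simp
    · intro η hη
      set K : ℝ := 1 + d / 2 with hK
      have hlim : Tendsto (fun n => K ^ 2 * m n) atTop (𝓝 0) := by simpa using hm0.const_mul (K ^ 2)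
      filter_upwards [hbounds, hlim.eventually_lt_const (show 0 < η ^ 2 * v / 8 by positivity)]
        with n ⟨hm, hW, _, hQ'⟩ hsmall k hk
      have hQpos : 0 < Q n := by linarith
      rw [abs_div, abs_of_pos (hσ n), div_le_iff₀ (hσ n)]
      refine abs_le_of_sq_le_sq ?_ (mul_pos hη (hσ n)).le
      -- Squared weights are of order `m n ^ 2`, whereas `σ n ^ 2` is at least of order `m n`; the
      -- spare factor `m n` tends to zero.
      calc W n k ^ 2 ≤ (K * m n) ^ 2 := by
            rw [← sq_abs]
            exact pow_le_pow_left₀ (abs_nonneg _) (hW k hk) 2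
        _ = K ^ 2 * m n * m n := by ring
        _ ≤ η ^ 2 * v / 8 * m n := by gcongr
        _ = η ^ 2 * (v * (m n / 8)) := by ring
        _ ≤ η ^ 2 * (v * Q n) := by gcongr
        _ = (η * σ n) ^ 2 := by rw [mul_pow, hσsq n hQpos]
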